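/- Let $X$ be a connected complete metric space and let $\Sigma=\{p_1,\dots,p_m\}\subset X$, $m\ge 0$, be a finite set such that $X\setminus\Sigma$ is a smooth flat hyperkähler $4$-manifold with nonempty boundary $\partial X$, and the metric of $X$ restricted to $X\setminus\Sigma$ is the length metric of its Riemannian metric. (Hyperkähler means that there are three orthogonal almost complex structures $J_1,J_2,J_3$ on $X\setminus\Sigma$, parallel for the Levi-Civita connection, with $J_1J_2=J_3=-J_2J_1$.) Suppose that the boundary is totally geodesic and that each connected component of $\partial X$, with its induced Riemannian metric, is isometric to flat $\mathbb R^3$. Suppose also that $X\setminus\partial X$ is a flat hyperkähler $4$-orbifold whose set of orbifold points is $\Sigma$; that is, each $p\in\Sigma$ has a neighbourhood which is the quotient of a ball about $0$ in Euclidean $\mathbb R^4$ by a nontrivial finite group of linear isometries, with $0$ mapping to $p$ and with the quotient map being a smooth local isometry into $X\setminus\Sigma$ away from $0$. Let $n$ be the number of connected components of $\partial X$. Then $X$ is isometric, as a metric space, to one of the following: 1. ($m=0$, $n=1$) the closed half-space $\mathbb R^4_+$; 2. ($m=0$, $n=2$) the closed region in $\mathbb R^4$ bounded by two distinct parallel hyperplanes;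 3. ($m=1$, $n=1$) the closure of the connected component of the image of $0$ in $(\mathbb R^4/\mathbb Z_2)\setminus \overline{H}$, where $\mathbb Z_2$ acts on $\mathbb R^4$ by $x\mapsto -x$, $\mathbb R^4/\mathbb Z_2$ has the quotient metric, and $\overline{H}$ is the image of a hyperplane $H\subset\mathbb R^4$ with $0\notin H$. -/

import Mathlib

open Set Filter Topology Bundle
open scoped Manifold ContDiff

noncomputable section

namespace FlatOrbifold

/-- Euclidean `3`-space. -/
abbrev E3 : Type := EuclideanSpace ℝ (Fin 3)

/-- Euclidean `4`-space. -/
abbrev E4 : Type := EuclideanSpace ℝ (Fin 4)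

/-! ### Riemannian geometry of a `4`-manifold with boundary -/

section Riemannian

/- `M` is a smooth `4`-manifold with (possibly empty) boundary, with a smooth Riemannian metric. -/
variable {M : Type*} [TopologicalSpace M] [ChartedSpace (EuclideanHalfSpace 4) M]
  [IsManifold (𝓡∂ 4) ∞ M]
  [RiemannianBundle (fun x : M => TangentSpace (𝓡∂ 4) x)]
  [IsContMDiffRiemannianBundle (𝓡∂ 4) ∞ E4 (fun x : M => TangentSpace (𝓡∂ 4) x)]

/-- The vector field `V` is smooth. -/
def SmoothField {M : Type*} [TopologicalSpace M] [ChartedSpace (EuclideanHalfSpace 4) M]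
    [IsManifold (𝓡∂ 4) ∞ M] (V : (x : M) → TangentSpace (𝓡∂ 4) x) : Prop :=
  ContMDiff (𝓡∂ 4) (𝓡∂ 4).tangent ∞ (fun x => (⟨x, V x⟩ : TangentBundle (𝓡∂ 4) M))

/-- `D` is the Levi-Civita connection `∇`: it is torsion free, `∇_V W - ∇_W V = [V, W]`, and
compatible with the metric, `U⟨V, W⟩ = ⟨∇_U V, W⟩ + ⟨V, ∇_U W⟩`.
Mathlib writes `D W x v` for the value at `x` of the derivative of `W` in the direction `v`. -/
def IsLeviCivita (D : CovariantDerivative (𝓡∂ 4) E4 (fun x : M => TangentSpace (𝓡∂ 4) x)) :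
    Prop :=
  haveI : IsContMDiffRiemannianBundle (𝓡∂ 4) 1 E4 (fun x : M => TangentSpace (𝓡∂ 4) x) :=
    IsContMDiffRiemannianBundle.of_le (n := ∞) (by exact_mod_cast le_top)
  D.torsion = 0 ∧ D.IsMetricCompatible

/-- The curvature tensor of `∇` vanishes:
`∇_U ∇_V W - ∇_V ∇_U W - ∇_{[U,V]} W = 0` for all smooth vector fields. -/
def IsFlat {M : Type*} [TopologicalSpace M] [ChartedSpace (EuclideanHalfSpace 4) M]
    [IsManifold (𝓡∂ 4) ∞ M]
    (D : CovariantDerivative (𝓡∂ 4) E4 (fun x : M => TangentSpace (𝓡∂ 4) x)) : Prop :=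
  ∀ U V W : (x : M) → TangentSpace (𝓡∂ 4) x,
    SmoothField U → SmoothField V → SmoothField W → ∀ x : M,
      D (fun y => D W y (V y)) x (U x) - D (fun y => D W y (U y)) x (V x)
        - D W x (VectorField.mlieBracket (𝓡∂ 4) U V x) = 0

/-- The metric with Levi-Civita connection `∇` is hyperkähler: there are three smooth, orthogonal,
`∇`-parallel almost complex structures that satisfy the quaternion relations
(that is, the holonomy group is contained in `Sp(1) = SU(2)`). -/
def IsHyperkahler (D : CovariantDerivative (𝓡∂ 4) E4 (fun x : M => TangentSpace (𝓡∂ 4) x)) :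
    Prop :=
  ∃ J : Fin 3 → (x : M) → TangentSpace (𝓡∂ 4) x →L[ℝ] TangentSpace (𝓡∂ 4) x,
    (∀ a x v, J a x (J a x v) = -v) ∧
    (∀ x v, J 0 x (J 1 x v) = J 2 x v) ∧
    (∀ x v, J 1 x (J 0 x v) = -J 2 x v) ∧
    (∀ a x v w, inner ℝ (J a x v) (J a x w) = inner ℝ v w) ∧
    (∀ a (V : (x : M) → TangentSpace (𝓡∂ 4) x),
      SmoothField V → SmoothField (fun x => J a x (V x))) ∧
    (∀ a (V : (x : M) → TangentSpace (𝓡∂ 4) x), SmoothField V →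
      ∀ x v, D (fun y => J a y (V y)) x v = J a x (D V x v))

/-- The vector `v` at the boundary point `x` is tangent to the boundary: its component along the
coordinate that defines the boundary is zero. -/
def TangentToBoundary {M : Type*} [TopologicalSpace M] [ChartedSpace (EuclideanHalfSpace 4) M]
    (x : M) (v : TangentSpace (𝓡∂ 4) x) : Prop :=
  letI w : E4 := mfderiv (𝓡∂ 4) 𝓘(ℝ, E4) (extChartAt (𝓡∂ 4) x) x v
  w 0 = 0

/-- The boundary is totally geodesic: its second fundamental form vanishes, that is,
`∇_V W` is tangent to the boundary whenever `V` and `W` are. -/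
def HasTotallyGeodesicBoundary {M : Type*} [TopologicalSpace M]
    [ChartedSpace (EuclideanHalfSpace 4) M] [IsManifold (𝓡∂ 4) ∞ M]
    (D : CovariantDerivative (𝓡∂ 4) E4 (fun x : M => TangentSpace (𝓡∂ 4) x)) : Prop :=
  ∀ V W : (x : M) → TangentSpace (𝓡∂ 4) x, SmoothField V → SmoothField W →
    (∀ x ∈ (𝓡∂ 4).boundary M, TangentToBoundary x (V x) ∧ TangentToBoundary x (W x)) →
    ∀ x ∈ (𝓡∂ 4).boundary M, TangentToBoundary x (D W x (V x))

/-- The set of connected components of the boundary. -/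
def boundaryComponents (M : Type*) [TopologicalSpace M] [ChartedSpace (EuclideanHalfSpace 4) M] :
    Set (Set M) :=
  (fun x => connectedComponentIn ((𝓡∂ 4).boundary M) x) '' (𝓡∂ 4).boundary M

/-- The boundary component `Y`, with the Riemannian metric induced from `M`, is isometric to flat
`ℝ³`: there is a bijection `ℝ³ → Y` that is smooth and whose differential preserves lengths. -/
def IsFlatR3 {M : Type*} [TopologicalSpace M] [ChartedSpace (EuclideanHalfSpace 4) M]
    [RiemannianBundle (fun x : M => TangentSpace (𝓡∂ 4) x)] (Y : Set M) : Prop :=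
  ∃ f : E3 → M, ContMDiff 𝓘(ℝ, E3) (𝓡∂ 4) ∞ f ∧ Function.Injective f ∧ range f = Y ∧
    ∀ (u v : E3), ‖mfderiv 𝓘(ℝ, E3) (𝓡∂ 4) f u v‖ = ‖v‖

end Riemannian

/-! ### Orbifolds -/

/-- The complement of the finite set `S` of orbifold points. -/
abbrev Reg {X : Type*} (S : Finset X) : Type _ := {x : X // x ∉ S}

/-- `p` is an orbifold point of the flat space `X` with set of orbifold points `S`: a neighbourhood
of `p` is the quotient of a Euclidean ball about `0` by a finite nontrivial group `G` of linear
isometries. The quotient map `q` sends `0` to `p`, is continuous and open, has the `G`-orbits as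
fibres, and is a smooth local isometry into `X \ S` away from `0`. (If `X \ S` is hyperkähler, then
its parallel complex structures pull back to constant `G`-invariant ones on the ball, so that `G`
lies in a copy of `SU(2)`.) -/
def IsFlatOrbifoldPoint {X : Type*} [MetricSpace X] (S : Finset X)
    [ChartedSpace (EuclideanHalfSpace 4) (Reg S)]
    [RiemannianBundle (fun x : Reg S => TangentSpace (𝓡∂ 4) x)] (p : X) : Prop :=
  ∃ (r : ℝ) (G : Subgroup (E4 ≃ₗᵢ[ℝ] E4)) (q : E4 → X) (s : E4 → Reg S),
    0 < r ∧ Finite G ∧ G ≠ ⊥ ∧ q 0 = p ∧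
    ContinuousOn q (Metric.ball 0 r) ∧
    (∀ W ⊆ Metric.ball (0 : E4) r, IsOpen W → IsOpen (q '' W)) ∧
    (∀ x ∈ Metric.ball (0 : E4) r, ∀ y ∈ Metric.ball (0 : E4) r,
      q x = q y ↔ ∃ g ∈ G, g x = y) ∧
    (∀ x ∈ Metric.ball (0 : E4) r, x ≠ 0 →
      (s x : X) = q x ∧ ContMDiffAt 𝓘(ℝ, E4) (𝓡∂ 4) ∞ s x ∧
        ∀ v : E4, ‖mfderiv 𝓘(ℝ, E4) (𝓡∂ 4) s x v‖ = ‖v‖)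

/-- `X` is a connected complete flat hyperkähler `4`-orbifold with boundary and with finite set of
orbifold points `S`; its metric is the length metric of the Riemannian metric on `X \ S`. The
boundary is nonempty and totally geodesic, and each of its components is isometric to flat `ℝ³`. -/
structure IsFlatHyperkahlerOrbifold {X : Type*} [MetricSpace X] (S : Finset X)
    [ChartedSpace (EuclideanHalfSpace 4) (Reg S)] [IsManifold (𝓡∂ 4) ∞ (Reg S)]
    [RiemannianBundle (fun x : Reg S => TangentSpace (𝓡∂ 4) x)]
    [IsContMDiffRiemannianBundle (𝓡∂ 4) ∞ E4 (fun x : Reg S => TangentSpace (𝓡∂ 4) x)] :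
    Prop where
  connected : ConnectedSpace X
  complete : CompleteSpace X
  riemannian : IsRiemannianManifold (𝓡∂ 4) (Reg S)
  flat_hyperkahler : ∃ D : CovariantDerivative (𝓡∂ 4) E4 (fun x : Reg S => TangentSpace (𝓡∂ 4) x),
    IsLeviCivita D ∧ IsFlat D ∧ IsHyperkahler D ∧ HasTotallyGeodesicBoundary D
  boundary_nonempty : ((𝓡∂ 4).boundary (Reg S)).Nonempty
  boundary_flat : ∀ Y ∈ boundaryComponents (Reg S), IsFlatR3 Y
  orbifold_points : ∀ p ∈ S, IsFlatOrbifoldPoint S p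

/-! ### The three models -/

/-- The closed half-space `ℝ⁴₊`. -/
def halfSpace : Set E4 := {x | 0 ≤ x 0}

/-- The closed region between the parallel hyperplanes `⟪b, x⟫ = c₁` and `⟪b, x⟫ = c₂`. -/
def slab (b : E4) (c₁ c₂ : ℝ) : Set E4 := {x | c₁ ≤ inner ℝ b x ∧ inner ℝ b x ≤ c₂}

/-- The equivalence relation `x ∼ ±x` on `ℝ⁴`. -/
def signSetoid : Setoid E4 where
  r x y := x = y ∨ x = -y
  iseqv :=
    { refl := fun _ => Or.inl rfl
      symm := by
        rintro x y (h | h)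
        · exact Or.inl h.symm
        · exact Or.inr (by rw [h, neg_neg])
      trans := by
        rintro x y z (rfl | rfl) (rfl | rfl)
        · exact Or.inl rfl
        · exact Or.inr rfl
        · exact Or.inr rfl
        · exact Or.inl (neg_neg _) }

/-- The orbifold `ℝ⁴ / ℤ₂`, where the generator of `ℤ₂` acts by `x ↦ -x`. -/
def R4modZ2 : Type := Quotient signSetoid

/-- The projection `ℝ⁴ → ℝ⁴ / ℤ₂`. -/
def R4modZ2.mk (x : E4) : R4modZ2 := Quotient.mk signSetoid x

/-- The quotient metric on `ℝ⁴ / ℤ₂`: the distance of `[x]` and `[y]` is the distance of the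
orbits `{x, -x}` and `{y, -y}`. -/
instance : MetricSpace R4modZ2 where
  dist := Quotient.lift₂ (fun x y => min ‖x - y‖ ‖x + y‖) (by
    rintro x y x' y' (rfl | rfl) (rfl | rfl)
    · rfl
    · rw [sub_neg_eq_add, ← sub_eq_add_neg, min_comm]
    · rw [← norm_neg (-x' - y), ← norm_neg (-x' + y), min_comm]
      congr 2 <;> abel
    · rw [← norm_neg (-x' - -y'), ← norm_neg (-x' + -y')]
      congr 2 <;> abel)
  dist_self := by
    rintro ⟨x⟩
    change min ‖x - x‖ ‖x + x‖ = 0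
    simp
  dist_comm := by
    rintro ⟨x⟩ ⟨y⟩
    change min ‖x - y‖ ‖x + y‖ = min ‖y - x‖ ‖y + x‖
    rw [norm_sub_rev, add_comm]
  dist_triangle := by
    rintro ⟨x⟩ ⟨y⟩ ⟨z⟩
    change min ‖x - z‖ ‖x + z‖ ≤ min ‖x - y‖ ‖x + y‖ + min ‖y - z‖ ‖y + z‖
    have h1 : ‖x - z‖ ≤ ‖x - y‖ + ‖y - z‖ := by
      simpa using norm_add_le (x - y) (y - z)
    have h2 : ‖x + z‖ ≤ ‖x - y‖ + ‖y + z‖ := by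
      calc ‖x + z‖ = ‖(x - y) + (y + z)‖ := by congr 1; abel
        _ ≤ _ := norm_add_le _ _
    have h3 : ‖x + z‖ ≤ ‖x + y‖ + ‖y - z‖ := by
      calc ‖x + z‖ = ‖(x + y) - (y - z)‖ := by congr 1; abel
        _ ≤ _ := norm_sub_le _ _
    have h4 : ‖x - z‖ ≤ ‖x + y‖ + ‖y + z‖ := by
      calc ‖x - z‖ = ‖(x + y) - (y + z)‖ := by congr 1; abel
        _ ≤ _ := norm_sub_le _ _
    rcases min_choice ‖x - y‖ ‖x + y‖ with h | h <;>
      rcases min_choice ‖y - z‖ ‖y + z‖ with h' | h' <;> rw [h, h'] <;>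
      simp only [min_le_iff, h1, h2, h3, h4, true_or, or_true]
  eq_of_dist_eq_zero := by
    rintro ⟨x⟩ ⟨y⟩ h
    change min ‖x - y‖ ‖x + y‖ = 0 at h
    apply Quotient.sound
    rcases min_choice ‖x - y‖ ‖x + y‖ with h' | h' <;> rw [h', norm_eq_zero] at h
    · exact Or.inl (sub_eq_zero.mp h)
    · exact Or.inr (eq_neg_of_add_eq_zero_left h)

/-- For the hyperplane `H = {x | ⟪b, x⟫ = c}`: the closure of the connected component of the image
of `0` in the complement of the image of `H` in `ℝ⁴ / ℤ₂`. -/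
def halfSlabQuotient (b : E4) (c : ℝ) : Set R4modZ2 :=
  closure (connectedComponentIn (R4modZ2.mk '' {x | inner ℝ b x = c})ᶜ (R4modZ2.mk 0))

end FlatOrbifold

end

noncomputable section

/-! Fix a boundary component, parametrised by an injective isometric `f : E3 → X`, and follow the
inward normal geodesics. They try to extend `f` to a local isometry `Φ` from the upper half-space of
ℝ⁴ to `X`. Flatness provides Euclidean charts, an orbifold point is crossed by lifting to the ball
that covers it, and completeness provides a limit point after any bounded time. So a geodesic either
continues or meets the boundary. Where it meets the boundary, total geodesy makes the boundary a
hyperplane in the developed picture, the graph of an affine function `u ↦ b + ⟪a, u⟫`. The set of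
`u` whose geodesic leaves through this same graph is open and closed in ℝ³, hence everything, and an
affine function that is positive on all of ℝ³ is constant (`exists_dev_or_exit`, `Exit.all`,
`Exit.slope_eq_zero`). Hence `Φ` is defined on a set `Ω` which is the closed half-space or a slab `0
≤ x 0 ≤ c` (`exists_isDevelopment`).

The map `Φ : Ω → X` is onto, and points with the same image differ by a deck transformation, an
isometry `γ` of ℝ⁴ with `Φ ∘ γ = Φ` (`surjective`, `exists_isDeck`). Since `f` is injective, a deck
transformation that keeps the bottom face is the identity. This settles the half-space. On the slab
a nontrivial deck transformation exchanges the two faces, so it is unique and an involution. All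
midpoints of `z` and `γ z` are fixed, whereas a nontrivial deck transformation fixes at most one
point, so `γ` is the reflection in a point (`exists_center`). Thus `X` is `Ω` or `Ω` modulo a point
reflection. The metrics agree because segments push forward without increase of length, and because
a function that is infinitesimally 1-Lipschitz is 1-Lipschitz (`dist_le`, `dist_ge`).

The Euclidean charts come from the Levi-Civita connection. A flat connection has a parallel frame
(`exists_parallel`); as the torsion vanishes, the frame is the differential of a map, and this map
is isometric because the connection is metric (`exists_chartFrame`). It is invertible also at
boundary points, where its image is a half-space because the boundary is totally geodesic
(`exists_openPartialHomeomorph_halfSpace`). Transition maps are affine isometries, which gives the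
atlas of `exists_flatAtlas`. Partial maps to `X` are functions `E4 → Option X`; as `none` marks the
outside of the domain, equality of germs also records the position of the boundary. -/

namespace FlatOrbifold

set_option linter.unusedSectionVars false

/-! ### Coordinate vector fields of the preferred charts. -/

section CoordinateFields

/-- The constant vector field on `ℝ⁴`. -/
def constField (u : E4) : (x : E4) → TangentSpace 𝓘(ℝ, E4) x := fun _ => u

lemma contMDiffAt_constField (u x : E4) :
    ContMDiffAt 𝓘(ℝ, E4) 𝓘(ℝ, E4).tangent ∞
      (fun z => (⟨z, constField u z⟩ : TangentBundle 𝓘(ℝ, E4) E4)) x := by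
  refine (contMDiffAt_section (F := E4) (E := TangentSpace 𝓘(ℝ, E4)) (s := constField u) x).2 ?_
  refine (contMDiffAt_const (c := u)).congr_of_eventuallyEq (Eventually.of_forall fun z => ?_)
  simp [constField]

variable {M : Type*} [TopologicalSpace M] [ChartedSpace (EuclideanHalfSpace 4) M]
  [IsManifold (𝓡∂ 4) ∞ M]

/-- The vector field near `x₀` which is constant equal to `u` in the preferred chart at `x₀`. -/
def coordField (x₀ : M) (u : E4) : (y : M) → TangentSpace (𝓡∂ 4) y :=
  VectorField.mpullback (𝓡∂ 4) 𝓘(ℝ, E4) (extChartAt (𝓡∂ 4) x₀) (constField u)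

/-- The derivative of the preferred chart at `x₀`, with values in `ℝ⁴`. -/
def coordDeriv (x₀ y : M) : TangentSpace (𝓡∂ 4) y →L[ℝ] E4 :=
  mfderiv (𝓡∂ 4) 𝓘(ℝ, E4) (extChartAt (𝓡∂ 4) x₀) y

lemma isInvertible_coordDeriv {x₀ y : M} (hy : y ∈ (extChartAt (𝓡∂ 4) x₀).source) :
    (coordDeriv x₀ y).IsInvertible :=
  isInvertible_mfderiv_extChartAt (I := 𝓡∂ 4) hy

lemma coordField_eq (x₀ : M) (u : E4) (y : M) :
    coordField x₀ u y = (coordDeriv x₀ y).inverse u := rfl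

lemma coordDeriv_coordField {x₀ y : M} (hy : y ∈ (extChartAt (𝓡∂ 4) x₀).source) (u : E4) :
    coordDeriv x₀ y (coordField x₀ u y) = u :=
  (((isInvertible_coordDeriv hy).inverse_apply_eq (x := coordField x₀ u y)).1
    (coordField_eq x₀ u y).symm).symm

lemma coordField_coordDeriv {x₀ y : M} (hy : y ∈ (extChartAt (𝓡∂ 4) x₀).source)
    (v : TangentSpace (𝓡∂ 4) y) : coordField x₀ (coordDeriv x₀ y v) y = v :=
  ((isInvertible_coordDeriv hy).inverse_apply_eq).2 rfl

lemma contMDiffAt_extChartAt_of_mem {x₀ y : M} (hy : y ∈ (extChartAt (𝓡∂ 4) x₀).source) :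
    ContMDiffAt (𝓡∂ 4) 𝓘(ℝ, E4) ∞ (extChartAt (𝓡∂ 4) x₀) y :=
  contMDiffAt_extChartAt' (by simpa using hy)

lemma contMDiffAt_coordField {x₀ y : M} (hy : y ∈ (extChartAt (𝓡∂ 4) x₀).source) (u : E4) :
    ContMDiffAt (𝓡∂ 4) (𝓡∂ 4).tangent ∞
      (fun z => (⟨z, coordField x₀ u z⟩ : TangentBundle (𝓡∂ 4) M)) y :=
  ContMDiffAt.mpullback_vectorField_preimage (contMDiffAt_constField u _)
    (contMDiffAt_extChartAt_of_mem hy) (isInvertible_coordDeriv hy) le_rfl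

/-- Brackets commute with pullback along the chart, and constant fields on ℝ⁴ commute. This removes
the bracket from both the torsion and the curvature equation. -/
lemma mlieBracket_coordField {x₀ y : M} (hy : y ∈ (extChartAt (𝓡∂ 4) x₀).source) (u v : E4) :
    VectorField.mlieBracket (𝓡∂ 4) (coordField x₀ u) (coordField x₀ v) y = 0 := by
  have hm : IsManifold (𝓡∂ 4) (minSmoothness ℝ 2) M := by
    rw [minSmoothness_of_isRCLikeNormedField]; infer_instance
  have hn : minSmoothness ℝ 2 ≤ (∞ : WithTop ℕ∞) := by
    rw [minSmoothness_of_isRCLikeNormedField]; exact WithTop.coe_le_coe.2 (le_top : (2 : ℕ∞) ≤ ⊤)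
  have h1 := VectorField.mpullback_mlieBracket (I := 𝓡∂ 4) (I' := 𝓘(ℝ, E4))
    (V := constField u) (W := constField v) (x₀ := y)
    ((contMDiffAt_constField u _).mdifferentiableAt (by simp))
    ((contMDiffAt_constField v _).mdifferentiableAt (by simp))
    (contMDiffAt_extChartAt_of_mem hy) hn
  have h2 : VectorField.mlieBracket 𝓘(ℝ, E4) (constField u) (constField v) = 0 := by
    ext1 z
    rw [← VectorField.mlieBracketWithin_univ, VectorField.mlieBracketWithin_eq_lieBracketWithin]
    have : ∀ u : E4, (constField u : E4 → E4) = fun _ => u := fun u => rfl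
    simp only [VectorField.lieBracketWithin, this]
    simp
    rfl
  rw [h2] at h1
  refine h1.symm.trans ?_
  simp [VectorField.mpullback_zero]

lemma coordField_add (x₀ : M) (u v : E4) : coordField x₀ (u + v) = coordField x₀ u + coordField x₀ v := by
  ext1 y; exact map_add (coordDeriv x₀ y).inverse u v

lemma coordField_smul (x₀ : M) (c : ℝ) (v : E4) : coordField x₀ (c • v) = c • coordField x₀ v := by
  ext1 y; exact map_smul (coordDeriv x₀ y).inverse c v

end CoordinateFields

/-! ### Gram form and Christoffel symbols. -/

section Connection

variable {M : Type*} [TopologicalSpace M] [ChartedSpace (EuclideanHalfSpace 4) M]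

/-- The derivative of a vector-valued function on `M`. -/
def tderiv {F : Type*} [NormedAddCommGroup F] [NormedSpace ℝ F] (f : M → F) (y : M) :
    TangentSpace (𝓡∂ 4) y →L[ℝ] F :=
  mfderiv (𝓡∂ 4) 𝓘(ℝ, F) f y

variable [IsManifold (𝓡∂ 4) ∞ M]

/-- The derivative of the inverse chart is the inverse of `coordDeriv`. Derivatives are taken within
`range (𝓡∂ 4)` because `z` may lie on the boundary of the half-space. -/
lemma hasFDerivWithinAt_comp_extChartAt_symm {F : Type*} [NormedAddCommGroup F] [NormedSpace ℝ F]
    {x₀ : M} {z : E4} (hz : z ∈ (extChartAt (𝓡∂ 4) x₀).target) {f : M → F}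
    (hf : MDifferentiableAt (𝓡∂ 4) 𝓘(ℝ, F) f ((extChartAt (𝓡∂ 4) x₀).symm z)) :
    HasFDerivWithinAt (f ∘ (extChartAt (𝓡∂ 4) x₀).symm)
      (tderiv f ((extChartAt (𝓡∂ 4) x₀).symm z) ∘L
        (coordDeriv x₀ ((extChartAt (𝓡∂ 4) x₀).symm z)).inverse)
      (range (𝓡∂ 4)) z := by
  have h1 := (mdifferentiableWithinAt_extChartAt_symm (I := 𝓡∂ 4) hz).hasMFDerivWithinAt
  have h2 := (hf.hasMFDerivAt.comp_hasMFDerivWithinAt z h1).hasFDerivWithinAt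
  have h3 : (coordDeriv x₀ ((extChartAt (𝓡∂ 4) x₀).symm z)).inverse =
      mfderivWithin 𝓘(ℝ, E4) (𝓡∂ 4) (extChartAt (𝓡∂ 4) x₀).symm (range (𝓡∂ 4)) z :=
    ContinuousLinearMap.inverse_eq
      (mfderiv_extChartAt_comp_mfderivWithin_extChartAt_symm (I := 𝓡∂ 4) hz)
      (mfderivWithin_extChartAt_symm_comp_mfderiv_extChartAt (I := 𝓡∂ 4) hz)
  rw [h3]
  exact h2

variable  [RiemannianBundle (fun x : M => TangentSpace (𝓡∂ 4) x)]
  [IsContMDiffRiemannianBundle (𝓡∂ 4) ∞ E4 (fun x : M => TangentSpace (𝓡∂ 4) x)]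

/-- The Gram form of the coordinate fields. -/
def gram (x₀ y : M) : E4 →L[ℝ] E4 →L[ℝ] ℝ :=
  (innerSL ℝ).bilinearComp (coordDeriv x₀ y).inverse (coordDeriv x₀ y).inverse

lemma gram_apply (x₀ y : M) (u v : E4) :
    gram x₀ y u v = inner ℝ (coordField x₀ u y) (coordField x₀ v y) := rfl

lemma contMDiffAt_gram_apply {x₀ y : M} (hy : y ∈ (extChartAt (𝓡∂ 4) x₀).source) (u v : E4) :
    ContMDiffAt (𝓡∂ 4) 𝓘(ℝ, ℝ) ∞ (fun z => gram x₀ z u v) y :=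
  (contMDiffAt_coordField hy u).inner_bundle (contMDiffAt_coordField hy v)

/-- The covariant derivative of a coordinate field. -/
def christoffel (D : CovariantDerivative (𝓡∂ 4) E4 (fun x : M => TangentSpace (𝓡∂ 4) x))
    (x₀ y : M) (u v : E4) : E4 :=
  coordDeriv x₀ y (D (coordField x₀ v) y (coordField x₀ u y))

variable {D : CovariantDerivative (𝓡∂ 4) E4 (fun x : M => TangentSpace (𝓡∂ 4) x)}

lemma coordField_christoffel {x₀ y : M} (hy : y ∈ (extChartAt (𝓡∂ 4) x₀).source) (u v : E4) :
    coordField x₀ (christoffel D x₀ y u v) y = D (coordField x₀ v) y (coordField x₀ u y) :=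
  coordField_coordDeriv hy _

lemma christoffel_symm (hD : IsLeviCivita D) {x₀ y : M} (hy : y ∈ (extChartAt (𝓡∂ 4) x₀).source)
    (u v : E4) : christoffel D x₀ y u v = christoffel D x₀ y v u := by
  have h := D.torsion_eq_zero_iff.1 hD.1
    ((contMDiffAt_coordField hy u).mdifferentiableAt (by simp))
    ((contMDiffAt_coordField hy v).mdifferentiableAt (by simp))
  rw [mlieBracket_coordField hy, sub_eq_zero] at h
  rw [christoffel, h, christoffel]

lemma tderiv_gram (hD : IsLeviCivita D) {x₀ y : M} (hy : y ∈ (extChartAt (𝓡∂ 4) x₀).source)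
    (u v w : E4) :
    tderiv (fun z => gram x₀ z v w) y (coordField x₀ u y) =
      gram x₀ y (christoffel D x₀ y u v) w + gram x₀ y v (christoffel D x₀ y u w) := by
  have : IsContMDiffRiemannianBundle (𝓡∂ 4) 1 E4 (fun x : M => TangentSpace (𝓡∂ 4) x) :=
    IsContMDiffRiemannianBundle.of_le (n := ∞) (WithTop.coe_le_coe.2 (le_top : (1 : ℕ∞) ≤ ⊤))
  have h := hD.2.mvfderiv_inner_eq (coordField x₀ u)
    ((contMDiffAt_coordField hy v).mdifferentiableAt (by simp))
    ((contMDiffAt_coordField hy w).mdifferentiableAt (by simp))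
  rw [gram_apply, gram_apply, coordField_christoffel hy, coordField_christoffel hy]
  exact h

lemma christoffel_add_left (x₀ y : M) (u u' v : E4) :
    christoffel D x₀ y (u + u') v = christoffel D x₀ y u v + christoffel D x₀ y u' v := by
  rw [christoffel, coordField_add, Pi.add_apply, map_add, map_add]; rfl

lemma christoffel_smul_left (x₀ y : M) (c : ℝ) (u v : E4) :
    christoffel D x₀ y (c • u) v = c • christoffel D x₀ y u v := by
  rw [christoffel, coordField_smul, Pi.smul_apply, map_smul, map_smul]; rfl

lemma christoffel_add_right {x₀ y : M} (hy : y ∈ (extChartAt (𝓡∂ 4) x₀).source) (u v v' : E4) :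
    christoffel D x₀ y u (v + v') = christoffel D x₀ y u v + christoffel D x₀ y u v' := by
  rw [christoffel, coordField_add, D.isCovariantDerivativeOnUniv.add
    ((contMDiffAt_coordField hy v).mdifferentiableAt (by simp))
    ((contMDiffAt_coordField hy v').mdifferentiableAt (by simp)), add_apply, map_add]
  rfl

lemma christoffel_smul_right {x₀ y : M} (hy : y ∈ (extChartAt (𝓡∂ 4) x₀).source) (c : ℝ) (u v : E4) :
    christoffel D x₀ y u (c • v) = c • christoffel D x₀ y u v := by
  rw [christoffel, coordField_smul, D.isCovariantDerivativeOnUniv.smul_const c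
    ((contMDiffAt_coordField hy v).mdifferentiableAt (by simp)), smul_apply, map_smul]
  rfl

/-- The Christoffel symbol as a bilinear map. -/
def christoffelBilin (D : CovariantDerivative (𝓡∂ 4) E4 (fun x : M => TangentSpace (𝓡∂ 4) x))
    {x₀ y : M} (hy : y ∈ (extChartAt (𝓡∂ 4) x₀).source) : E4 →L[ℝ] E4 →L[ℝ] E4 :=
  (LinearMap.mk₂ ℝ (christoffel D x₀ y) (christoffel_add_left x₀ y) (christoffel_smul_left x₀ y)
    (christoffel_add_right hy) (christoffel_smul_right hy)).toContinuousBilinearMap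

lemma christoffelBilin_apply {x₀ y : M} (hy : y ∈ (extChartAt (𝓡∂ 4) x₀).source) (u v : E4) :
    christoffelBilin D hy u v = christoffel D x₀ y u v := rfl

lemma covariantDerivative_sum {ι : Type*} (s : Finset ι) {σ : ι → (z : M) → TangentSpace (𝓡∂ 4) z}
    {y : M} (hσ : ∀ i, MDifferentiableAt (𝓡∂ 4) (𝓡∂ 4).tangent
      (fun z => (⟨z, σ i z⟩ : TangentBundle (𝓡∂ 4) M)) y) :
    D (fun z => ∑ i ∈ s, σ i z) y = ∑ i ∈ s, D (σ i) y := by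
  classical
  induction s using Finset.induction_on with
  | empty =>
    simp only [Finset.sum_empty]
    exact D.isCovariantDerivativeOnUniv.zero
  | insert i s hi ih =>
    have h1 : (fun z => ∑ j ∈ insert i s, σ j z) = σ i + fun z => ∑ j ∈ s, σ j z := by
      ext1 z; simp [Finset.sum_insert hi]
    rw [h1, D.isCovariantDerivativeOnUniv.add (hσ i)
      (MDifferentiableAt.sum_section fun j _ => hσ j), ih, Finset.sum_insert hi]

lemma sum_smul_single (w : E4) : w = ∑ i, w i • EuclideanSpace.single i (1 : ℝ) := by
  simpa using ((EuclideanSpace.basisFun (Fin 4) ℝ).sum_repr w).symm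

lemma coordField_comp_eq_sum (x₀ : M) (c : M → E4) : (fun z => coordField x₀ (c z) z) = fun z => ∑ i,
      ((fun z => c z i) • coordField x₀ (EuclideanSpace.single i (1 : ℝ))) z := by
  ext1 z
  conv_lhs => rw [sum_smul_single (c z)]
  exact (map_sum (coordDeriv x₀ z).inverse _ _).trans
    (Finset.sum_congr rfl fun i _ => map_smul _ _ _)

lemma hasMFDerivAt_coord {y : M} {c : M → E4} (hc : MDifferentiableAt (𝓡∂ 4) 𝓘(ℝ, E4) c y) (i : Fin 4) :
    HasMFDerivAt (𝓡∂ 4) 𝓘(ℝ, ℝ) (fun z => c z i) y (EuclideanSpace.proj i ∘L tderiv c y) :=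
  ((EuclideanSpace.proj i : E4 →L[ℝ] ℝ).hasMFDerivAt).comp y hc.hasMFDerivAt

lemma mdifferentiableAt_coordField_comp {x₀ y : M} (hy : y ∈ (extChartAt (𝓡∂ 4) x₀).source)
    {c : M → E4} (hc : MDifferentiableAt (𝓡∂ 4) 𝓘(ℝ, E4) c y) :
    MDifferentiableAt (𝓡∂ 4) (𝓡∂ 4).tangent
      (fun z => (⟨z, coordField x₀ (c z) z⟩ : TangentBundle (𝓡∂ 4) M)) y := by
  have h := MDifferentiableAt.sum_section (s := Finset.univ) fun i _ =>
    (hasMFDerivAt_coord hc i).mdifferentiableAt.smul_section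
      ((contMDiffAt_coordField hy (EuclideanSpace.single i (1 : ℝ))).mdifferentiableAt (by simp))
  refine h.congr_of_eventuallyEq (Eventually.of_forall fun z => ?_)
  exact congrArg _ (congrFun (coordField_comp_eq_sum x₀ c) z)

/-- The covariant derivative of a field with variable coefficients. -/
lemma covariantDerivative_coordField_comp {x₀ y : M} (hy : y ∈ (extChartAt (𝓡∂ 4) x₀).source)
    {c : M → E4} (hc : MDifferentiableAt (𝓡∂ 4) 𝓘(ℝ, E4) c y) (u : E4) :
    coordDeriv x₀ y (D (fun z => coordField x₀ (c z) z) y (coordField x₀ u y)) =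
      christoffel D x₀ y u (c y) + tderiv c y (coordField x₀ u y) := by
  have hci := fun i => hasMFDerivAt_coord hc i
  have hd : ∀ i, MDifferentiableAt (𝓡∂ 4) (𝓡∂ 4).tangent
      (fun z => (⟨z, coordField x₀ (EuclideanSpace.single i (1 : ℝ)) z⟩ :
        TangentBundle (𝓡∂ 4) M)) y :=
    fun i => (contMDiffAt_coordField hy _).mdifferentiableAt (by simp)
  have hsum := sum_smul_single
  rw [coordField_comp_eq_sum, covariantDerivative_sum _ fun i => (hci i).mdifferentiableAt.smul_section (hd i)]
  have h2 : ∀ i, D ((fun z => c z i) • coordField x₀ (EuclideanSpace.single i (1 : ℝ))) y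
      (coordField x₀ u y) = c y i • D (coordField x₀ (EuclideanSpace.single i (1 : ℝ))) y
        (coordField x₀ u y) + (tderiv c y (coordField x₀ u y)) i •
          coordField x₀ (EuclideanSpace.single i (1 : ℝ)) y := fun i => by
    rw [D.isCovariantDerivativeOnUniv.leibniz (hd i) (hci i).mdifferentiableAt]
    have h3 : ∀ X, mvfderiv (𝓡∂ 4) (fun z => c z i) y X = (tderiv c y X) i := fun X => by
      exact congrArg (fun L => L X) (hci i).mfderiv
    rw [add_apply, smul_apply, ContinuousLinearMap.smulRight_apply, h3]
  rw [_root_.sum_apply, Finset.sum_congr rfl fun i _ => h2 i, Finset.sum_add_distrib, map_add]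
  congr 1
  · rw [map_sum]
    conv_rhs => rw [hsum (c y)]
    rw [← christoffelBilin_apply hy, map_sum]
    exact Finset.sum_congr rfl fun i _ => by rw [map_smul, map_smul]; rfl
  · rw [map_sum]
    conv_rhs => rw [hsum (tderiv c y (coordField x₀ u y))]
    exact Finset.sum_congr rfl fun i _ => by rw [map_smul, coordDeriv_coordField hy]

/-- The Christoffel symbols, as a function on the preferred chart at `x₀`. -/
def chartChristoffel (D : CovariantDerivative (𝓡∂ 4) E4 (fun x : M => TangentSpace (𝓡∂ 4) x))
    (x₀ : M) (z : E4) : E4 →L[ℝ] E4 →L[ℝ] E4 :=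
  open Classical in
  -- The bilinear form exists only over the chart source; the value 0 elsewhere plays no role, since
  -- the function is only studied on the target.
  if h : (extChartAt (𝓡∂ 4) x₀).symm z ∈ (extChartAt (𝓡∂ 4) x₀).source then christoffelBilin D h
  else 0

lemma chartChristoffel_apply {x₀ : M} {z : E4} (hz : z ∈ (extChartAt (𝓡∂ 4) x₀).target) (u v : E4) :
    chartChristoffel D x₀ z u v = christoffel D x₀ ((extChartAt (𝓡∂ 4) x₀).symm z) u v := by
  rw [chartChristoffel, dif_pos ((extChartAt (𝓡∂ 4) x₀).map_target hz), christoffelBilin_apply]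

/-- The metric, as a function on the preferred chart at `x₀`. -/
def chartGram (x₀ : M) (z : E4) : E4 →L[ℝ] E4 →L[ℝ] ℝ := gram x₀ ((extChartAt (𝓡∂ 4) x₀).symm z)

lemma contDiffOn_chartGram (x₀ : M) :
    ContDiffOn ℝ ∞ (chartGram x₀) (extChartAt (𝓡∂ 4) x₀).target := by
  refine contDiffOn_clm_apply.2 fun u => contDiffOn_clm_apply.2 fun v => ?_
  rw [← contMDiffOn_iff_contDiffOn]
  intro z hz
  exact (contMDiffAt_gram_apply ((extChartAt (𝓡∂ 4) x₀).map_target hz) u v).comp_contMDiffWithinAt z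
    (contMDiffOn_extChartAt_symm x₀ z hz)

lemma chartGram_symm (x₀ : M) (z u v : E4) : chartGram x₀ z u v = chartGram x₀ z v u :=
  real_inner_comm (coordField x₀ v ((extChartAt (𝓡∂ 4) x₀).symm z)) (coordField x₀ u _)

/-- Positive definiteness gives injectivity, and the dual of ℝ⁴ has the same dimension. -/
lemma isInvertible_chartGram {x₀ : M} {z : E4} (hz : z ∈ (extChartAt (𝓡∂ 4) x₀).target) :
    (chartGram x₀ z).IsInvertible := by
  have hinj : Function.Injective (chartGram x₀ z : E4 →ₗ[ℝ] E4 →L[ℝ] ℝ) := by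
    rw [injective_iff_map_eq_zero]
    intro u hu
    have h1 : chartGram x₀ z u u = 0 := by
      have : chartGram x₀ z u = 0 := hu
      rw [this]; rfl
    have h2 : coordField x₀ u ((extChartAt (𝓡∂ 4) x₀).symm z) = 0 := inner_self_eq_zero.1 h1
    have h3 := coordDeriv_coordField ((extChartAt (𝓡∂ 4) x₀).map_target hz) u
    rw [h2, map_zero] at h3
    exact h3.symm
  have hd : Module.finrank ℝ E4 = Module.finrank ℝ (E4 →L[ℝ] ℝ) := by
    rw [← (LinearMap.toContinuousLinearMap (𝕜 := ℝ) (E := E4) (F' := ℝ)).finrank_eq]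
    exact Subspace.dual_finrank_eq.symm
  exact ⟨(LinearEquiv.ofInjective _ hinj |>.trans (LinearEquiv.ofTop _
    (LinearMap.range_eq_top.2 ((LinearMap.injective_iff_surjective_of_finrank_eq_finrank hd).1
      hinj)))).toContinuousLinearEquiv, rfl⟩

lemma extChartAt_target_mem_nhdsWithin_range {x₀ : M} {z : E4}
    (hz : z ∈ (extChartAt (𝓡∂ 4) x₀).target) :
    (extChartAt (𝓡∂ 4) x₀).target ∈ 𝓝[range (𝓡∂ 4)] z :=
  extChartAt_target_mem_nhdsWithin_of_mem hz

lemma nhdsWithin_extChartAt_target {x₀ : M} {z : E4}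
    (hz : z ∈ (extChartAt (𝓡∂ 4) x₀).target) :
    𝓝[(extChartAt (𝓡∂ 4) x₀).target] z = 𝓝[range (𝓡∂ 4)] z :=
  nhdsWithin_extChartAt_target_eq_of_mem hz

lemma hasFDerivWithinAt_chartGram_apply (hD : IsLeviCivita D) {x₀ : M} {z : E4}
    (hz : z ∈ (extChartAt (𝓡∂ 4) x₀).target) (v w : E4) :
    ∃ L : E4 →L[ℝ] ℝ, HasFDerivWithinAt (fun z => chartGram x₀ z v w) L (range (𝓡∂ 4)) z ∧
      ∀ u, L u = chartGram x₀ z (chartChristoffel D x₀ z u v) w +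
        chartGram x₀ z v (chartChristoffel D x₀ z u w) := by
  have hy := (extChartAt (𝓡∂ 4) x₀).map_target hz
  refine ⟨_, hasFDerivWithinAt_comp_extChartAt_symm hz
    ((contMDiffAt_gram_apply hy v w).mdifferentiableAt (by simp)), fun u => ?_⟩
  rw [chartChristoffel_apply hz, chartChristoffel_apply hz]
  exact tderiv_gram hD hy u v w

end Connection

/-! ### Smoothness of the Christoffel symbols and the curvature equation. -/

section Connection

variable {M : Type*} [TopologicalSpace M] [ChartedSpace (EuclideanHalfSpace 4) M]
  [IsManifold (𝓡∂ 4) ∞ M]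
  [RiemannianBundle (fun x : M => TangentSpace (𝓡∂ 4) x)]
  [IsContMDiffRiemannianBundle (𝓡∂ 4) ∞ E4 (fun x : M => TangentSpace (𝓡∂ 4) x)]
  {D : CovariantDerivative (𝓡∂ 4) E4 (fun x : M => TangentSpace (𝓡∂ 4) x)}

lemma hasFDerivWithinAt_target_iff {F : Type*} [NormedAddCommGroup F] [NormedSpace ℝ F]
    {x₀ : M} {z : E4} (hz : z ∈ (extChartAt (𝓡∂ 4) x₀).target) {f : E4 → F} {f' : E4 →L[ℝ] F} :
    HasFDerivWithinAt f f' (extChartAt (𝓡∂ 4) x₀).target z ↔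
      HasFDerivWithinAt f f' (range (𝓡∂ 4)) z := by
  rw [HasFDerivWithinAt, nhdsWithin_extChartAt_target hz, HasFDerivWithinAt]

/-- This is the Koszul formula: torsion freeness and metric compatibility express `g(Γ(u, v), ·)`
through first derivatives of the Gram form `g`, and inverting `g` preserves smoothness. -/
lemma contDiffOn_chartChristoffel (hD : IsLeviCivita D) (x₀ : M) :
    ContDiffOn ℝ ∞ (chartChristoffel D x₀) (extChartAt (𝓡∂ 4) x₀).target := by
  set N := (extChartAt (𝓡∂ 4) x₀).target with hN
  refine contDiffOn_clm_apply.2 fun u => contDiffOn_clm_apply.2 fun v => ?_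
  have hg : ∀ v w, ContDiffOn ℝ ∞ (fun z => chartGram x₀ z v w) N := fun v w =>
    contDiffOn_clm_apply.1 (contDiffOn_clm_apply.1 (contDiffOn_chartGram x₀) v) w
  let dg : E4 → E4 → E4 → E4 →L[ℝ] ℝ := fun v w => fderivWithin ℝ (fun z => chartGram x₀ z v w) N
  have hdg : ∀ v w, ContDiffOn ℝ ∞ (dg v w) N := fun v w =>
    (hg v w).fderivWithin (uniqueDiffOn_extChartAt_target x₀) (m := ∞) (by simp)
  have hdga : ∀ z ∈ N, ∀ u v w, dg v w z u = chartGram x₀ z (chartChristoffel D x₀ z u v) w +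
      chartGram x₀ z v (chartChristoffel D x₀ z u w) := by
    intro z hz u v w
    obtain ⟨L, hL, hLu⟩ := hasFDerivWithinAt_chartGram_apply hD hz v w
    have h3 := ((hasFDerivWithinAt_target_iff hz).2 hL).fderivWithin
      (uniqueDiffOn_extChartAt_target x₀ z hz)
    rw [← hLu, ← h3]
  -- The Koszul one-form `w ↦ ½ (∂_u g(v, w) + ∂_v g(u, w) - ∂_w g(u, v))`. In the first two terms
  -- `w` enters the differentiated function, so they are expanded in the standard basis.
  let K : E4 → E4 →L[ℝ] ℝ := fun z => (1 / 2 : ℝ) •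
    ((∑ i, (dg v (EuclideanSpace.single i (1 : ℝ)) z u + dg u (EuclideanSpace.single i (1 : ℝ)) z v) •
      (EuclideanSpace.proj i : E4 →L[ℝ] ℝ)) - dg u v z)
  have hK : ContDiffOn ℝ ∞ K N := by
    refine ContDiffOn.const_smul (F := E4 →L[ℝ] ℝ) (1 / 2 : ℝ) ((ContDiffOn.sum fun i _ => ?_).sub (hdg u v))
    have h : ContDiffOn ℝ ∞ (fun z => dg v (EuclideanSpace.single i (1 : ℝ)) z u +
        dg u (EuclideanSpace.single i (1 : ℝ)) z v) N :=
      ((hdg _ _).clm_apply contDiffOn_const).add ((hdg _ _).clm_apply contDiffOn_const)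
    exact ContDiffOn.smul (F := E4 →L[ℝ] ℝ) h
      (contDiffOn_const (c := (EuclideanSpace.proj i : E4 →L[ℝ] ℝ)))
  have hinv : ContDiffOn ℝ ∞ (fun z => (chartGram x₀ z).inverse) N := by
    intro z hz
    obtain ⟨e, he⟩ := isInvertible_chartGram hz
    have := contDiffAt_map_inverse (n := ∞) (𝕜 := ℝ) e
    rw [he] at this
    exact this.comp_contDiffWithinAt z (contDiffOn_chartGram x₀ z hz)
  refine (hinv.clm_apply hK).congr fun z hz => ?_
  refine ((isInvertible_chartGram hz).inverse_apply_eq.2 ?_).symm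
  have hs : ∀ a b, chartChristoffel D x₀ z a b = chartChristoffel D x₀ z b a := fun a b => by
    rw [chartChristoffel_apply hz, chartChristoffel_apply hz,
      christoffel_symm hD ((extChartAt (𝓡∂ 4) x₀).map_target hz)]
  refine ContinuousLinearMap.coe_injective ((EuclideanSpace.basisFun (Fin 4) ℝ).toBasis.ext fun j => ?_)
  have h1 : K z (EuclideanSpace.single j (1 : ℝ)) =
      (1 / 2 : ℝ) * (dg v (EuclideanSpace.single j (1 : ℝ)) z u +
        dg u (EuclideanSpace.single j (1 : ℝ)) z v - dg u v z (EuclideanSpace.single j (1 : ℝ))) := by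
    simp [K]
  simp only [OrthonormalBasis.coe_toBasis, EuclideanSpace.basisFun_apply,
    ContinuousLinearMap.coe_coe, h1, hdga z hz]
  rw [hs v u, hs (EuclideanSpace.single j (1 : ℝ)) u, hs (EuclideanSpace.single j (1 : ℝ)) v,
    chartGram_symm x₀ z _ v, chartGram_symm x₀ z u]
  ring

lemma christoffel_eq_chartChristoffel {x₀ y : M} (hy : y ∈ (extChartAt (𝓡∂ 4) x₀).source)
    (u v : E4) :
    christoffel D x₀ y u v = chartChristoffel D x₀ (extChartAt (𝓡∂ 4) x₀ y) u v := by
  rw [chartChristoffel_apply ((extChartAt (𝓡∂ 4) x₀).map_source hy),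
    (extChartAt (𝓡∂ 4) x₀).left_inv hy]

lemma contMDiffAt_christoffel (hD : IsLeviCivita D) {x₀ y : M}
    (hy : y ∈ (extChartAt (𝓡∂ 4) x₀).source) (u v : E4) :
    ContMDiffAt (𝓡∂ 4) 𝓘(ℝ, E4) ∞ (fun z => christoffel D x₀ z u v) y := by
  have h1 : ContMDiffOn 𝓘(ℝ, E4) 𝓘(ℝ, E4) ∞ (fun z => chartChristoffel D x₀ z u v)
      (extChartAt (𝓡∂ 4) x₀).target := contMDiffOn_iff_contDiffOn.2
    (contDiffOn_clm_apply.1 (contDiffOn_clm_apply.1 (contDiffOn_chartChristoffel hD x₀) u) v)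
  have hs : (extChartAt (𝓡∂ 4) x₀).source ∈ 𝓝 y :=
    (isOpen_extChartAt_source x₀).mem_nhds hy
  have h2 := (h1 _ ((extChartAt (𝓡∂ 4) x₀).map_source hy)).comp y
    (contMDiffAt_extChartAt_of_mem hy).contMDiffWithinAt
    (s := (extChartAt (𝓡∂ 4) x₀).source) fun z hz => (extChartAt (𝓡∂ 4) x₀).map_source hz
  refine (h2.contMDiffAt hs).congr_of_eventuallyEq ?_
  filter_upwards [hs] with z hz
  exact christoffel_eq_chartChristoffel hz u v

section Bump

variable [T2Space M]

/-- `IsFlat` and `HasTotallyGeodesicBoundary` test global smooth fields only, so coordinate fields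
have to be cut off by a bump function. -/
lemma exists_smoothField_eventuallyEq_coordField {x₀ y : M}
    (hy : y ∈ (extChartAt (𝓡∂ 4) x₀).source) :
    ∃ χ : M → ℝ, χ =ᶠ[𝓝 y] 1 ∧ (∀ z, χ z ≠ 0 → z ∈ (extChartAt (𝓡∂ 4) x₀).source) ∧
      ∀ u, SmoothField (χ • coordField x₀ u) := by
  have hs : (extChartAt (𝓡∂ 4) x₀).source ∈ 𝓝 y := (isOpen_extChartAt_source x₀).mem_nhds hy
  obtain ⟨f, -, hf⟩ := (SmoothBumpFunction.nhds_basis_tsupport (I := 𝓡∂ 4) y).mem_iff.1 hs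
  refine ⟨f, f.eventuallyEq_one, fun z hz => hf (subset_tsupport _ hz), fun u => ?_⟩
  exact ContMDiffOn.smul_section_of_tsupport f.contMDiff.contMDiffOn (isOpen_extChartAt_source x₀) hf
    fun z hz => (contMDiffAt_coordField hz u).contMDiffWithinAt

lemma covariantDerivative_congr {σ τ : (z : M) → TangentSpace (𝓡∂ 4) z} {y : M}
    (hσ : MDifferentiableAt (𝓡∂ 4) (𝓡∂ 4).tangent
      (fun z => (⟨z, σ z⟩ : TangentBundle (𝓡∂ 4) M)) y)
    (h : ∀ᶠ z in 𝓝 y, σ z = τ z) : D σ y = D τ y := by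
  refine D.isCovariantDerivativeOnUniv.congr_of_eventuallyEq hσ
    (hσ.congr_of_eventuallyEq ?_) univ_mem h
  filter_upwards [h] with z hz
  rw [hz]

/-- Flatness is applied to three cut-off coordinate fields, which near `y` are honest coordinate
fields with vanishing bracket. -/
lemma fderivWithin_chartChristoffel_flat (hD : IsLeviCivita D) (hF : IsFlat D) {x₀ : M} {z : E4}
    (hz : z ∈ (extChartAt (𝓡∂ 4) x₀).target) (a b c : E4) :
    fderivWithin ℝ (chartChristoffel D x₀) (extChartAt (𝓡∂ 4) x₀).target z a b c -
      fderivWithin ℝ (chartChristoffel D x₀) (extChartAt (𝓡∂ 4) x₀).target z b a c +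
      chartChristoffel D x₀ z a (chartChristoffel D x₀ z b c) -
      chartChristoffel D x₀ z b (chartChristoffel D x₀ z a c) = 0 := by
  set y := (extChartAt (𝓡∂ 4) x₀).symm z with hyz
  have hy : y ∈ (extChartAt (𝓡∂ 4) x₀).source := (extChartAt (𝓡∂ 4) x₀).map_target hz
  obtain ⟨χ, hχ, -, hs⟩ := exists_smoothField_eventuallyEq_coordField hy
  have hev : ∀ᶠ z in 𝓝 y, z ∈ (extChartAt (𝓡∂ 4) x₀).source ∧
      ∀ u, ∀ᶠ w in 𝓝 z, coordField x₀ u w = (χ • coordField x₀ u) w := by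
    filter_upwards [(isOpen_extChartAt_source (I := 𝓡∂ 4) x₀).mem_nhds hy,
      eventually_eventually_nhds.2 hχ] with z hz hz'
    refine ⟨hz, fun u => ?_⟩
    filter_upwards [hz'] with w hw
    simp [hw]
  -- The inner derivative is the field with coefficients `Γ(v, w)`; differentiating it along `u`
  -- gives `Γ(u, Γ(v, w)) + ∂_u Γ(v, w)`.
  have hDD : ∀ u v w, coordDeriv x₀ y (D (fun z => D (χ • coordField x₀ w) z ((χ • coordField x₀ v) z)) y
      ((χ • coordField x₀ u) y)) = christoffel D x₀ y u (christoffel D x₀ y v w) +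
        tderiv (fun z => christoffel D x₀ z v w) y (coordField x₀ u y) := by
    intro u v w
    have hc := (contMDiffAt_christoffel hD hy v w).mdifferentiableAt (by simp)
    rw [← covariantDerivative_coordField_comp hy hc,
      ← (hev.self_of_nhds.2 u).self_of_nhds]
    congr 2
    refine (covariantDerivative_congr (mdifferentiableAt_coordField_comp hy hc) ?_).symm
    filter_upwards [hev] with z hz
    rw [coordField_christoffel hz.1, (hz.2 v).self_of_nhds]
    congr 1
    exact covariantDerivative_congr ((contMDiffAt_coordField hz.1 w).mdifferentiableAt (by simp))
      (hz.2 w)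
  have hbr : VectorField.mlieBracket (𝓡∂ 4) (χ • coordField x₀ a) (χ • coordField x₀ b) y = 0 := by
    rw [← mlieBracket_coordField hy a b]
    exact Filter.EventuallyEq.mlieBracket_vectorField_eq
      ((hev.self_of_nhds.2 a).mono fun _ h => h.symm) ((hev.self_of_nhds.2 b).mono fun _ h => h.symm)
  have h := congrArg (coordDeriv x₀ y) (hF _ _ _ (hs a) (hs b) (hs c) y)
  rw [map_zero, map_sub, map_sub, hbr, hDD, hDD, map_zero, map_zero] at h
  have hder : ∀ u v, fderivWithin ℝ (chartChristoffel D x₀) (extChartAt (𝓡∂ 4) x₀).target z u v c =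
      tderiv (fun z => christoffel D x₀ z v c) y (coordField x₀ u y) := by
    intro u v
    have h1 := ((contDiffOn_chartChristoffel hD x₀).differentiableOn (by simp) z hz).hasFDerivWithinAt
    have h2 := (h1.clm_apply (hasFDerivWithinAt_const v z _)).clm_apply
      (hasFDerivWithinAt_const c z _)
    have h3 := hasFDerivWithinAt_comp_extChartAt_symm hz
      ((contMDiffAt_christoffel hD hy v c).mdifferentiableAt (by simp))
    have h4 := (uniqueDiffOn_extChartAt_target x₀ z hz).eq h2
      (((hasFDerivWithinAt_target_iff hz).2 h3).congr
        (fun w hw => chartChristoffel_apply hw v c) (chartChristoffel_apply hz v c))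
    have h5 := congrArg (fun L => L u) h4
    simpa using! h5
  rw [hder, hder, chartChristoffel_apply hz, chartChristoffel_apply hz, chartChristoffel_apply hz,
    chartChristoffel_apply hz, ← h]
  abel

end Bump

end Connection

/-! ### The boundary in coordinates and its second fundamental form. -/

section TotallyGeodesic

variable {M : Type*} [TopologicalSpace M] [ChartedSpace (EuclideanHalfSpace 4) M]
  [IsManifold (𝓡∂ 4) ∞ M]
  [RiemannianBundle (fun x : M => TangentSpace (𝓡∂ 4) x)]
  [IsContMDiffRiemannianBundle (𝓡∂ 4) ∞ E4 (fun x : M => TangentSpace (𝓡∂ 4) x)]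
  {D : CovariantDerivative (𝓡∂ 4) E4 (fun x : M => TangentSpace (𝓡∂ 4) x)}

lemma range_modelWithCorners_eq : range (𝓡∂ 4) = {z : E4 | 0 ≤ z 0} := range_euclideanHalfSpace 4

lemma isBoundaryPoint_iff_extChartAt_eq_zero {x₀ y : M} (hy : y ∈ (extChartAt (𝓡∂ 4) x₀).source) :
    y ∈ (𝓡∂ 4).boundary M ↔ extChartAt (𝓡∂ 4) x₀ y 0 = 0 := by
  have hy' : y ∈ (chartAt (EuclideanHalfSpace 4) x₀).source := by simpa using hy
  have h1 : y ∈ (𝓡∂ 4).boundary M ↔ ¬ (extChartAt (𝓡∂ 4) x₀ y ∈ interior (range (𝓡∂ 4))) := by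
    rw [← ModelWithCorners.compl_interior, mem_compl_iff, not_iff_not]
    refine (ModelWithCorners.isInteriorPoint_iff_of_mem_atlas (n := ∞) (by simp)
      (chart_mem_atlas _ x₀) hy').trans
      ⟨fun h => OpenPartialHomeomorph.interior_extend_target_subset_interior_range _ h, fun h => ?_⟩
    exact (chartAt _ x₀).mem_interior_extend_target ((chartAt _ x₀).map_source hy') h
  rw [h1, interior_range_modelWithCornersEuclideanHalfSpace]
  have h2 : extChartAt (𝓡∂ 4) x₀ y ∈ range (𝓡∂ 4) :=
    extChartAt_target_subset_range x₀ ((extChartAt (𝓡∂ 4) x₀).map_source hy)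
  rw [range_modelWithCorners_eq, mem_ofPred_eq] at h2
  simp only [mem_ofPred_eq, not_lt]
  exact ⟨fun h => le_antisymm h h2, fun h => h.le⟩

/-- A line in the hyperplane `z 0 = 0` of one chart consists of boundary points, so the other chart
sends it to `z 0 = 0` as well; differentiate. This compares `TangentToBoundary`, which uses the
preferred chart at each point itself, with a fixed chart at `x₀`. -/
lemma coordDeriv_eq_zero_of_boundary {x₀ x₁ y : M} (hy₀ : y ∈ (extChartAt (𝓡∂ 4) x₀).source)
    (hy₁ : y ∈ (extChartAt (𝓡∂ 4) x₁).source) (hb : y ∈ (𝓡∂ 4).boundary M)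
    {v : TangentSpace (𝓡∂ 4) y} (hv : coordDeriv x₀ y v 0 = 0) : coordDeriv x₁ y v 0 = 0 := by
  set z := extChartAt (𝓡∂ 4) x₀ y with hz
  have hzt : z ∈ (extChartAt (𝓡∂ 4) x₀).target := (extChartAt (𝓡∂ 4) x₀).map_source hy₀
  have hzy : (extChartAt (𝓡∂ 4) x₀).symm z = y := (extChartAt (𝓡∂ 4) x₀).left_inv hy₀
  have hz0 : z 0 = 0 := (isBoundaryPoint_iff_extChartAt_eq_zero hy₀).1 hb
  set a : E4 := coordDeriv x₀ y v with ha
  have hf := hasMFDerivAt_coord ((contMDiffAt_extChartAt_of_mem hy₁).mdifferentiableAt (by simp)) 0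
  have h1 := hasFDerivWithinAt_comp_extChartAt_symm hzt (hzy.symm ▸ hf.mdifferentiableAt)
  have hline : HasDerivAt (fun t : ℝ => z + t • a) a 0 := by
    simpa using ((hasDerivAt_id (0 : ℝ)).smul_const a).const_add z
  have hmem : ∀ t : ℝ, z + t • a ∈ range (𝓡∂ 4) := fun t => by
    rw [range_modelWithCorners_eq]; simp [hz0, hv]
  have h2 := HasFDerivWithinAt.comp_hasDerivWithinAt (t := range (𝓡∂ 4)) (s := univ) (0 : ℝ)
    (by simpa using h1) hline.hasDerivWithinAt fun t _ => hmem t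
  have hcont : Tendsto (fun t : ℝ => z + t • a) (𝓝 0) (𝓝[range (𝓡∂ 4)] z) := by
    refine tendsto_nhdsWithin_iff.2 ⟨?_, Eventually.of_forall hmem⟩
    simpa using hline.continuousAt.tendsto
  have hev : ∀ᶠ w in 𝓝[range (𝓡∂ 4)] z, w 0 = 0 →
      extChartAt (𝓡∂ 4) x₁ ((extChartAt (𝓡∂ 4) x₀).symm w) 0 = 0 := by
    have hc : ContinuousAt (extChartAt (𝓡∂ 4) x₀).symm z := continuousAt_extChartAt_symm' hy₀
    have hs : (extChartAt (𝓡∂ 4) x₁).source ∈ 𝓝 ((extChartAt (𝓡∂ 4) x₀).symm z) := by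
      rw [hzy]; exact (isOpen_extChartAt_source x₁).mem_nhds hy₁
    filter_upwards [extChartAt_target_mem_nhdsWithin_range hzt,
      mem_nhdsWithin_of_mem_nhds (hc.preimage_mem_nhds hs)] with w hw hw' hw0
    refine (isBoundaryPoint_iff_extChartAt_eq_zero hw').1 ?_
    refine (isBoundaryPoint_iff_extChartAt_eq_zero ((extChartAt (𝓡∂ 4) x₀).map_target hw)).2 ?_
    rwa [(extChartAt (𝓡∂ 4) x₀).right_inv hw]
  have h3 := (hasDerivWithinAt_univ.1 h2).congr_of_eventuallyEq (f₁ := fun _ => (0 : ℝ)) (by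
    filter_upwards [hcont.eventually hev] with t ht
    exact (ht (by simp [hz0, hv])).symm)
  have h4 : (tderiv (fun w => extChartAt (𝓡∂ 4) x₁ w 0) ((extChartAt (𝓡∂ 4) x₀).symm z) ∘L
      (coordDeriv x₀ ((extChartAt (𝓡∂ 4) x₀).symm z)).inverse) a = 0 :=
    h3.unique (hasDerivAt_const _ _)
  rw [hzy] at h4
  have h5 : (coordDeriv x₀ y).inverse a = v := coordField_coordDeriv hy₀ v
  have h6 : tderiv (fun w => extChartAt (𝓡∂ 4) x₁ w 0) y v = 0 := by
    rw [← h5]; exact h4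
  have h7 : tderiv (fun w => extChartAt (𝓡∂ 4) x₁ w 0) y = EuclideanSpace.proj 0 ∘L coordDeriv x₁ y :=
    hf.mfderiv
  rw [h7] at h6
  exact h6

lemma chartChristoffel_eq_zero_of_boundary [T2Space M] (hD : HasTotallyGeodesicBoundary D) {x₀ : M}
    {z a b : E4} (hz : z ∈ (extChartAt (𝓡∂ 4) x₀).target) (hz0 : z 0 = 0) (ha : a 0 = 0)
    (hb : b 0 = 0) : chartChristoffel D x₀ z a b 0 = 0 := by
  set y := (extChartAt (𝓡∂ 4) x₀).symm z with hyz
  have hy : y ∈ (extChartAt (𝓡∂ 4) x₀).source := (extChartAt (𝓡∂ 4) x₀).map_target hz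
  have hyb : y ∈ (𝓡∂ 4).boundary M := by
    rw [isBoundaryPoint_iff_extChartAt_eq_zero hy, (extChartAt (𝓡∂ 4) x₀).right_inv hz, hz0]
  obtain ⟨χ, hχ, hχs, hs⟩ := exists_smoothField_eventuallyEq_coordField hy
  have htan : ∀ a : E4, a 0 = 0 → ∀ x ∈ (𝓡∂ 4).boundary M,
      TangentToBoundary x ((χ • coordField x₀ a) x) := by
    intro a ha x hx
    -- Tangency is required at every boundary point: where `χ` vanishes the field is zero, and
    -- elsewhere the point lies in the chart at `x₀`.
    by_cases h0 : χ x = 0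
    · have : (χ • coordField x₀ a) x = 0 := by
        change χ x • coordField x₀ a x = 0
        rw [h0, zero_smul]
      rw [this]
      have h : coordDeriv x x 0 0 = 0 := by rw [map_zero]; rfl
      exact h
    · have hxs := hχs x h0
      have h1 : coordDeriv x x (coordField x₀ a x) 0 = 0 :=
        coordDeriv_eq_zero_of_boundary hxs (mem_extChartAt_source x) hx
          (by rw [coordDeriv_coordField hxs, ha])
      have h : coordDeriv x x (χ x • coordField x₀ a x) 0 = 0 := by
        rw [map_smul, PiLp.smul_apply, h1, smul_zero]
      exact h
  have h := hD _ _ (hs a) (hs b) (fun x hx => ⟨htan a ha x hx, htan b hb x hx⟩) y hyb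
  have h1 : D (χ • coordField x₀ b) y ((χ • coordField x₀ a) y) =
      D (coordField x₀ b) y (coordField x₀ a y) := by
    have e1 : (χ • coordField x₀ a) y = coordField x₀ a y := by
      change χ y • coordField x₀ a y = _
      rw [hχ.self_of_nhds, Pi.one_apply, one_smul]
    rw [e1, covariantDerivative_congr ((contMDiffAt_coordField hy b).mdifferentiableAt (by simp))]
    filter_upwards [hχ] with w hw
    simp [hw]
  rw [h1] at h
  rw [chartChristoffel_apply hz]
  exact coordDeriv_eq_zero_of_boundary (mem_extChartAt_source y) hy hyb h

end TotallyGeodesic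

/-! ### Flat connections have parallel frames. -/

section FlatConnection

/-- Grönwall with rate 1 on `[0, 1]` bounds the norm by `ε (exp t - 1)`, and `exp 1 ≤ 3`. -/
lemma norm_le_two_mul_of_norm_deriv_le {F : Type*} [NormedAddCommGroup F] [NormedSpace ℝ F]
    {R R' : ℝ → F} {ε : ℝ} (hε : 0 ≤ ε) (h0 : R 0 = 0)
    (hR : ∀ t ∈ Icc (0 : ℝ) 1, HasDerivWithinAt R (R' t) (Icc 0 1) t)
    (hb : ∀ t ∈ Icc (0 : ℝ) 1, ‖R' t‖ ≤ ‖R t‖ + ε) {t : ℝ} (ht : t ∈ Icc (0 : ℝ) 1) :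
    ‖R t‖ ≤ 2 * ε := by
  have h := norm_le_gronwallBound_of_norm_deriv_right_le (f := R) (f' := R') (δ := 0) (K := 1)
    (ε := ε) (a := 0) (b := 1) (fun t ht => (hR t ht).continuousWithinAt)
    (fun t ht => (hR t (Ico_subset_Icc_self ht)).mono_of_mem_nhdsWithin (Icc_mem_nhdsGE_of_mem ht))
    (by simp [h0]) (fun t ht => by simpa using hb t (Ico_subset_Icc_self ht)) t ht
  rw [gronwallBound_of_K_ne_0 one_ne_zero] at h
  have h1 : Real.exp t ≤ 3 := by
    have := Real.exp_le_exp.2 ht.2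
    linarith [Real.exp_one_lt_d9]
  simp only [zero_mul, one_mul, div_one, sub_zero, zero_add] at h
  nlinarith

variable {E 𝔸 : Type*} [NormedAddCommGroup E] [NormedSpace ℝ E] [NormedRing 𝔸] [NormedAlgebra ℝ 𝔸]

/-- The derivative of a frame `b` that is parallel for the connection form `γ`. -/
def parallelDeriv (b : 𝔸) (γ : E →L[ℝ] 𝔸) : E →L[ℝ] 𝔸 :=
  ContinuousLinearMap.mul ℝ 𝔸 b ∘L γ

lemma parallelDeriv_apply (b : 𝔸) (γ : E →L[ℝ] 𝔸) (v : E) :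
    parallelDeriv b γ v = b * γ v := rfl

/-- `d + Γ` is a flat connection on the small convex neighbourhood `s` of `0`, with `C` a bound for
`Γ` and its derivatives. -/
structure IsFlatConnectionOn (Γ : E → E →L[ℝ] 𝔸) (Γ' : E → E →L[ℝ] E →L[ℝ] 𝔸) (s : Set E)
    (C : ℝ) : Prop where
  convex : Convex ℝ s
  zero_mem : (0 : E) ∈ s
  hasFDerivWithinAt : ∀ x ∈ s, HasFDerivWithinAt Γ (Γ' x) s x
  norm_le : ∀ x ∈ s, ‖Γ x‖ ≤ C
  norm_deriv_le : ∀ x ∈ s, ‖Γ' x‖ ≤ C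
  lipschitz_deriv : ∀ x ∈ s, ∀ y ∈ s, ‖Γ' y - Γ' x‖ ≤ C * ‖y - x‖
  norm_le_one : ∀ x ∈ s, ‖x‖ ≤ 1
  mul_norm_le_half : ∀ x ∈ s, C * ‖x‖ ≤ 1 / 2
  flat : ∀ x ∈ s, ∀ a b, Γ' x a b - Γ' x b a + Γ x a * Γ x b - Γ x b * Γ x a = 0

namespace IsFlatConnectionOn

variable {Γ : E → E →L[ℝ] 𝔸} {Γ' : E → E →L[ℝ] E →L[ℝ] 𝔸} {s : Set E} {C : ℝ}
  (h : IsFlatConnectionOn Γ Γ' s C)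

include h

lemma smul_mem {x : E} (hx : x ∈ s) {t : ℝ} (ht : t ∈ Icc (0 : ℝ) 1) : t • x ∈ s :=
  h.convex.smul_mem_of_zero_mem h.zero_mem hx ht

lemma nonneg : 0 ≤ C := (norm_nonneg _).trans (h.norm_le 0 h.zero_mem)

lemma hasDerivWithinAt_ray {x : E} (hx : x ∈ s) {t : ℝ} (ht : t ∈ Icc (0 : ℝ) 1) :
    HasDerivWithinAt (fun t : ℝ => Γ (t • x)) (Γ' (t • x) x) (Icc 0 1) t := by
  have h1 : HasDerivWithinAt (fun t : ℝ => t • x) x (Icc 0 1) t := by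
    simpa using (hasDerivWithinAt_id t (Icc (0 : ℝ) 1)).smul_const x
  exact (h.hasFDerivWithinAt _ (h.smul_mem hx ht)).comp_hasDerivWithinAt t h1
    fun t ht => h.smul_mem hx ht

lemma norm_apply_le {x : E} (hx : x ∈ s) (v : E) : ‖Γ x v‖ ≤ C * ‖v‖ :=
  (Γ x).le_of_opNorm_le (h.norm_le x hx) v

lemma norm_ray_le {x : E} (hx : x ∈ s) {t : ℝ} (ht : t ∈ Icc (0 : ℝ) 1) :
    ‖Γ (t • x) x‖ ≤ 1 / 2 :=
  (h.norm_apply_le (h.smul_mem hx ht) x).trans (h.mul_norm_le_half x hx)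

lemma norm_sub_le {x y : E} (hx : x ∈ s) (hy : y ∈ s) : ‖Γ y - Γ x‖ ≤ C * ‖y - x‖ :=
  h.convex.norm_image_sub_le_of_norm_hasFDerivWithin_le h.hasFDerivWithinAt h.norm_deriv_le hx hy

lemma norm_sub_sub_le {x y : E} (hx : x ∈ s) (hy : y ∈ s) :
    ‖Γ y - Γ x - Γ' x (y - x)‖ ≤ C * ‖y - x‖ * ‖y - x‖ := by
  have hsub : segment ℝ x y ⊆ s := h.convex.segment_subset hx hy
  refine (convex_segment x y).norm_image_sub_le_of_norm_hasFDerivWithin_le' (s := segment ℝ x y)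
    (fun z hz => (h.hasFDerivWithinAt z (hsub hz)).mono hsub) (fun z hz => ?_)
    (left_mem_segment ℝ x y) (right_mem_segment ℝ x y)
  refine (h.lipschitz_deriv x hx z (hsub hz)).trans
    (mul_le_mul_of_nonneg_left (norm_sub_le_of_mem_segment hz) h.nonneg)

/-- Parallel transport along the ray through `x`, by Picard–Lindelöf. -/
lemma exists_ray_solution [CompleteSpace 𝔸] (h1 : ‖(1 : 𝔸)‖ ≤ 1) {x : E} (hx : x ∈ s) :
    ∃ b : ℝ → 𝔸, b 0 = 1 ∧
      ∀ t ∈ Icc (0 : ℝ) 1, HasDerivWithinAt b (b t * Γ (t • x) x) (Icc 0 1) t := by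
  -- On the unit ball about 1 one has `‖b‖ ≤ 2`, and `‖Γ (t • x) x‖ ≤ 1 / 2`, so the speed is at
  -- most 1 and the solution stays in the ball up to time 1.
  have hP : IsPicardLindelof (fun t (b : 𝔸) => b * Γ (t • x) x) (tmin := 0) (tmax := 1)
      ⟨0, by simp⟩ 1 1 0 1 1 := by
    refine ⟨fun t ht => ?_, fun b _ => ?_, fun t ht b hb => ?_, by simp⟩
    · refine LipschitzOnWith.of_dist_le_mul fun b _ c _ => ?_
      rw [dist_eq_norm, dist_eq_norm, ← sub_mul]
      refine (norm_mul_le _ _).trans ?_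
      rw [mul_comm]
      refine mul_le_mul_of_nonneg_right ((h.norm_ray_le hx ht).trans (by norm_num)) (norm_nonneg _)
    · refine continuousOn_const.mul fun t ht => ?_
      exact ((h.hasDerivWithinAt_ray hx ht).continuousWithinAt).clm_apply continuousWithinAt_const
    · have h2 : ‖b‖ ≤ 2 := by
        have := norm_le_norm_add_norm_sub' b 1
        rw [mem_closedBall_iff_norm] at hb
        simp only [NNReal.coe_one] at hb
        linarith
      refine (norm_mul_le _ _).trans ?_
      have := h.norm_ray_le hx ht
      simp only [NNReal.coe_one]
      nlinarith [norm_nonneg b, norm_nonneg (Γ (t • x) x)]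
  exact hP.exists_eq_forall_mem_Icc_hasDerivWithinAt₀

lemma ray_solution_unique {x : E} (hx : x ∈ s) {b c : ℝ → 𝔸} (h0 : b 0 = c 0)
    (hb : ∀ t ∈ Icc (0 : ℝ) 1, HasDerivWithinAt b (b t * Γ (t • x) x) (Icc 0 1) t)
    (hc : ∀ t ∈ Icc (0 : ℝ) 1, HasDerivWithinAt c (c t * Γ (t • x) x) (Icc 0 1) t)
    {t : ℝ} (ht : t ∈ Icc (0 : ℝ) 1) : b t = c t := by
  have := norm_le_two_mul_of_norm_deriv_le (R := fun t => b t - c t) le_rfl (by simp [h0])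
    (fun t ht => (hb t ht).sub (hc t ht)) (fun t ht => ?_) ht
  · simpa [sub_eq_zero] using this
  · rw [← sub_mul, add_zero]
    refine (norm_mul_le _ _).trans ?_
    have := h.norm_ray_le hx ht
    nlinarith [norm_nonneg (b t - c t)]

lemma norm_ray_solution_le (h1 : ‖(1 : 𝔸)‖ ≤ 1) {x : E} (hx : x ∈ s) {b : ℝ → 𝔸} (h0 : b 0 = 1)
    (hb : ∀ t ∈ Icc (0 : ℝ) 1, HasDerivWithinAt b (b t * Γ (t • x) x) (Icc 0 1) t)
    {t : ℝ} (ht : t ∈ Icc (0 : ℝ) 1) : ‖b t‖ ≤ 2 := by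
  have := norm_le_two_mul_of_norm_deriv_le (R := fun t => b t - 1) (ε := 1 / 2) (by norm_num)
    (by simp [h0]) (fun t ht => (hb t ht).sub_const 1) (fun t ht => ?_) ht
  · have h2 := norm_le_norm_add_norm_sub' (b t) 1
    linarith
  · have h2 := h.norm_ray_le hx ht
    have h3 : b t * Γ (t • x) x = (b t - 1) * Γ (t • x) x + Γ (t • x) x := by noncomm_ring
    rw [h3]
    refine (norm_add_le _ _).trans (add_le_add ((norm_mul_le _ _).trans ?_) h2)
    nlinarith [norm_nonneg (b t - 1)]

lemma norm_ray_sub_le {x y : E} (hx : x ∈ s) (hy : y ∈ s) {t : ℝ} (ht : t ∈ Icc (0 : ℝ) 1) :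
    ‖Γ (t • y) y - Γ (t • x) x‖ ≤ 2 * C * ‖y - x‖ := by
  have h1 : Γ (t • y) y - Γ (t • x) x = (Γ (t • y) - Γ (t • x)) y + Γ (t • x) (y - x) := by
    simp [map_sub]
  have h2 := h.norm_sub_le (h.smul_mem hx ht) (h.smul_mem hy ht)
  have h3 : ‖t • y - t • x‖ ≤ ‖y - x‖ := by
    rw [← smul_sub, norm_smul, Real.norm_eq_abs, abs_of_nonneg ht.1]
    exact mul_le_of_le_one_left (norm_nonneg _) ht.2
  have h4 := (Γ (t • y) - Γ (t • x)).le_opNorm y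
  have h5 := h.norm_apply_le (h.smul_mem hx ht) (y - x)
  have h6 := h.norm_le_one y hy
  have h7 := h.nonneg
  rw [h1]
  refine (norm_add_le _ _).trans ?_
  have h8 : ‖Γ (t • y) - Γ (t • x)‖ ≤ C * ‖y - x‖ :=
    h2.trans (mul_le_mul_of_nonneg_left h3 h7)
  have h9 : ‖Γ (t • y) - Γ (t • x)‖ * ‖y‖ ≤ C * ‖y - x‖ :=
    (mul_le_of_le_one_right (norm_nonneg _) h6).trans h8
  linarith

lemma norm_ray_solution_sub_le (h1 : ‖(1 : 𝔸)‖ ≤ 1) {x y : E} (hx : x ∈ s) (hy : y ∈ s)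
    {b c : ℝ → 𝔸} (hb0 : b 0 = 1) (hc0 : c 0 = 1)
    (hb : ∀ t ∈ Icc (0 : ℝ) 1, HasDerivWithinAt b (b t * Γ (t • x) x) (Icc 0 1) t)
    (hc : ∀ t ∈ Icc (0 : ℝ) 1, HasDerivWithinAt c (c t * Γ (t • y) y) (Icc 0 1) t)
    {t : ℝ} (ht : t ∈ Icc (0 : ℝ) 1) : ‖c t - b t‖ ≤ 8 * C * ‖y - x‖ := by
  have h7 := h.nonneg
  have := norm_le_two_mul_of_norm_deriv_le (R := fun t => c t - b t) (ε := 4 * C * ‖y - x‖)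
    (by positivity) (by simp [hb0, hc0]) (fun t ht => (hc t ht).sub (hb t ht)) (fun t ht => ?_) ht
  · linarith
  · have h3 : c t * Γ (t • y) y - b t * Γ (t • x) x =
      (c t - b t) * Γ (t • x) x + c t * (Γ (t • y) y - Γ (t • x) x) := by noncomm_ring
    rw [h3]
    have h4 := h.norm_ray_le hx ht
    have h5 := h.norm_ray_sub_le hx hy ht
    have h6 := h.norm_ray_solution_le h1 hy hc0 hc ht
    refine (norm_add_le _ _).trans (add_le_add ((norm_mul_le _ _).trans ?_)
      ((norm_mul_le _ _).trans ?_))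
    · nlinarith [norm_nonneg (c t - b t)]
    · have := mul_le_mul h6 h5 (norm_nonneg _) (by norm_num)
      linarith

/-- The expected first variation of the ray solution at time `t`, when `x` moves to `y`, is `t • (b
t * Γ (t • x) (y - x))`. Vanishing curvature is what makes this expression solve the linearised
equation, so the true difference deviates from it by a term quadratic in `y - x`. -/
lemma norm_ray_solution_taylor_le (h1 : ‖(1 : 𝔸)‖ ≤ 1) {x y : E} (hx : x ∈ s) (hy : y ∈ s)
    {b c : ℝ → 𝔸} (hb0 : b 0 = 1) (hc0 : c 0 = 1)
    (hb : ∀ t ∈ Icc (0 : ℝ) 1, HasDerivWithinAt b (b t * Γ (t • x) x) (Icc 0 1) t)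
    (hc : ∀ t ∈ Icc (0 : ℝ) 1, HasDerivWithinAt c (c t * Γ (t • y) y) (Icc 0 1) t) :
    ‖c 1 - b 1 - b 1 * Γ x (y - x)‖ ≤ 2 * ((16 * C ^ 2 + 4 * C) * ‖y - x‖ ^ 2) := by
  have hC := h.nonneg
  have hP : ∀ t ∈ Icc (0 : ℝ) 1, HasDerivWithinAt (fun t : ℝ => t • (b t * Γ (t • x) (y - x)))
      (t • (b t * Γ (t • x) x * Γ (t • x) (y - x) + b t * Γ' (t • x) x (y - x)) +
        (1 : ℝ) • (b t * Γ (t • x) (y - x))) (Icc 0 1) t := fun t ht => by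
    have h2 := (hb t ht).mul ((h.hasDerivWithinAt_ray hx ht).clm_apply
      (hasDerivWithinAt_const t (Icc (0 : ℝ) 1) (y - x)))
    exact ((hasDerivWithinAt_id t (Icc (0 : ℝ) 1)).smul h2).congr_deriv (by simp)
  have := norm_le_two_mul_of_norm_deriv_le
    (R := fun t => c t - b t - t • (b t * Γ (t • x) (y - x)))
    (ε := (16 * C ^ 2 + 4 * C) * ‖y - x‖ ^ 2) (by positivity) (by simp [hb0, hc0])
    (fun t ht => ((hc t ht).sub (hb t ht)).sub (hP t ht)) (fun t ht => ?_) (t := 1) (by simp)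
  · simpa using this
  · have hfl : Γ' (t • x) x (y - x) = Γ' (t • x) (y - x) x - Γ (t • x) x * Γ (t • x) (y - x) +
        Γ (t • x) (y - x) * Γ (t • x) x := by
      have := h.flat _ (h.smul_mem hx ht) x (y - x)
      rw [← sub_eq_zero, ← this]; abel
    -- The error `R` satisfies `R' = R * Γ (t • x) x` plus terms of second order in `y - x`.
    have h3 : c t * Γ (t • y) y - b t * Γ (t • x) x -
        (t • (b t * Γ (t • x) x * Γ (t • x) (y - x) + b t * Γ' (t • x) x (y - x)) +
        (1 : ℝ) • (b t * Γ (t • x) (y - x))) =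
        (c t - b t - t • (b t * Γ (t • x) (y - x))) * Γ (t • x) x +
        ((c t - b t) * (Γ (t • y) y - Γ (t • x) x) +
          b t * ((Γ (t • y) - Γ (t • x) - Γ' (t • x) (t • y - t • x)) x +
            (Γ (t • y) - Γ (t • x)) (y - x))) := by
      rw [hfl, ← smul_sub t y x]
      simp only [sub_apply, map_smul, smul_apply, map_sub, one_smul, smul_add, smul_sub, mul_add, mul_sub, sub_mul,
        smul_mul_assoc, mul_smul_comm, mul_assoc]
      abel
    rw [h3]
    have hxt := h.smul_mem hx ht
    have hyt := h.smul_mem hy ht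
    have e1 := h.norm_ray_le hx ht
    have e2 := h.norm_ray_sub_le hx hy ht
    have e3 := h.norm_ray_solution_le h1 hx hb0 hb ht
    have e4 := h.norm_ray_solution_sub_le h1 hx hy hb0 hc0 hb hc ht
    have e5 : ‖t • y - t • x‖ ≤ ‖y - x‖ := by
      rw [← smul_sub, norm_smul, Real.norm_eq_abs, abs_of_nonneg ht.1]
      exact mul_le_of_le_one_left (norm_nonneg _) ht.2
    have e6 : ‖(Γ (t • y) - Γ (t • x) - Γ' (t • x) (t • y - t • x)) x‖ ≤ C * ‖y - x‖ ^ 2 := by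
      refine (ContinuousLinearMap.le_opNorm _ _).trans
        ((mul_le_of_le_one_right (norm_nonneg _) (h.norm_le_one x hx)).trans
          ((h.norm_sub_sub_le hxt hyt).trans ?_))
      rw [mul_assoc, sq]
      gcongr
    have e7 : ‖(Γ (t • y) - Γ (t • x)) (y - x)‖ ≤ C * ‖y - x‖ ^ 2 := by
      refine (ContinuousLinearMap.le_opNorm _ _).trans ?_
      have := (h.norm_sub_le hxt hyt).trans (mul_le_mul_of_nonneg_left e5 hC)
      refine (mul_le_mul_of_nonneg_right this (norm_nonneg _)).trans (by rw [sq, mul_assoc])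
    refine (norm_add_le _ _).trans (add_le_add ((norm_mul_le _ _).trans ?_)
      ((norm_add_le _ _).trans ?_))
    · exact mul_le_of_le_one_right (norm_nonneg _) (e1.trans (by norm_num))
    · have f1 := (norm_mul_le (c t - b t) (Γ (t • y) y - Γ (t • x) x)).trans
        (mul_le_mul e4 e2 (norm_nonneg _) (by positivity))
      have f2 := (norm_add_le _ _).trans (add_le_add e6 e7)
      have f3 := (norm_mul_le _ _).trans (mul_le_mul e3 f2 (norm_nonneg _) (by norm_num))
      nlinarith

/-- A flat connection has a parallel frame. -/
theorem exists_parallel [CompleteSpace 𝔸] (h1 : ‖(1 : 𝔸)‖ ≤ 1) :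
    ∃ B : E → 𝔸, B 0 = 1 ∧
      ∀ x ∈ s, HasFDerivWithinAt B (parallelDeriv (B x) (Γ x)) s x := by
  choose b hb0 hb using fun x : s => h.exists_ray_solution h1 x.2
  classical
  let B : E → 𝔸 := fun x => if hx : x ∈ s then b ⟨x, hx⟩ 1 else 1
  have hB : ∀ x (hx : x ∈ s), B x = b ⟨x, hx⟩ 1 := fun x hx => dif_pos hx
  refine ⟨B, ?_, fun x hx => ?_⟩
  · rw [hB 0 h.zero_mem]
    refine h.ray_solution_unique h.zero_mem (c := fun _ => 1) (hb0 _) (hb _) (fun t ht => ?_)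
      (by simp)
    simpa using hasDerivWithinAt_const t (Icc (0 : ℝ) 1) (1 : 𝔸)
  · refine .of_isLittleO ?_
    have hO : (fun y => B y - B x - parallelDeriv (B x) (Γ x) (y - x))
        =O[𝓝[s] x] fun y => ‖y - x‖ ^ 2 := by
      refine Asymptotics.IsBigO.of_bound (2 * (16 * C ^ 2 + 4 * C)) ?_
      filter_upwards [self_mem_nhdsWithin] with y hy
      have := h.norm_ray_solution_taylor_le h1 hx hy (hb0 ⟨x, hx⟩) (hb0 ⟨y, hy⟩) (hb ⟨x, hx⟩)
        (hb ⟨y, hy⟩)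
      rw [hB x hx, hB y hy, norm_pow, norm_norm, mul_assoc]
      exact this
    have ho : (fun y => ‖y - x‖ ^ 2) =o[𝓝[s] x] fun y => y - x := by
      refine (Asymptotics.isLittleO_norm_pow_id (E' := E) one_lt_two).comp_tendsto
        (k := fun y => y - x) ?_
      have : Tendsto (fun y => y - x) (𝓝 x) (𝓝 (x - x)) := tendsto_id.sub_const x
      rw [sub_self] at this
      exact this.mono_left nhdsWithin_le_nhds
    exact hO.trans_isLittleO ho

end IsFlatConnectionOn

end FlatConnection

/-! ### What a parallel frame preserves. -/

section ParallelFrame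

lemma eq_zero_of_norm_deriv_le {F : Type*} [NormedAddCommGroup F] [NormedSpace ℝ F]
    {R R' : ℝ → F} {K : ℝ} (h0 : R 0 = 0)
    (hR : ∀ t ∈ Icc (0 : ℝ) 1, HasDerivWithinAt R (R' t) (Icc 0 1) t)
    (hb : ∀ t ∈ Icc (0 : ℝ) 1, ‖R' t‖ ≤ K * ‖R t‖) {t : ℝ} (ht : t ∈ Icc (0 : ℝ) 1) :
    R t = 0 := by
  have h := norm_le_gronwallBound_of_norm_deriv_right_le (f := R) (f' := R') (δ := 0) (K := K)
    (ε := 0) (a := 0) (b := 1) (fun t ht => (hR t ht).continuousWithinAt)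
    (fun t ht => (hR t (Ico_subset_Icc_self ht)).mono_of_mem_nhdsWithin (Icc_mem_nhdsGE_of_mem ht))
    (by simp [h0]) (fun t ht => by simpa using hb t (Ico_subset_Icc_self ht)) t ht
  simpa [gronwallBound_ε0_δ0] using h

lemma abs_bilin_le (Δ : E4 →L[ℝ] E4 →L[ℝ] ℝ) {r : ℝ}
    (hr : ∀ i j, |Δ (EuclideanSpace.single i 1) (EuclideanSpace.single j 1)| ≤ r) (u : E4) (j : Fin 4) :
    |Δ u (EuclideanSpace.single j 1)| ≤ 4 * ‖u‖ * r ∧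
      |Δ (EuclideanSpace.single j 1) u| ≤ 4 * ‖u‖ * r := by
  have h4 : 4 * ‖u‖ * r = ∑ _i : Fin 4, ‖u‖ * r := by simp; ring
  rw [h4]
  constructor
  · conv_lhs => rw [sum_smul_single u]
    rw [map_sum, _root_.sum_apply]
    refine (Finset.abs_sum_le_sum_abs _ _).trans (Finset.sum_le_sum fun i _ => ?_)
    rw [map_smul, smul_apply, smul_eq_mul, abs_mul]
    exact mul_le_mul (PiLp.norm_apply_le u i) (hr i j) (abs_nonneg _) (norm_nonneg _)
  · conv_lhs => rw [sum_smul_single u]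
    rw [map_sum]
    refine (Finset.abs_sum_le_sum_abs _ _).trans (Finset.sum_le_sum fun i _ => ?_)
    rw [map_smul, smul_eq_mul, abs_mul]
    exact mul_le_mul (PiLp.norm_apply_le u i) (hr j i) (abs_nonneg _) (norm_nonneg _)

variable {Γ : E4 → E4 →L[ℝ] E4 →L[ℝ] E4} {Γ' : E4 → E4 →L[ℝ] E4 →L[ℝ] E4 →L[ℝ] E4}
  {s : Set E4} {C : ℝ}

lemma hasDerivWithinAt_comp_ray (h : IsFlatConnectionOn Γ Γ' s C) {F : Type*}
    [NormedAddCommGroup F] [NormedSpace ℝ F] {f : E4 → F} {x : E4} (hx : x ∈ s) {t : ℝ}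
    {L : E4 →L[ℝ] F} (hf : HasFDerivWithinAt f L s (t • x)) :
    HasDerivWithinAt (fun t : ℝ => f (t • x)) (L x) (Icc 0 1) t := by
  have h1 : HasDerivWithinAt (fun t : ℝ => t • x) x (Icc 0 1) t := by
    simpa using (hasDerivWithinAt_id t (Icc (0 : ℝ) 1)).smul_const x
  exact hf.comp_hasDerivWithinAt t h1 fun t ht => h.smul_mem hx ht

variable {B : E4 → E4 →L[ℝ] E4}

/-- Along a ray the difference `Δ` of the two forms solves the linear equation `Δ' = Δ(Γ·, ·) + Δ(·,
Γ·)` and vanishes at the start. -/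
lemma gram_parallel_eq (h : IsFlatConnectionOn Γ Γ' s C) (hB0 : B 0 = 1)
    (hB : ∀ x ∈ s, HasFDerivWithinAt B (parallelDeriv (B x) (Γ x)) s x)
    {G : E4 → E4 →L[ℝ] E4 →L[ℝ] ℝ}
    (hG : ∀ x ∈ s, ∀ v w, ∃ L : E4 →L[ℝ] ℝ, HasFDerivWithinAt (fun z => G z v w) L s x ∧
      ∀ u, L u = G x (Γ x u v) w + G x v (Γ x u w)) {x : E4} (hx : x ∈ s) (v w : E4) :
    G 0 (B x v) (B x w) = G x v w := by
  let Δ : ℝ → E4 →L[ℝ] E4 →L[ℝ] ℝ := fun t =>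
    (G 0).bilinearComp (B (t • x)) (B (t • x)) - G (t • x)
  have hΔ : ∀ t v w, Δ t v w = G 0 (B (t • x) v) (B (t • x) w) - G (t • x) v w := fun t v w => rfl
  have hd : ∀ t ∈ Icc (0 : ℝ) 1, ∀ v w, HasDerivWithinAt (fun t => Δ t v w)
      (Δ t (Γ (t • x) x v) w + Δ t v (Γ (t • x) x w)) (Icc 0 1) t := by
    intro t ht v w
    have hxt := h.smul_mem hx ht
    have hb : ∀ v, HasDerivWithinAt (fun t : ℝ => B (t • x) v) (B (t • x) (Γ (t • x) x v))
        (Icc 0 1) t := fun v => by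
      refine ((hasDerivWithinAt_comp_ray h hx (hB _ hxt)).clm_apply
        (hasDerivWithinAt_const t (Icc (0 : ℝ) 1) v)).congr_deriv ?_
      rw [map_zero, add_zero, parallelDeriv_apply]
      rfl
    obtain ⟨L, hL, hLx⟩ := hG _ hxt v w
    have h1 := hasDerivWithinAt_comp_ray h hx hL
    have h2 : HasDerivWithinAt (fun t : ℝ => G 0 (B (t • x) v)) (G 0 (B (t • x) (Γ (t • x) x v)))
        (Icc 0 1) t := (G 0).hasFDerivAt.comp_hasDerivWithinAt t (hb v)
    have h3 := (h2.clm_apply (hb w)).sub h1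
    refine h3.congr_deriv ?_
    rw [hΔ, hΔ, hLx]
    ring
  let R : ℝ → Fin 4 × Fin 4 → ℝ := fun t p =>
    Δ t (EuclideanSpace.single p.1 1) (EuclideanSpace.single p.2 1)
  have hRb : ∀ t i j, |Δ t (EuclideanSpace.single i 1) (EuclideanSpace.single j 1)| ≤ ‖R t‖ :=
    fun t i j => norm_le_pi_norm (R t) (i, j)
  -- Each of the two terms of the derivative is at most `4 * (1 / 2)` times the largest entry of
  -- `Δ`, which gives the rate 4.
  have hR := eq_zero_of_norm_deriv_le (R := R) (K := 4) (t := 1)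
    (R' := fun t p => Δ t (Γ (t • x) x (EuclideanSpace.single p.1 1)) (EuclideanSpace.single p.2 1) +
      Δ t (EuclideanSpace.single p.1 1) (Γ (t • x) x (EuclideanSpace.single p.2 1)))
    (by ext p; simp [R, hΔ, hB0]) (fun t ht => hasDerivWithinAt_pi.2 fun p => hd t ht _ _)
    (fun t ht => (pi_norm_le_iff_of_nonneg (by positivity)).2 fun p => ?_) (by simp)
  · have h0 : Δ 1 = 0 := by
      refine ContinuousLinearMap.coe_injective
        ((EuclideanSpace.basisFun (Fin 4) ℝ).toBasis.ext fun i => ?_)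
      refine ContinuousLinearMap.coe_injective
        ((EuclideanSpace.basisFun (Fin 4) ℝ).toBasis.ext fun j => ?_)
      simpa using congrFun hR (i, j)
    have h1 : Δ 1 v w = 0 := by rw [h0]; rfl
    rw [hΔ, sub_eq_zero, one_smul] at h1
    exact h1
  · have hγ : ∀ i, ‖Γ (t • x) x (EuclideanSpace.single i 1)‖ ≤ 1 / 2 := fun i => by
      refine (ContinuousLinearMap.le_opNorm _ _).trans ?_
      simpa using h.norm_ray_le hx ht
    have e1 := (abs_bilin_le (Δ t) (hRb t) (Γ (t • x) x (EuclideanSpace.single p.1 1)) p.2).1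
    have e2 := (abs_bilin_le (Δ t) (hRb t) (Γ (t • x) x (EuclideanSpace.single p.2 1)) p.1).2
    rw [Real.norm_eq_abs]
    refine (abs_add_le _ _).trans ?_
    have := norm_nonneg (R t)
    nlinarith [hγ p.1, hγ p.2]

/-- When the radial connection form preserves the range of `P`, the product `Q * B * P` solves a
homogeneous linear equation with initial value `Q * P = 0`. It is used for `P` a projection onto the
boundary hyperplane and `Q` built from the unit normal. -/
lemma inner_parallel_eq_zero (h : IsFlatConnectionOn Γ Γ' s C) (hB0 : B 0 = 1)
    (hB : ∀ x ∈ s, HasFDerivWithinAt B (parallelDeriv (B x) (Γ x)) s x)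
    {Q P : E4 →L[ℝ] E4} (hQP : Q * P = 0) {x : E4} (hx : x ∈ s)
    (hΓ : ∀ t ∈ Icc (0 : ℝ) 1, Γ (t • x) x * P = P * Γ (t • x) x * P) :
    Q * B x * P = 0 := by
  have := eq_zero_of_norm_deriv_le (R := fun t : ℝ => Q * B (t • x) * P) (K := ‖P‖) (t := 1)
    (R' := fun t => Q * (B (t • x) * Γ (t • x) x) * P) (by simp [hB0, hQP])
    (fun t ht => ?_) (fun t ht => ?_) (by simp)
  · simpa using this
  · have h1 := hasDerivWithinAt_comp_ray h hx (hB _ (h.smul_mem hx ht))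
    exact (h1.const_mul Q).mul_const P
  · have h1 : Q * (B (t • x) * Γ (t • x) x) * P = (Q * B (t • x) * P) * (Γ (t • x) x * P) := by
      calc Q * (B (t • x) * Γ (t • x) x) * P = Q * B (t • x) * (Γ (t • x) x * P) := by
            simp only [mul_assoc]
        _ = _ := by conv_lhs => rw [hΓ t ht]
                    simp only [mul_assoc]
    rw [h1]
    refine (norm_mul_le _ _).trans ?_
    have h2 := (norm_mul_le (Γ (t • x) x) P).trans
      (mul_le_mul_of_nonneg_right ((h.norm_ray_le hx ht).trans (by norm_num : (1 / 2 : ℝ) ≤ 1))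
        (norm_nonneg _))
    rw [mul_comm]
    exact mul_le_mul_of_nonneg_right (by simpa using h2) (norm_nonneg _)

end ParallelFrame

/-! ### Uniform bounds near a point. -/

section Frame

lemma eventually_norm_lt_add_one {E F : Type*} [TopologicalSpace E] [NormedAddCommGroup F]
    {f : E → F} {R N : Set E} {z₀ : E} (hf : ContinuousWithinAt f N z₀) (hN : N ∈ 𝓝[R] z₀) :
    ∀ᶠ z in 𝓝[R] z₀, ‖f z‖ < ‖f z₀‖ + 1 :=
  (hf.mono_of_mem_nhdsWithin hN).norm.eventually_lt_const (by simp)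

lemma norm_sub_le_of_lipschitzOnWith {E F : Type*} [NormedAddCommGroup E] [NormedAddCommGroup F]
    {f : E → F} {t : Set E} {K : NNReal} {C : ℝ} (hf : LipschitzOnWith K f t) (hKC : K ≤ C) {x y z : E}
    (hx : z + x ∈ t) (hy : z + y ∈ t) : ‖f (z + y) - f (z + x)‖ ≤ C * ‖y - x‖ := by
  have := hf.norm_sub_le hy hx
  rw [add_sub_add_left_eq_sub] at this
  exact this.trans (mul_le_mul_of_nonneg_right hKC (norm_nonneg _))

set_option synthInstance.maxHeartbeats 200000 in
set_option maxHeartbeats 1000000 in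
-- Smoothness bounds `Γ`, its derivative and the Lipschitz constant of the derivative near `z₀`. The
-- convex set `R`, in the application the closed half-space, lets boundary points be treated like
-- interior ones.
lemma exists_isFlatConnectionOn {E 𝔸 : Type*} [NormedAddCommGroup E] [NormedSpace ℝ E]
    [NormedRing 𝔸] [NormedAlgebra ℝ 𝔸] {Γ : E → E →L[ℝ] 𝔸} {N R : Set E} {z₀ : E} (hR : Convex ℝ R)
    (hz₀ : z₀ ∈ N) (hNR : N ⊆ R) (hN : N ∈ 𝓝[R] z₀) (hu : UniqueDiffOn ℝ N)
    (hΓ : ContDiffOn ℝ ∞ Γ N)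
    (hflat : ∀ z ∈ N, ∀ a b, fderivWithin ℝ Γ N z a b - fderivWithin ℝ Γ N z b a + Γ z a * Γ z b -
      Γ z b * Γ z a = 0) :
    ∃ ε > 0, R ∩ Metric.ball z₀ ε ⊆ N ∧ ∃ C, IsFlatConnectionOn (fun h => Γ (z₀ + h))
      (fun h => fderivWithin ℝ Γ N (z₀ + h)) {h | z₀ + h ∈ R ∩ Metric.ball z₀ ε} C := by
  have hΓ' : ContDiffOn ℝ 1 (fderivWithin ℝ Γ N) N := hΓ.fderivWithin hu (by
    exact WithTop.coe_le_coe.2 (le_top : (1 + 1 : ℕ∞) ≤ ⊤))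
  have hΓ1 : ContDiffOn ℝ 1 Γ N := hΓ.of_le (WithTop.coe_le_coe.2 (le_top : (1 : ℕ∞) ≤ ⊤))
  obtain ⟨K, t, ht, hK⟩ := ((hΓ' z₀ hz₀).mono_of_mem_nhdsWithin hN).exists_lipschitzOnWith hR
  have h1 : ∀ᶠ z in 𝓝[R] z₀, ‖Γ z‖ < ‖Γ z₀‖ + 1 :=
    eventually_norm_lt_add_one (hΓ1 z₀ hz₀).continuousWithinAt hN
  have h2 : ∀ᶠ z in 𝓝[R] z₀, ‖fderivWithin ℝ Γ N z‖ < ‖fderivWithin ℝ Γ N z₀‖ + 1 :=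
    eventually_norm_lt_add_one (hΓ' z₀ hz₀).continuousWithinAt hN
  obtain ⟨ε, hε, hsub⟩ := Metric.mem_nhdsWithin_iff.1 ((h1.and h2).and (Filter.inter_mem hN ht))
  -- One constant that dominates the three local bounds; the radius `1 / (2 * C)` then yields `C *
  -- ‖x‖ ≤ 1 / 2`.
  set C : ℝ := ‖Γ z₀‖ + 1 + (‖fderivWithin ℝ Γ N z₀‖ + 1) + K with hC
  have hC0 : 0 < C := by positivity
  set δ := min ε (min 1 (1 / (2 * C))) with hδ
  have hδ0 : 0 < δ := by positivity
  have hs : R ∩ Metric.ball z₀ δ ⊆ {z | (‖Γ z‖ < ‖Γ z₀‖ + 1 ∧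
      ‖fderivWithin ℝ Γ N z‖ < ‖fderivWithin ℝ Γ N z₀‖ + 1) ∧ z ∈ N ∩ t} := fun z hz =>
    hsub ⟨Metric.ball_subset_ball (min_le_left _ _) hz.2, hz.1⟩
  have hsN : R ∩ Metric.ball z₀ δ ⊆ N := fun z hz => (hs hz).2.1
  have hnorm : ∀ h, z₀ + h ∈ R ∩ Metric.ball z₀ δ → ‖h‖ < δ := fun h hh => by
    simpa using hh.2
  refine ⟨δ, hδ0, hsN, C, ?_⟩
  constructor
  · exact (hR.inter (convex_ball z₀ δ)).translate_preimage_right z₀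
  · simpa using ⟨hNR hz₀, hδ0⟩
  · intro x hx
    have h3 := ((hΓ1.differentiableOn (by simp) _ (hsN hx)).hasFDerivWithinAt).mono hsN
    have h4 : HasFDerivWithinAt (fun h => z₀ + h) (ContinuousLinearMap.id ℝ E)
        {h | z₀ + h ∈ R ∩ Metric.ball z₀ δ} x := (hasFDerivWithinAt_id x _).const_add z₀
    exact h3.comp x h4 fun h hh => hh
  · intro x hx
    have := (hs hx).1.1
    have := norm_nonneg (fderivWithin ℝ Γ N z₀)
    have := K.2
    change _ ≤ _ + (K : ℝ)
    linarith
  · intro x hx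
    have := (hs hx).1.2
    have := norm_nonneg (Γ z₀)
    have := K.2
    change _ ≤ _ + (K : ℝ)
    linarith
  · intro x hx y hy
    refine norm_sub_le_of_lipschitzOnWith hK ?_ (hs hx).2.2 (hs hy).2.2
    rw [hC]
    have h1 := norm_nonneg (Γ z₀)
    have h2 := norm_nonneg (fderivWithin ℝ Γ N z₀)
    linarith
  · intro x hx
    exact (hnorm x hx).le.trans ((min_le_right _ _).trans (min_le_left _ _))
  · intro x hx
    have h3 := (hnorm x hx).le.trans ((min_le_right _ _).trans (min_le_right _ _))
    calc C * ‖x‖ ≤ C * (1 / (2 * C)) := by gcongr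
      _ = 1 / 2 := by field_simp
  · intro x hx a b
    exact hflat _ (hsN hx) a b

end Frame

/-! ### Integrating the parallel frame to an isometric map. -/

section ChartFrame

lemma contDiffOn_succ_of_hasFDerivWithinAt {E F : Type*} [NormedAddCommGroup E] [NormedSpace ℝ E]
    [NormedAddCommGroup F] [NormedSpace ℝ F] {f : E → F} {f' : E → E →L[ℝ] F} {s : Set E} {n : ℕ}
    (h : ∀ x ∈ s, HasFDerivWithinAt f (f' x) s x) (h' : ContDiffOn ℝ n f' s) :
    ContDiffOn ℝ (n + 1) f s := by
  rw [contDiffOn_succ_iff_hasFDerivWithinAt (by simp)]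
  intro x hx
  rw [insert_eq_of_mem hx]
  exact ⟨s, self_mem_nhdsWithin, by simp, f', h, h'⟩

lemma contDiffOn_one_parallel {E 𝔸 : Type*} [NormedAddCommGroup E] [NormedSpace ℝ E]
    [NormedRing 𝔸] [NormedAlgebra ℝ 𝔸] {B : E → 𝔸} {Γ : E → E →L[ℝ] 𝔸} {s : Set E}
    (h : ∀ x ∈ s, HasFDerivWithinAt B (parallelDeriv (B x) (Γ x)) s x) (hΓ : ContinuousOn Γ s) :
    ContDiffOn ℝ 1 B s := by
  have hB : ContinuousOn B s := fun x hx => (h x hx).continuousWithinAt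
  have := contDiffOn_succ_of_hasFDerivWithinAt (n := 0) h (by
    rw [Nat.cast_zero, contDiffOn_zero]
    exact ((ContinuousLinearMap.mul ℝ 𝔸).continuous.comp_continuousOn hB).clm_comp hΓ)
  simpa using this

lemma hasFDerivWithinAt_mul_parallel {E 𝔸 : Type*} [NormedAddCommGroup E] [NormedSpace ℝ E]
    [NormedRing 𝔸] [NormedAlgebra ℝ 𝔸] {B : E → 𝔸} {Γ : E → E →L[ℝ] 𝔸} {s : Set E} {z₀ z : E} (L : 𝔸)
    (h : HasFDerivWithinAt B (parallelDeriv (B (z - z₀)) (Γ z)) {h | z₀ + h ∈ s} (z - z₀)) :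
    HasFDerivWithinAt (fun z => L * B (z - z₀)) (parallelDeriv (L * B (z - z₀)) (Γ z)) s z := by
  have h1 : HasFDerivWithinAt (fun z => z - z₀) (ContinuousLinearMap.id ℝ E) s z :=
    (hasFDerivWithinAt_id z s).sub_const z₀
  have h2 := (h.comp z h1 fun w hw => by simpa using hw).const_mul L
  refine h2.congr_fderiv ?_
  ext v
  simp [parallelDeriv_apply, mul_assoc]

variable {M : Type*} [TopologicalSpace M] [ChartedSpace (EuclideanHalfSpace 4) M]
  [IsManifold (𝓡∂ 4) ∞ M]
  [RiemannianBundle (fun x : M => TangentSpace (𝓡∂ 4) x)]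
  [IsContMDiffRiemannianBundle (𝓡∂ 4) ∞ E4 (fun x : M => TangentSpace (𝓡∂ 4) x)]
  {D : CovariantDerivative (𝓡∂ 4) E4 (fun x : M => TangentSpace (𝓡∂ 4) x)}

lemma exists_inner_eq_gram (x : M) :
    ∃ L : E4 →L[ℝ] E4, ∀ v w, inner ℝ (L v) (L w) = gram x x v w := by
  have hf : Module.finrank ℝ (TangentSpace (𝓡∂ 4) x) = 4 :=
    (finrank_euclideanSpace_fin : Module.finrank ℝ E4 = 4)
  have : FiniteDimensional ℝ (TangentSpace (𝓡∂ 4) x) :=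
    inferInstanceAs (FiniteDimensional ℝ E4)
  let e : TangentSpace (𝓡∂ 4) x ≃ₗᵢ[ℝ] E4 :=
    (stdOrthonormalBasis ℝ (TangentSpace (𝓡∂ 4) x)).repr.trans
      (LinearIsometryEquiv.piLpCongrLeft 2 ℝ ℝ (finCongr hf))
  let L : E4 →ₗ[ℝ] E4 :=
    { toFun := fun v => e (coordField x v x)
      map_add' := fun v w => by rw [coordField_add, Pi.add_apply, map_add]
      map_smul' := fun c v => by rw [coordField_smul, Pi.smul_apply, map_smul]; rfl }
  exact ⟨L.toContinuousLinearMap, fun v w => e.inner_map_map _ _⟩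

/-- Subtract from the image of the vertical vector its projection to the image of the hyperplane;
injectivity of `L` makes the remainder nonzero. -/
lemma exists_unit_normal {L : E4 →L[ℝ] E4} (hL : Function.Injective L) :
    ∃ n : E4, ‖n‖ = 1 ∧ 0 < inner ℝ n (L (EuclideanSpace.single 0 1)) ∧
      ∀ w : E4, w 0 = 0 → inner ℝ n (L w) = 0 := by
  let W : Submodule ℝ E4 := (LinearMap.ker (EuclideanSpace.proj 0 : E4 →L[ℝ] ℝ).toLinearMap).map L.toLinearMap
  set u := L (EuclideanSpace.single 0 1) with hu
  set n := u - W.starProjection u with hn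
  have hort : n ∈ Wᗮ := W.sub_starProjection_mem_orthogonal u
  have hn0 : n ≠ 0 := by
    intro h
    have h1 : u ∈ W := by
      rw [sub_eq_zero.1 h]; exact W.starProjection_apply_mem u
    obtain ⟨w, hw, hwu⟩ := h1
    have h2 : w = EuclideanSpace.single 0 1 := hL hwu
    have h3 : w 0 = 0 := hw
    rw [h2] at h3
    simp at h3
  have hpos : 0 < inner ℝ n u := by
    have h1 : inner ℝ n u = inner ℝ n n := by
      have h2 : inner ℝ n (W.starProjection u) = 0 :=
        W.inner_left_of_mem_orthogonal (W.starProjection_apply_mem u) hort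
      conv_rhs => rw [hn, inner_sub_right, ← hn, h2, sub_zero]
    rw [h1]
    exact real_inner_self_pos.2 hn0
  have hnn : 0 < ‖n‖ := norm_pos_iff.2 hn0
  refine ⟨‖n‖⁻¹ • n, by rw [norm_smul, norm_inv, norm_norm, inv_mul_cancel₀ hnn.ne'], ?_, ?_⟩
  · rw [real_inner_smul_left]
    positivity
  · intro w hw
    have hm : L w ∈ W := Submodule.mem_map_of_mem hw
    rw [real_inner_smul_left, W.inner_left_of_mem_orthogonal hm hort, mul_zero]

/-- The frame `L * B` starts from an isometry `L` of the tangent space at `x` with ℝ⁴. Being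
parallel it remains isometric, being torsion free it is a differential, and over the totally
geodesic boundary it keeps tangent vectors in the fixed hyperplane orthogonal to `n`. -/
theorem exists_chartFrame [T2Space M] (hD : IsLeviCivita D) (hF : IsFlat D)
    (hT : HasTotallyGeodesicBoundary D) (x : M) :
    ∃ ε > 0, range (𝓡∂ 4) ∩ Metric.ball (extChartAt (𝓡∂ 4) x x) ε ⊆ (extChartAt (𝓡∂ 4) x).target ∧
      ∃ (B : E4 → E4 →L[ℝ] E4) (Φ : E4 → E4) (n : E4), Φ (extChartAt (𝓡∂ 4) x x) = 0 ∧
        ContDiffOn ℝ 1 B (range (𝓡∂ 4) ∩ Metric.ball (extChartAt (𝓡∂ 4) x x) ε) ∧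
        (∀ z ∈ range (𝓡∂ 4) ∩ Metric.ball (extChartAt (𝓡∂ 4) x x) ε,
          HasFDerivWithinAt Φ (B z) (range (𝓡∂ 4) ∩ Metric.ball (extChartAt (𝓡∂ 4) x x) ε) z ∧
          ∀ v w, inner ℝ (B z v) (B z w) = chartGram x z v w) ∧
        ‖n‖ = 1 ∧ 0 < inner ℝ n (B (extChartAt (𝓡∂ 4) x x) (EuclideanSpace.single 0 1)) ∧
        (extChartAt (𝓡∂ 4) x x 0 = 0 →
          ∀ z ∈ range (𝓡∂ 4) ∩ Metric.ball (extChartAt (𝓡∂ 4) x x) ε, z 0 = 0 →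
            ∀ w, w 0 = 0 → inner ℝ n (B z w) = 0) := by
  set z₀ := extChartAt (𝓡∂ 4) x x with hz₀
  set N := (extChartAt (𝓡∂ 4) x).target with hN
  have hz₀N : z₀ ∈ N := mem_extChartAt_target x
  have hR : Convex ℝ (range (𝓡∂ 4)) := (𝓡∂ 4).convex_range
  obtain ⟨ε, hε, hsub, C, hC⟩ := exists_isFlatConnectionOn (Γ := chartChristoffel D x) hR hz₀N
    (extChartAt_target_subset_range x) (extChartAt_target_mem_nhdsWithin x)
    (uniqueDiffOn_extChartAt_target x) (contDiffOn_chartChristoffel hD x) (fun z hz a b => by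
      ext1 c
      exact fderivWithin_chartChristoffel_flat hD hF hz a b c)
  set s := range (𝓡∂ 4) ∩ Metric.ball z₀ ε with hs
  obtain ⟨B, hB0, hB⟩ := hC.exists_parallel ContinuousLinearMap.norm_id_le
  obtain ⟨L, hL⟩ := exists_inner_eq_gram x
  have hz₀s : z₀ ∈ s := ⟨extChartAt_target_subset_range x hz₀N, Metric.mem_ball_self hε⟩
  have hsm : ∀ z ∈ s, z - z₀ ∈ {h | z₀ + h ∈ s} := fun z hz => by simpa using hz
  have hBL : ∀ z ∈ s, HasFDerivWithinAt (fun z => L * B (z - z₀))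
      (parallelDeriv (L * B (z - z₀)) (chartChristoffel D x z)) s z := fun z hz => by
    refine hasFDerivWithinAt_mul_parallel L ?_
    have := hB _ (hsm z hz)
    rwa [add_sub_cancel] at this
  have hgram : ∀ v w, inner ℝ (L v) (L w) = chartGram x z₀ v w := fun v w => by
    rw [hL, chartGram, hz₀, extChartAt_to_inv]
  have hLinj : Function.Injective L := by
    rw [injective_iff_map_eq_zero]
    intro v hv
    have h1 : chartGram x z₀ v = 0 := by
      ext w
      rw [← hgram, hv, inner_zero_left]; rfl
    exact (isInvertible_chartGram hz₀N).injective (h1.trans (map_zero _).symm)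
  -- The Poincaré lemma on a convex set: the derivative of `L * B` is `L * B * Γ`, so symmetry of
  -- `Γ` says that this one-form is closed.
  obtain ⟨Φ, hΦ⟩ := (hR.inter (convex_ball z₀ ε)).exists_forall_hasFDerivWithinAt_of_hasFDerivWithinAt_symmetric
    hBL (fun z hz u _ v _ => by
      have hzN := hsub hz
      have h1 : chartChristoffel D x z u v = chartChristoffel D x z v u := by
        rw [chartChristoffel_apply hzN, chartChristoffel_apply hzN,
          christoffel_symm hD ((extChartAt (𝓡∂ 4) x).map_target hzN)]
      exact congrArg (L * B (z - z₀)) h1)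
  obtain ⟨n, hn1, hnpos, hnW⟩ := exists_unit_normal hLinj
  refine ⟨ε, hε, hsub, fun z => L * B (z - z₀), fun z => Φ z - Φ z₀, n, sub_self _, ?_, ?_, hn1, ?_, ?_⟩
  · exact contDiffOn_one_parallel hBL ((contDiffOn_chartChristoffel hD x).continuousOn.mono hsub)
  · refine fun z hz => ⟨(hΦ z hz).sub_const _, fun v w => ?_⟩
    have h1 := gram_parallel_eq hC hB0 hB (G := fun h => chartGram x (z₀ + h)) (fun h hh v w => by
      obtain ⟨L, hL, hLu⟩ := hasFDerivWithinAt_chartGram_apply hD (hsub hh) v w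
      refine ⟨L, ?_, hLu⟩
      have h4 : HasFDerivWithinAt (fun h => z₀ + h) (ContinuousLinearMap.id ℝ E4)
          {h | z₀ + h ∈ s} h := (hasFDerivWithinAt_id h _).const_add z₀
      exact (hL.mono inter_subset_left).comp h h4 fun h hh => hh) (hsm z hz) v w
    rw [add_zero, add_sub_cancel] at h1
    rw [← h1, ← hgram]
    rfl
  · simpa [hB0] using hnpos
  · intro hz00 z hz hz0 w hw
    -- `P` projects to the boundary hyperplane along the vertical axis, and `Q w` is `⟪n, L w⟫ n`;
    -- total geodesy says that the connection form in a boundary direction preserves the range of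
    -- `P`.
    let P : E4 →L[ℝ] E4 := ContinuousLinearMap.id ℝ E4 -
      (EuclideanSpace.proj 0 : E4 →L[ℝ] ℝ).smulRight (EuclideanSpace.single 0 1)
    let Q : E4 →L[ℝ] E4 := ((innerSL ℝ n) ∘L L).smulRight n
    have hP : ∀ w : E4, w 0 = 0 → P w = w := fun w hw => by simp [P, hw]
    have hP0 : ∀ w : E4, P w 0 = 0 := fun w => by simp [P]
    have hQ : ∀ w, Q w = inner ℝ n (L w) • n := fun w => rfl
    have h1 := inner_parallel_eq_zero hC hB0 hB (Q := Q) (P := P) (by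
      ext1 w
      change Q (P w) = 0
      rw [hQ, hnW _ (hP0 w), zero_smul]) (hsm z hz) (fun t ht => by
      ext1 w
      refine (hP _ ?_).symm
      refine chartChristoffel_eq_zero_of_boundary hT (hsub (hC.smul_mem (hsm z hz) ht)) ?_ ?_ (hP0 w)
      · simp [hz00, hz0]
      · simp [hz00, hz0])
    have h2 : Q (B (z - z₀) (P w)) = 0 := congrArg (fun T : E4 →L[ℝ] E4 => T w) h1
    rw [hP w hw, hQ] at h2
    have hn0 : n ≠ 0 := fun h => by simp [h] at hn1
    exact (smul_eq_zero.1 h2).resolve_right hn0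

end ChartFrame

/-! ### Inverting the map up to the boundary. -/

section LocalInverse

/-- The nearest point projection to the half-space `0 ≤ z 0`. -/
def toUpper (z : E4) : E4 := z + (max (z 0) 0 - z 0) • EuclideanSpace.single 0 1

lemma toUpper_zero (z : E4) : toUpper z 0 = max (z 0) 0 := by simp [toUpper]

lemma toUpper_of_ne (z : E4) {i : Fin 4} (hi : i ≠ 0) : toUpper z i = z i := by
  simp [toUpper, hi]

lemma toUpper_of_nonneg {z : E4} (hz : 0 ≤ z 0) : toUpper z = z := by
  simp [toUpper, max_eq_left hz]

lemma norm_toUpper_sub_le (x y : E4) : ‖toUpper x - toUpper y‖ ≤ ‖x - y‖ := by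
  rw [EuclideanSpace.norm_eq, EuclideanSpace.norm_eq]
  refine Real.sqrt_le_sqrt (Finset.sum_le_sum fun i _ => ?_)
  refine pow_le_pow_left₀ (norm_nonneg _) ?_ 2
  by_cases hi : i = 0
  · subst hi
    rw [PiLp.sub_apply, PiLp.sub_apply, toUpper_zero, toUpper_zero]
    exact abs_max_sub_max_le_abs _ _ _
  · rw [PiLp.sub_apply, PiLp.sub_apply, toUpper_of_ne x hi, toUpper_of_ne y hi]

lemma exists_equiv_of_injective {L : E4 →L[ℝ] E4} (hL : Function.Injective L) :
    ∃ e : E4 ≃L[ℝ] E4, (e : E4 →L[ℝ] E4) = L :=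
  ⟨(LinearEquiv.ofInjectiveEndo L.toLinearMap hL).toContinuousLinearEquiv, by ext1 v; rfl⟩

/-- At a boundary point `Φ` is known on one side only. It is extended by its linear part in the
vertical direction; since `toUpper` is 1-Lipschitz, the extension is as close to the linear map `B
z₀` as `Φ` is, which suffices for a local homeomorphism. The vector `m` is the inner normal of the
image, and 0 at an interior point. -/
theorem exists_openPartialHomeomorph_halfSpace {z₀ : E4} {ε : ℝ} (hε : 0 < ε) (hz₀ : 0 ≤ z₀ 0)
    {s : Set E4} (hs : s = {z : E4 | 0 ≤ z 0} ∩ Metric.ball z₀ ε)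
    {B : E4 → E4 →L[ℝ] E4} {Φ : E4 → E4} {n : E4}
    (hB : ContDiffOn ℝ 1 B s) (hΦ : ∀ z ∈ s, HasFDerivWithinAt Φ (B z) s z)
    (hΦ0 : Φ z₀ = 0)
    (hinj : ∀ z ∈ s, Function.Injective (B z)) (hn1 : ‖n‖ = 1)
    (hn : 0 < inner ℝ n (B z₀ (EuclideanSpace.single 0 1)))
    (hbd : z₀ 0 = 0 → ∀ z ∈ s, z 0 = 0 → ∀ w, w 0 = 0 → inner ℝ n (B z w) = 0) :
    ∃ (T : OpenPartialHomeomorph E4 E4) (m : E4) (δ : ℝ), 0 < δ ∧ δ ≤ ε ∧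
      T.source = Metric.ball z₀ δ ∧ (m = 0 ∨ ‖m‖ = 1) ∧ (m = 0 ↔ 0 < z₀ 0) ∧
      (∀ z ∈ Metric.ball z₀ δ, 0 ≤ z 0 → T z = Φ z) ∧
      (∀ z ∈ Metric.ball z₀ δ, (0 ≤ z 0 ↔ 0 ≤ inner ℝ m (T z))) ∧
      (∀ z ∈ Metric.ball z₀ δ, z 0 = 0 ↔ m ≠ 0 ∧ inner ℝ m (T z) = 0) ∧
      ∀ z ∈ Metric.ball z₀ δ, 0 < z 0 → ContDiffAt ℝ 2 T.symm (T z) := by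
  have hR : Convex ℝ {z : E4 | 0 ≤ z 0} := by
    rw [← range_modelWithCorners_eq]; exact (𝓡∂ 4).convex_range
  have hz₀s : z₀ ∈ s := hs ▸ ⟨hz₀, Metric.mem_ball_self hε⟩
  obtain ⟨e, he⟩ := exists_equiv_of_injective (hinj z₀ hz₀s)
  set κ : ℝ := inner ℝ n (B z₀ (EuclideanSpace.single 0 1)) with hκ
  have hepos : 0 < ‖(e.symm : E4 →L[ℝ] E4)‖ := by
    exact e.norm_symm_pos
  -- The bound `c < κ` makes `⟪n, Φ z⟫` grow with the height of `z`; the bound by the inverse norm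
  -- is the hypothesis of the inverse function theorem.
  obtain ⟨c, hc0, hcκ, hce⟩ : ∃ c : ℝ, 0 < c ∧ c < κ ∧ c < ‖(e.symm : E4 →L[ℝ] E4)‖⁻¹ := by
    refine ⟨min κ ‖(e.symm : E4 →L[ℝ] E4)‖⁻¹ / 2, by positivity, ?_, ?_⟩
    · have := min_le_left κ ‖(e.symm : E4 →L[ℝ] E4)‖⁻¹
      linarith
    · have := min_le_right κ ‖(e.symm : E4 →L[ℝ] E4)‖⁻¹
      have h2 : 0 < ‖(e.symm : E4 →L[ℝ] E4)‖⁻¹ := by positivity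
      linarith
  have hBc : ∀ᶠ z in 𝓝[s] z₀, ‖B z - B z₀‖ < c := by
    have h1 : ContinuousWithinAt (fun z => B z - B z₀) s z₀ :=
      (hB z₀ hz₀s).continuousWithinAt.sub continuousWithinAt_const
    exact h1.norm.eventually_lt_const (by simpa using hc0)
  obtain ⟨δ₀, hδ₀, hδs⟩ := Metric.mem_nhdsWithin_iff.1 hBc
  -- For an interior centre the ball is kept inside the open half-space.
  let δ₁ : ℝ := if 0 < z₀ 0 then z₀ 0 else 1
  have hδ₁ : 0 < δ₁ := by
    by_cases h : 0 < z₀ 0 <;> simp [δ₁, h]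
  set δ := min δ₀ (min ε δ₁) with hδ
  have hδ0 : 0 < δ := by positivity
  have hδε : δ ≤ ε := (min_le_right _ _).trans (min_le_left _ _)
  have hint : 0 < z₀ 0 → ∀ z ∈ Metric.ball z₀ δ, 0 < z 0 := by
    intro h z hz
    have h1 : ‖z - z₀‖ < z₀ 0 := by
      have h2 : δ ≤ z₀ 0 := by
        have h3 : δ₁ = z₀ 0 := if_pos h
        exact h3 ▸ (min_le_right _ _ : δ ≤ min ε δ₁).trans (min_le_right _ _)
      exact (mem_ball_iff_norm.1 hz).trans_le h2
    have h3 : ‖(z - z₀) 0‖ ≤ ‖z - z₀‖ := PiLp.norm_apply_le (z - z₀) 0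
    rw [PiLp.sub_apply, Real.norm_eq_abs] at h3
    have := neg_abs_le (z 0 - z₀ 0)
    linarith
  set s' := {z : E4 | 0 ≤ z 0} ∩ Metric.ball z₀ δ with hs'
  have hs's : s' ⊆ s := hs ▸ inter_subset_inter_right _ (Metric.ball_subset_ball hδε)
  have hs'conv : Convex ℝ s' := hR.inter (convex_ball _ _)
  have hBs' : ∀ z ∈ s', ‖B z - B z₀‖ ≤ c := fun z hz =>
    (hδs ⟨Metric.ball_subset_ball (min_le_left _ _) hz.2, hs's hz⟩).le
  have happ : ∀ x ∈ s', ∀ y ∈ s', ‖Φ x - Φ y - B z₀ (x - y)‖ ≤ c * ‖x - y‖ := fun x hx y hy =>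
    hs'conv.norm_image_sub_le_of_norm_hasFDerivWithin_le'
      (fun z hz => (hΦ z (hs's hz)).mono hs's) hBs' hy hx
  have hup : ∀ z ∈ Metric.ball z₀ δ, toUpper z ∈ s' := by
    intro z hz
    refine ⟨?_, ?_⟩
    · change 0 ≤ toUpper z 0
      rw [toUpper_zero]; exact le_max_right _ _
    · rw [mem_ball_iff_norm] at hz ⊢
      refine lt_of_le_of_lt ?_ hz
      have := norm_toUpper_sub_le z z₀
      rwa [toUpper_of_nonneg hz₀] at this
  -- On the half-space this is `Φ`. The extension is continuous, but differentiability across the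
  -- hyperplane is not claimed.
  let F : E4 → E4 := fun z => Φ (toUpper z) + B z₀ (z - toUpper z)
  have hF : ∀ z : E4, 0 ≤ z 0 → F z = Φ z := fun z hz => by
    simp [F, toUpper_of_nonneg hz]
  lift c to NNReal using hc0.le
  have hFapp : ApproximatesLinearOn F (e : E4 →L[ℝ] E4) (Metric.ball z₀ δ) c := by
    intro x hx y hy
    have h1 : F x - F y - (e : E4 →L[ℝ] E4) (x - y) =
        Φ (toUpper x) - Φ (toUpper y) - B z₀ (toUpper x - toUpper y) := by
      simp only [F, he, map_sub]; abel
    rw [h1]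
    exact (happ _ (hup x hx) _ (hup y hy)).trans
      (mul_le_mul_of_nonneg_left (norm_toUpper_sub_le x y) hc0.le)
  let T := hFapp.toOpenPartialHomeomorph F (Metric.ball z₀ δ) (Or.inr (by
    rw [← NNReal.coe_lt_coe]; simpa using hce)) Metric.isOpen_ball
  have hT : ∀ z, T z = F z := fun z => rfl
  have hsmooth : ∀ z ∈ Metric.ball z₀ δ, 0 < z 0 → ContDiffAt ℝ 2 T.symm (T z) := by
    intro z hz hz0
    have hzs : z ∈ s' := ⟨hz0.le, hz⟩
    have hn : {z : E4 | 0 < z 0} ∈ 𝓝 z :=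
      (isOpen_lt continuous_const (EuclideanSpace.proj 0 : E4 →L[ℝ] ℝ).continuous).mem_nhds hz0
    have hsn : s ∈ 𝓝 z := by
      filter_upwards [hn, Metric.isOpen_ball.mem_nhds hz] with w hw hw'
      exact hs's ⟨le_of_lt hw, hw'⟩
    have hTΦ : T =ᶠ[𝓝 z] Φ := by
      filter_upwards [hn] with w hw
      exact hF w (le_of_lt hw)
    obtain ⟨e', he'⟩ := exists_equiv_of_injective (hinj z (hs's hzs))
    have hd : HasFDerivAt Φ (e' : E4 →L[ℝ] E4) z := he' ▸ (hΦ z (hs's hzs)).hasFDerivAt hsn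
    have hc2 : ContDiffOn ℝ 2 Φ s := by
      have := contDiffOn_succ_of_hasFDerivWithinAt (n := 1) hΦ (by exact_mod_cast hB)
      norm_num at this
      exact this
    have hzT : T.symm (T z) = z := T.left_inv hz
    refine T.contDiffAt_symm (T.map_source hz) (f₀' := e') ?_ ?_
    · rw [hzT]; exact hd.congr_of_eventuallyEq hTΦ
    · rw [hzT]; exact (hc2.contDiffAt hsn).congr_of_eventuallyEq hTΦ
  by_cases hpos : 0 < z₀ 0
  · have hz0 := hint hpos
    refine ⟨T, 0, δ, hδ0, hδε, rfl, Or.inl rfl, by simpa using hpos, fun z hz h => hF z h, ?_, ?_,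
      hsmooth⟩
    · intro z hz
      simpa using (hz0 z hz).le
    · intro z hz
      simpa using (hz0 z hz).ne'
  · have hz00 : z₀ 0 = 0 := le_antisymm (not_lt.1 hpos) hz₀
    have hbd' := hbd hz00
    have f0 : ∀ z ∈ s', z 0 = 0 → inner ℝ n (Φ z) = 0 := by
      intro z hz hz0
      have hline : ∀ t ∈ Icc (0 : ℝ) 1, z₀ + t • (z - z₀) ∈ s' := fun t ht =>
        hs'conv.add_smul_sub_mem ⟨hz₀, Metric.mem_ball_self hδ0⟩ hz ht
      have := eq_zero_of_norm_deriv_le (R := fun t : ℝ => inner ℝ n (Φ (z₀ + t • (z - z₀))))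
        (R' := fun _ => 0) (K := 0) (t := 1) (by simp [hΦ0]) (fun t ht => ?_) (by simp) (by simp)
      · simpa using this
      · have h1 : HasDerivWithinAt (fun t : ℝ => z₀ + t • (z - z₀)) (z - z₀) (Icc 0 1) t := by
          simpa using ((hasDerivWithinAt_id t (Icc (0 : ℝ) 1)).smul_const (z - z₀)).const_add z₀
        have h2 := ((hΦ _ (hs's (hline t ht))).mono hs's).comp_hasDerivWithinAt t h1 hline
        have h3 := (innerSL ℝ n).hasFDerivAt.comp_hasDerivWithinAt t h2
        refine h3.congr_deriv ?_
        exact hbd' _ (hs's (hline t ht)) (by simp [hz00, hz0]) _ (by simp [hz00, hz0])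
    have fpos : ∀ z ∈ s', 0 < z 0 → 0 < inner ℝ n (Φ z) := by
      intro z hz hz0
      -- The conjugate of `toUpper` by negation projects to the lower half-space, hence sends `z` to
      -- its foot `w` on the hyperplane. Being 1-Lipschitz and fixing `z₀`, it keeps `w` in the
      -- ball.
      have e1 : -toUpper (-z) = z - z 0 • EuclideanSpace.single 0 1 := by
        have : (-z) 0 ≤ 0 := by simpa using hz0.le
        rw [toUpper, max_eq_right this]
        simp; abel
      have e2 : -toUpper (-z₀) = z₀ := by
        rw [toUpper_of_nonneg (by simp [hz00]), neg_neg]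
      set w := z - z 0 • EuclideanSpace.single 0 1 with hw
      have hw0 : w 0 = 0 := by simp [hw]
      have hws : w ∈ s' := by
        refine ⟨hw0.ge, ?_⟩
        rw [mem_ball_iff_norm]
        refine lt_of_le_of_lt ?_ (mem_ball_iff_norm.1 hz.2)
        have := norm_toUpper_sub_le (-z) (-z₀)
        rw [← e1, ← norm_neg, show -(-toUpper (-z) - z₀) = toUpper (-z) - toUpper (-z₀) by
          conv_lhs => rw [← e2]
          abel]
        refine this.trans_eq ?_
        rw [← norm_neg]; congr 1; abel
      have h1 := happ z hz w hws
      have hzw : z - w = z 0 • EuclideanSpace.single 0 1 := by simp [hw]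
      have h2 : ‖z - w‖ = z 0 := by
        rw [hzw, norm_smul, Real.norm_eq_abs, abs_of_pos hz0]; simp
      have h3 := abs_real_inner_le_norm n (Φ z - Φ w - B z₀ (z - w))
      rw [hn1, one_mul] at h3
      have h4 : inner ℝ n (Φ z - Φ w - B z₀ (z - w)) = inner ℝ n (Φ z) - z 0 * κ := by
        rw [inner_sub_right, inner_sub_right, f0 w hws hw0, hzw, map_smul, real_inner_smul_right]
        ring
      rw [h4] at h3
      rw [h2] at h1
      have := neg_abs_le (inner ℝ n (Φ z) - z 0 * κ)
      nlinarith
    have fneg : ∀ z ∈ Metric.ball z₀ δ, z 0 < 0 → inner ℝ n (F z) < 0 := by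
      intro z hz hz0
      have h1 : inner ℝ n (Φ (toUpper z)) = 0 :=
        f0 _ (hup z hz) (by rw [toUpper_zero, max_eq_right hz0.le])
      have h2 : z - toUpper z = z 0 • EuclideanSpace.single 0 1 := by
        rw [toUpper, max_eq_right hz0.le]; simp
      change inner ℝ n (Φ (toUpper z) + B z₀ (z - toUpper z)) < 0
      rw [inner_add_right, h1, h2, map_smul, real_inner_smul_right, zero_add]
      exact mul_neg_of_neg_of_pos hz0 hn
    have hn0 : n ≠ 0 := fun h => by simp [h] at hn1
    refine ⟨T, n, δ, hδ0, hδε, rfl, Or.inr hn1, by simp [hn0, hz00], fun z hz h => hF z h, ?_, ?_,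
      hsmooth⟩
    · intro z hz
      rw [hT]
      refine ⟨fun h => ?_, fun h => ?_⟩
      · rw [hF z h]
        rcases h.eq_or_lt with h' | h'
        · exact (f0 z ⟨h, hz⟩ h'.symm).ge
        · exact (fpos z ⟨h, hz⟩ h').le
      · by_contra h'
        exact absurd h (not_le.2 (fneg z hz (not_le.1 h')))
    · intro z hz
      rw [hT]
      refine ⟨fun h => ⟨hn0, ?_⟩, fun ⟨_, h⟩ => ?_⟩
      · rw [hF z h.ge, f0 z ⟨h.ge, hz⟩ h]
      · rcases lt_trichotomy (z 0) 0 with h' | h' | h'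
        · exact absurd h (fneg z hz h').ne
        · exact h'
        · rw [hF z h'.le] at h
          exact absurd h (fpos z ⟨h'.le, hz⟩ h').ne'

end LocalInverse

/-! ### Isometric charts with values in Euclidean half-balls. -/

section FlatChart

/-- The half-space with inner normal `n`, or the whole space if `n = 0`. -/
def halfSpaceOf (n : E4) : Set E4 := {w | 0 ≤ inner ℝ n w}

variable {M : Type*} [TopologicalSpace M] [ChartedSpace (EuclideanHalfSpace 4) M]
  [RiemannianBundle (fun x : M => TangentSpace (𝓡∂ 4) x)]

/-- An isometric chart around `x` with values in a Euclidean half-space or the Euclidean space. -/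
structure FlatChart (x : M) where
  n : E4
  r : ℝ
  U : Set M
  φ : M → E4
  q : E4 → M
  norm_n : n = 0 ∨ ‖n‖ = 1
  r_pos : 0 < r
  isOpen_U : IsOpen U
  mem_U : x ∈ U
  φ_self : φ x = 0
  φ_mem : ∀ y ∈ U, φ y ∈ halfSpaceOf n ∩ Metric.ball 0 r
  q_mem : ∀ w ∈ halfSpaceOf n ∩ Metric.ball 0 r, q w ∈ U
  q_φ : ∀ y ∈ U, q (φ y) = y
  φ_q : ∀ w ∈ halfSpaceOf n ∩ Metric.ball 0 r, φ (q w) = w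
  continuousOn_q : ContinuousOn q (halfSpaceOf n ∩ Metric.ball 0 r)
  contMDiffAt_φ : ∀ y ∈ U, ContMDiffAt (𝓡∂ 4) 𝓘(ℝ, E4) 2 φ y
  norm_tderiv_φ : ∀ y ∈ U, ∀ v, ‖tderiv φ y v‖ = ‖v‖
  contMDiffAt_q : ∀ w ∈ Metric.ball (0 : E4) r, (n = 0 ∨ 0 < inner ℝ n w) →
    ContMDiffAt 𝓘(ℝ, E4) (𝓡∂ 4) 2 q w
  mem_boundary_iff : ∀ y ∈ U, y ∈ (𝓡∂ 4).boundary M ↔ n ≠ 0 ∧ inner ℝ n (φ y) = 0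

variable [IsManifold (𝓡∂ 4) ∞ M]
  [IsContMDiffRiemannianBundle (𝓡∂ 4) ∞ E4 (fun x : M => TangentSpace (𝓡∂ 4) x)]
  {D : CovariantDerivative (𝓡∂ 4) E4 (fun x : M => TangentSpace (𝓡∂ 4) x)}

set_option maxHeartbeats 400000 in
-- The chart is `Φ` after the preferred chart, with the inverse of the extended map going back. The
-- inverse is asserted to be differentiable only off the boundary, where the extension agrees with
-- `Φ` on a full neighbourhood.
theorem nonempty_flatChart [T2Space M] (hD : IsLeviCivita D) (hF : IsFlat D)
    (hT : HasTotallyGeodesicBoundary D) (x : M) : Nonempty (FlatChart x) := by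
  obtain ⟨ε, hε, hsub, B, Φ, n, hΦ0, hB, hΦ, hn1, hn, hbd⟩ := exists_chartFrame hD hF hT x
  set z₀ := extChartAt (𝓡∂ 4) x x with hz₀
  set N := (extChartAt (𝓡∂ 4) x).target with hN
  set s := range (𝓡∂ 4) ∩ Metric.ball z₀ ε with hs
  have hNR : ∀ z ∈ N, 0 ≤ z 0 := fun z hz => by
    have := extChartAt_target_subset_range x hz
    rwa [range_modelWithCorners_eq] at this
  have hinj : ∀ z ∈ s, Function.Injective (B z) := fun z hz => by
    rw [injective_iff_map_eq_zero]
    intro v hv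
    have h1 : chartGram x z v = 0 := by
      ext w
      rw [← (hΦ z hz).2, hv, inner_zero_left]; rfl
    exact (isInvertible_chartGram (hsub hz)).injective (h1.trans (map_zero _).symm)
  obtain ⟨T, m, δ, hδ, hδε, hTs, hm, hm0, hTΦ, hTK, hTb, hTc⟩ := exists_openPartialHomeomorph_halfSpace
    hε (hNR z₀ (mem_extChartAt_target x)) (by rw [hs, range_modelWithCorners_eq]) hB
    (fun z hz => (hΦ z hz).1) hΦ0 hinj hn1 hn hbd
  have hNb : ∀ z ∈ Metric.ball z₀ δ, 0 ≤ z 0 → z ∈ s := fun z hz h0 =>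
    ⟨by rw [range_modelWithCorners_eq]; exact h0, Metric.ball_subset_ball hδε hz⟩
  have hz₀δ : z₀ ∈ T.source := hTs ▸ Metric.mem_ball_self hδ
  have hTz : T z₀ = 0 :=
    (hTΦ z₀ (Metric.mem_ball_self hδ) (hNR z₀ (mem_extChartAt_target x))).trans hΦ0
  have hT0 : (0 : E4) ∈ T.target := hTz ▸ T.map_source hz₀δ
  obtain ⟨r, hr, hrT⟩ := Metric.isOpen_iff.1 T.open_target 0 hT0
  let U : Set M := (extChartAt (𝓡∂ 4) x).source ∩ (extChartAt (𝓡∂ 4) x) ⁻¹'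
    (T.source ∩ T ⁻¹' Metric.ball 0 r)
  have hUδ : ∀ y ∈ U, extChartAt (𝓡∂ 4) x y ∈ Metric.ball z₀ δ := fun y hy => hTs ▸ hy.2.1
  have hU0 : ∀ y ∈ U, 0 ≤ extChartAt (𝓡∂ 4) x y 0 := fun y hy =>
    hNR _ ((extChartAt (𝓡∂ 4) x).map_source hy.1)
  have hUs : ∀ y ∈ U, extChartAt (𝓡∂ 4) x y ∈ s := fun y hy => hNb _ (hUδ y hy) (hU0 y hy)
  have hUT : ∀ y ∈ U, T (extChartAt (𝓡∂ 4) x y) = Φ (extChartAt (𝓡∂ 4) x y) := fun y hy =>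
    hTΦ _ (hUδ y hy) (hU0 y hy)
  have hUo : IsOpen U := (continuousOn_extChartAt x).isOpen_inter_preimage
    (isOpen_extChartAt_source x) (T.isOpen_inter_preimage Metric.isOpen_ball)
  have hq : ∀ w ∈ halfSpaceOf m ∩ Metric.ball 0 r, T.symm w ∈ Metric.ball z₀ δ ∧
      0 ≤ T.symm w 0 ∧ T (T.symm w) = w := by
    intro w hw
    have h1 : T.symm w ∈ Metric.ball z₀ δ := hTs ▸ T.map_target (hrT hw.2)
    have h2 := T.right_inv (hrT hw.2)
    refine ⟨h1, (hTK _ h1).2 ?_, h2⟩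
    rw [h2]; exact hw.1
  have hqN : ∀ w ∈ halfSpaceOf m ∩ Metric.ball 0 r, T.symm w ∈ N := fun w hw =>
    hsub (hNb _ (hq w hw).1 (hq w hw).2.1)
  have hc2 : ContDiffOn ℝ 2 Φ s := by
    have := contDiffOn_succ_of_hasFDerivWithinAt (n := 1) (fun z hz => (hΦ z hz).1)
      (by exact_mod_cast hB)
    norm_num at this
    exact this
  have hsn : ∀ y ∈ U, (extChartAt (𝓡∂ 4) x) ⁻¹' s ∈ 𝓝 y := fun y hy => by
    filter_upwards [hUo.mem_nhds hy] with w hw using hUs w hw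
  have hder : ∀ y ∈ U, HasMFDerivAt (𝓡∂ 4) 𝓘(ℝ, E4) (Φ ∘ extChartAt (𝓡∂ 4) x) y
      (B (extChartAt (𝓡∂ 4) x y) ∘L coordDeriv x y) := fun y hy => by
    have h1 := ((contMDiffAt_extChartAt_of_mem hy.1).mdifferentiableAt (by simp)).hasMFDerivAt
    have h2 := (hΦ _ (hUs y hy)).1.hasMFDerivWithinAt
    have h3 := h2.comp y (h1.hasMFDerivWithinAt (s := (extChartAt (𝓡∂ 4) x) ⁻¹' s)) subset_rfl
    exact h3.hasMFDerivAt (hsn y hy)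
  refine ⟨⟨m, r, U, Φ ∘ extChartAt (𝓡∂ 4) x, fun w => (extChartAt (𝓡∂ 4) x).symm (T.symm w), hm, hr,
    hUo, ⟨mem_extChartAt_source x, hz₀δ, ?_⟩, hΦ0, ?_, ?_, ?_, ?_, ?_, ?_, ?_, ?_, ?_⟩⟩
  · have h1 : T z₀ ∈ Metric.ball 0 r := by
      rw [hTz]; exact Metric.mem_ball_self hr
    exact h1
  · intro y hy
    have h1 := hy.2.2
    rw [mem_preimage, hUT y hy] at h1
    refine ⟨?_, h1⟩
    have := (hTK _ (hUδ y hy)).1 (hU0 y hy)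
    rwa [hUT y hy] at this
  · intro w hw
    have h1 := hqN w hw
    refine ⟨(extChartAt (𝓡∂ 4) x).map_target h1, ?_⟩
    rw [mem_preimage, (extChartAt (𝓡∂ 4) x).right_inv h1]
    refine ⟨T.map_target (hrT hw.2), ?_⟩
    rw [mem_preimage, (hq w hw).2.2]
    exact hw.2
  · intro y hy
    change (extChartAt (𝓡∂ 4) x).symm (T.symm (Φ (extChartAt (𝓡∂ 4) x y))) = y
    rw [← hUT y hy, T.left_inv hy.2.1, (extChartAt (𝓡∂ 4) x).left_inv hy.1]
  · intro w hw
    change Φ (extChartAt (𝓡∂ 4) x ((extChartAt (𝓡∂ 4) x).symm (T.symm w))) = w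
    rw [(extChartAt (𝓡∂ 4) x).right_inv (hqN w hw), ← hTΦ _ (hq w hw).1 (hq w hw).2.1, (hq w hw).2.2]
  · exact (continuousOn_extChartAt_symm x).comp (T.continuousOn_symm.mono fun w hw => hrT hw.2) hqN
  · intro y hy
    have h1 := (hc2 _ (hUs y hy)).contMDiffWithinAt.comp y
      ((contMDiffAt_extChartAt_of_mem hy.1).of_le
        (WithTop.coe_le_coe.2 (le_top : (2 : ℕ∞) ≤ ⊤))).contMDiffWithinAt
      (s := (extChartAt (𝓡∂ 4) x) ⁻¹' s) (fun w hw => hw)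
    exact h1.contMDiffAt (hsn y hy)
  · intro y hy v
    have h1 : tderiv (Φ ∘ extChartAt (𝓡∂ 4) x) y = B (extChartAt (𝓡∂ 4) x y) ∘L coordDeriv x y :=
      (hder y hy).mfderiv
    have h2 := (hΦ _ (hUs y hy)).2 (coordDeriv x y v) (coordDeriv x y v)
    rw [chartGram, (extChartAt (𝓡∂ 4) x).left_inv hy.1, gram_apply, coordField_coordDeriv hy.1,
      real_inner_self_eq_norm_sq, real_inner_self_eq_norm_sq] at h2
    rw [h1]
    exact (pow_left_inj₀ (norm_nonneg _) (norm_nonneg _) two_ne_zero).1 h2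
  · intro w hw hmw
    have hwK : w ∈ halfSpaceOf m ∩ Metric.ball 0 r := ⟨by
      rcases hmw with h | h
      · simp [halfSpaceOf, h]
      · exact h.le, hw⟩
    have hz := hq w hwK
    have hz0 : 0 < T.symm w 0 := by
      refine lt_of_le_of_ne hz.2.1 fun h => ?_
      have h1 := (hTb _ hz.1).1 h.symm
      rw [hz.2.2] at h1
      rcases hmw with h | h
      · exact h1.1 h
      · exact h.ne' h1.2
    have h1 := hTc _ hz.1 hz0
    rw [hz.2.2] at h1
    have hNn : N ∈ 𝓝 (T.symm w) := by
      have hn : {z : E4 | 0 < z 0} ∈ 𝓝 (T.symm w) :=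
        (isOpen_lt continuous_const (EuclideanSpace.proj 0 : E4 →L[ℝ] ℝ).continuous).mem_nhds hz0
      filter_upwards [hn, Metric.isOpen_ball.mem_nhds hz.1] with v hv hv'
      exact hsub (hNb v hv' (le_of_lt hv))
    have h2 := ((contMDiffOn_extChartAt_symm (n := ∞) x).contMDiffAt hNn).of_le
      (m := 2) (WithTop.coe_le_coe.2 (le_top : (2 : ℕ∞) ≤ ⊤))
    exact h2.comp w h1.contMDiffAt
  · intro y hy
    rw [isBoundaryPoint_iff_extChartAt_eq_zero hy.1, hTb _ (hUδ y hy), hUT y hy]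
    rfl

end FlatChart

/-! ### Euclidean local isometries are affine. -/

section LocalIsometry

variable {E : Type*} [NormedAddCommGroup E] [InnerProductSpace ℝ E] [FiniteDimensional ℝ E]

/-- Differentiating `⟪T' b, T' c⟫ = ⟪b, c⟫` shows that `⟪T''(a, b), T' c⟫` is skew in `b, c`, while
it is symmetric in `a, b`. A trilinear form with both symmetries vanishes, and `T'` is onto. -/
lemma fderiv_fderiv_eq_zero_of_norm_eq {T : E → E} {V : Set E} (hV : IsOpen V)
    (hT : ContDiffOn ℝ 2 T V) (hn : ∀ x ∈ V, ∀ v, ‖fderiv ℝ T x v‖ = ‖v‖) {x : E} (hx : x ∈ V) :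
    HasFDerivAt (fderiv ℝ T) (0 : E →L[ℝ] E →L[ℝ] E) x := by
  have h2 : ContDiffAt ℝ 2 T x := hT.contDiffAt (hV.mem_nhds hx)
  have hsym := h2.isSymmSndFDerivAt (by simp)
  have hd : DifferentiableAt ℝ (fderiv ℝ T) x :=
    (h2.fderiv_right (m := 1) (by norm_num)).differentiableAt (by simp)
  have hi : ∀ y ∈ V, ∀ b c, inner ℝ (fderiv ℝ T y b) (fderiv ℝ T y c) = inner ℝ b c := fun y hy =>
    (LinearMap.norm_map_iff_inner_map_map (fderiv ℝ T y)).1 (hn y hy)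
  set H := fderiv ℝ (fderiv ℝ T) x with hH
  set L := fderiv ℝ T x with hL
  have hskew : ∀ a b c, inner ℝ (H a b) (L c) = - inner ℝ (H a c) (L b) := by
    intro a b c
    have hb : ∀ b, HasFDerivAt (fun y => fderiv ℝ T y b) (H.flip b) x := fun b => by
      simpa using hd.hasFDerivAt.clm_apply (hasFDerivAt_const b x)
    have h3 := (hb b).inner ℝ (hb c)
    have h4 : HasFDerivAt (fun y => inner ℝ (fderiv ℝ T y b) (fderiv ℝ T y c)) (0 : E →L[ℝ] ℝ) x := by
      refine (hasFDerivAt_const (inner ℝ b c) x).congr_of_eventuallyEq ?_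
      filter_upwards [hV.mem_nhds hx] with y hy using hi y hy b c
    have h5 := congrArg (fun l => l a) (h3.unique h4)
    simp at h5
    have h6 := real_inner_comm (fderiv ℝ T x b) (H a c)
    rw [hL]
    linarith
  have hzero : ∀ a b c, inner ℝ (H a b) (L c) = 0 := by
    intro a b c
    have hs : ∀ a b, H a b = H b a := fun a b => hsym a b
    have e1 := hskew a b c
    have e2 := hskew c a b
    have e3 := hskew b c a
    rw [hs a c] at e1
    rw [hs c b] at e2
    rw [hs b a] at e3
    linarith
  have hLs : Function.Surjective L := by
    refine LinearMap.surjective_of_injective (f := (L : E →ₗ[ℝ] E)) ?_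
    rw [injective_iff_map_eq_zero]
    intro v hv
    have := hn x hx v
    rw [← hL] at this
    rw [← norm_eq_zero, ← this, norm_eq_zero]
    exact hv
  have hH0 : H = 0 := by
    ext a b
    obtain ⟨c, hc⟩ := hLs (H a b)
    have := hzero a b c
    rw [hc] at this
    simpa using this
  rw [← hH0]
  exact hd.hasFDerivAt

theorem exists_affineIsometryEquiv_of_norm_fderiv_eq {T : E → E} {V : Set E} (hV : IsOpen V)
    (hc : Convex ℝ V) (hT : ContDiffOn ℝ 2 T V) (hn : ∀ x ∈ V, ∀ v, ‖fderiv ℝ T x v‖ = ‖v‖) :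
    ∃ A : E ≃ᵃⁱ[ℝ] E, ∀ x ∈ V, T x = A x := by
  rcases V.eq_empty_or_nonempty with rfl | ⟨x₀, hx₀⟩
  · exact ⟨AffineIsometryEquiv.refl ℝ E, by simp⟩
  let L : E →ₗᵢ[ℝ] E := ⟨(fderiv ℝ T x₀ : E →ₗ[ℝ] E), hn x₀ hx₀⟩
  let e : E ≃ₗᵢ[ℝ] E := L.toLinearIsometryEquiv rfl
  have hconst : ∀ x ∈ V, fderiv ℝ T x = fderiv ℝ T x₀ := fun x hx => by
    have := hc.norm_image_sub_le_of_norm_hasFDerivWithin_le (C := 0)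
      (fun y hy => (fderiv_fderiv_eq_zero_of_norm_eq hV hT hn hy).hasFDerivWithinAt)
      (fun y hy => by simp) hx₀ hx
    rw [zero_mul] at this
    exact sub_eq_zero.1 (norm_le_zero_iff.1 this)
  have haff : ∀ x ∈ V, T x = T x₀ + fderiv ℝ T x₀ (x - x₀) := fun x hx => by
    have := hc.norm_image_sub_le_of_norm_hasFDerivWithin_le' (C := 0) (φ := fderiv ℝ T x₀)
      (fun y hy => (((hT.contDiffAt (hV.mem_nhds hy)).differentiableAt
        (by simp)).hasFDerivAt).hasFDerivWithinAt)
      (fun y hy => by rw [hconst y hy]; simp) hx₀ hx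
    rw [zero_mul] at this
    have := norm_le_zero_iff.1 this
    rw [sub_sub, sub_eq_zero] at this
    exact this
  refine ⟨AffineIsometryEquiv.mk' (fun x => T x₀ + e (x - x₀)) e x₀ fun x => ?_, haff⟩
  simp [add_comm]

end LocalIsometry

/-! ### Transition maps between flat charts. -/

section Transition

/-- Used to pass from the open half-space, where charts can be differentiated, to the boundary by
continuity. -/
lemma eqOn_of_subset_closure_halfSpace {f g : E4 → E4} {n u : E4} {ε : ℝ}
    (h : ∀ w ∈ {w | n = 0 ∨ 0 < inner ℝ n w} ∩ Metric.ball u ε, f w = g w)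
    (hf : ContinuousOn f (halfSpaceOf n ∩ Metric.ball u ε)) (hg : Continuous g) :
    EqOn f g (halfSpaceOf n ∩ Metric.ball u ε) := by
  refine EqOn.of_subset_closure (s := {w | n = 0 ∨ 0 < inner ℝ n w} ∩ Metric.ball u ε) h hf
    hg.continuousOn ?_ ?_
  · rintro w ⟨hw | hw, hw'⟩
    · exact ⟨by simp [halfSpaceOf, hw], hw'⟩
    · exact ⟨le_of_lt hw, hw'⟩
  · rintro w ⟨hw, hw'⟩
    by_cases hn : n = 0
    · exact subset_closure ⟨Or.inl hn, hw'⟩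
    have hlim : Tendsto (fun t : ℝ => w + t • n) (𝓝[>] 0) (𝓝 w) := by
      have : Continuous fun t : ℝ => w + t • n := by fun_prop
      simpa using (this.tendsto 0).mono_left nhdsWithin_le_nhds
    refine mem_closure_of_tendsto hlim ?_
    filter_upwards [hlim (Metric.isOpen_ball.mem_nhds hw'), self_mem_nhdsWithin] with t ht ht0
    refine ⟨Or.inr ?_, ht⟩
    rw [inner_add_right, real_inner_smul_right]
    have h1 : 0 < inner ℝ n n := real_inner_self_pos.2 hn
    have h2 : 0 < t * inner ℝ n n := mul_pos ht0 h1
    have h3 : 0 ≤ inner ℝ n w := hw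
    linarith

lemma isOpen_openHalfSpace (n : E4) : IsOpen {w : E4 | n = 0 ∨ 0 < inner ℝ n w} := by
  by_cases hn : n = 0
  · simp [hn]
  · simp only [hn, false_or]
    exact isOpen_lt continuous_const (by fun_prop)

lemma convex_openHalfSpace (n : E4) : Convex ℝ {w : E4 | n = 0 ∨ 0 < inner ℝ n w} := by
  by_cases hn : n = 0
  · simp [hn, convex_univ]
  · simp only [hn, false_or]
    exact convex_halfSpace_gt (innerSL ℝ n).isBoundedLinearMap.toIsLinearMap 0

lemma convex_halfSpaceOf (n : E4) : Convex ℝ (halfSpaceOf n) :=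
  convex_halfSpace_ge (innerSL ℝ n).isBoundedLinearMap.toIsLinearMap 0

lemma isClosed_halfSpaceOf (n : E4) : IsClosed (halfSpaceOf n) :=
  isClosed_le continuous_const (by fun_prop)

variable {M : Type*} [TopologicalSpace M] [ChartedSpace (EuclideanHalfSpace 4) M]
  [RiemannianBundle (fun x : M => TangentSpace (𝓡∂ 4) x)]
  {E : Type*} [NormedAddCommGroup E] [InnerProductSpace ℝ E]

/-- The derivative of a map from a vector space to `M`. -/
def mapDeriv (s : E → M) (w : E) : E →L[ℝ] TangentSpace (𝓡∂ 4) (s w) :=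
  mfderiv 𝓘(ℝ, E) (𝓡∂ 4) s w

lemma hasFDerivAt_comp_mapDeriv {φ : M → E4} {s : E → M} {w : E}
    (hφ : MDifferentiableAt (𝓡∂ 4) 𝓘(ℝ, E4) φ (s w))
    (hs : MDifferentiableAt 𝓘(ℝ, E) (𝓡∂ 4) s w) :
    HasFDerivAt (φ ∘ s) (tderiv φ (s w) ∘L mapDeriv s w) w :=
  hasMFDerivAt_iff_hasFDerivAt.1 (hφ.hasMFDerivAt.comp w hs.hasMFDerivAt)

/-- The map `s` is twice continuously differentiable at `w`, with isometric derivative. -/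
structure IsIsometricAt (s : E → M) (w : E) : Prop where
  contMDiffAt : ContMDiffAt 𝓘(ℝ, E) (𝓡∂ 4) 2 s w
  norm_mapDeriv : ∀ v, ‖mapDeriv s w v‖ = ‖v‖

lemma IsIsometricAt.mdifferentiableAt {s : E → M} {w : E} (h : IsIsometricAt s w) :
    MDifferentiableAt 𝓘(ℝ, E) (𝓡∂ 4) s w := h.contMDiffAt.mdifferentiableAt (by simp)

namespace FlatChart

variable {x : M} (c : FlatChart x)

lemma mdifferentiableAt_φ {y : M} (hy : y ∈ c.U) : MDifferentiableAt (𝓡∂ 4) 𝓘(ℝ, E4) c.φ y :=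
  (c.contMDiffAt_φ y hy).mdifferentiableAt (by simp)

lemma isIsometricAt_q {w : E4} (hw : w ∈ Metric.ball (0 : E4) c.r)
    (hn : c.n = 0 ∨ 0 < inner ℝ c.n w) : IsIsometricAt c.q w := by
  have h2 := c.contMDiffAt_q w hw hn
  refine ⟨h2, fun v => ?_⟩
  have hwK : ∀ w ∈ {w | c.n = 0 ∨ 0 < inner ℝ c.n w} ∩ Metric.ball 0 c.r,
      w ∈ halfSpaceOf c.n ∩ Metric.ball 0 c.r := by
    rintro w ⟨h | h, h'⟩
    · exact ⟨by simp [halfSpaceOf, h], h'⟩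
    · exact ⟨le_of_lt h, h'⟩
  have hU := c.q_mem w (hwK w ⟨hn, hw⟩)
  have h1 := hasFDerivAt_comp_mapDeriv (c.mdifferentiableAt_φ hU) (h2.mdifferentiableAt (by simp))
  have h3 : HasFDerivAt (c.φ ∘ c.q) (ContinuousLinearMap.id ℝ E4) w := by
    refine (hasFDerivAt_id w).congr_of_eventuallyEq ?_
    filter_upwards [((isOpen_openHalfSpace c.n).inter Metric.isOpen_ball).mem_nhds ⟨hn, hw⟩]
      with w hw using c.φ_q w (hwK w hw)
  have h4 := congrArg (fun l => l v) (h1.unique h3)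
  have h5 : tderiv c.φ (c.q w) (mapDeriv c.q w v) = v := h4
  rw [← c.norm_tderiv_φ _ hU, h5]

lemma contDiffAt_φ_comp {s : E → M} {w : E} (hs : IsIsometricAt s w) (hw : s w ∈ c.U) :
    ContDiffAt ℝ 2 (c.φ ∘ s) w :=
  contMDiffAt_iff_contDiffAt.1 ((c.contMDiffAt_φ _ hw).comp w hs.contMDiffAt)

lemma norm_fderiv_φ_comp {s : E → M} {w : E} (hs : IsIsometricAt s w) (hw : s w ∈ c.U) (v : E) :
    ‖fderiv ℝ (c.φ ∘ s) w v‖ = ‖v‖ := by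
  rw [(hasFDerivAt_comp_mapDeriv (c.mdifferentiableAt_φ hw) hs.mdifferentiableAt).fderiv]
  exact (c.norm_tderiv_φ _ hw _).trans (hs.norm_mapDeriv v)

lemma exists_affine_of_isIsometricAt {s : E4 → M} {V : Set E4} (hV : IsOpen V) (hc : Convex ℝ V)
    (hs : ∀ w ∈ V, IsIsometricAt s w) (hU : ∀ w ∈ V, s w ∈ c.U) :
    ∃ A : E4 ≃ᵃⁱ[ℝ] E4, ∀ w ∈ V, c.φ (s w) = A w :=
  exists_affineIsometryEquiv_of_norm_fderiv_eq hV hc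
    (fun w hw => (c.contDiffAt_φ_comp (hs w hw) (hU w hw)).contDiffWithinAt)
    fun w hw => c.norm_fderiv_φ_comp (hs w hw) (hU w hw)

lemma φ_continuousAt {y : M} (hy : y ∈ c.U) : ContinuousAt c.φ y := (c.contMDiffAt_φ y hy).continuousAt

lemma tendsto_q {u : E4} (hu : u ∈ halfSpaceOf c.n ∩ Metric.ball 0 c.r) :
    Tendsto c.q (𝓝[halfSpaceOf c.n] u) (𝓝 (c.q u)) := by
  have h := c.continuousOn_q u hu
  rwa [ContinuousWithinAt, nhdsWithin_inter_of_mem'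
    (mem_nhdsWithin_of_mem_nhds (Metric.isOpen_ball.mem_nhds hu.2))] at h

/-- On the open half-space the transition is a local isometry, hence affine, and the formula extends
to the boundary. That both domains correspond near `u` is part of the claim, since this says that
boundary goes to boundary. -/
theorem exists_transition {u : E4} (hu : u ∈ halfSpaceOf c.n ∩ Metric.ball 0 c.r)
    (c' : FlatChart (c.q u)) :
    ∃ A : E4 ≃ᵃⁱ[ℝ] E4, A u = 0 ∧ ∀ᶠ w in 𝓝 u,
      (w ∈ halfSpaceOf c.n ∩ Metric.ball 0 c.r ↔ A w ∈ halfSpaceOf c'.n ∩ Metric.ball 0 c'.r) ∧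
      (w ∈ halfSpaceOf c.n ∩ Metric.ball 0 c.r → c.q w = c'.q (A w)) := by
  have h1 : ∀ᶠ w in 𝓝[halfSpaceOf c.n] u, c.q w ∈ c'.U :=
    (c.tendsto_q hu).eventually (c'.isOpen_U.mem_nhds c'.mem_U)
  obtain ⟨ε, hε, hsub⟩ := Metric.mem_nhdsWithin_iff.1
    (h1.and (mem_nhdsWithin_of_mem_nhds (Metric.isOpen_ball.mem_nhds hu.2)))
  have hsub' : ∀ w ∈ halfSpaceOf c.n ∩ Metric.ball u ε, c.q w ∈ c'.U ∧ w ∈ Metric.ball 0 c.r :=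
    fun w hw => hsub ⟨hw.2, hw.1⟩
  have hVK : {w | c.n = 0 ∨ 0 < inner ℝ c.n w} ∩ Metric.ball u ε ⊆
      halfSpaceOf c.n ∩ Metric.ball u ε := by
    rintro w ⟨h | h, h'⟩
    · exact ⟨by simp [halfSpaceOf, h], h'⟩
    · exact ⟨le_of_lt h, h'⟩
  obtain ⟨A, hA⟩ := c'.exists_affine_of_isIsometricAt (s := c.q)
    ((isOpen_openHalfSpace c.n).inter Metric.isOpen_ball)
    ((convex_openHalfSpace c.n).inter (convex_ball u ε))
    (fun w hw => c.isIsometricAt_q (hsub' w (hVK hw)).2 hw.1) (fun w hw => (hsub' w (hVK hw)).1)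
  have hA' := eqOn_of_subset_closure_halfSpace hA (fun w hw =>
    (c'.φ_continuousAt (hsub' w hw).1).comp_continuousWithinAt
      ((c.continuousOn_q w ⟨hw.1, (hsub' w hw).2⟩).mono fun z hz => ⟨hz.1, (hsub' z hz).2⟩))
    A.continuous
  have hAu : A u = 0 := by
    rw [← hA' ⟨hu.1, Metric.mem_ball_self hε⟩]; exact c'.φ_self
  -- For the reverse inclusion of domains: points of the second chart close to its centre come back
  -- into the first chart close to `u`, where the affine formula applies and `A` is injective.
  have hev : ∀ᶠ w in 𝓝 u, A w ∈ halfSpaceOf c'.n ∩ Metric.ball 0 c'.r →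
      c'.q (A w) ∈ c.U ∧ c.φ (c'.q (A w)) ∈ Metric.ball u ε := by
    have h2 : (0 : E4) ∈ halfSpaceOf c'.n ∩ Metric.ball 0 c'.r :=
      ⟨by simp [halfSpaceOf], Metric.mem_ball_self c'.r_pos⟩
    have h3 := c'.tendsto_q h2
    have h4 : c'.q 0 = c.q u := by rw [← c'.φ_self, c'.q_φ _ c'.mem_U]
    rw [h4] at h3
    have hUu := c.q_mem u hu
    have h5 : Metric.ball u ε ∈ 𝓝 (c.φ (c.q u)) := by
      rw [c.φ_q u hu]; exact Metric.ball_mem_nhds u hε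
    have h6 := h3.eventually (Filter.inter_mem (c.isOpen_U.mem_nhds hUu) (c.φ_continuousAt hUu h5))
    have h7 : Tendsto A (𝓝 u) (𝓝 0) := hAu ▸ A.continuous.tendsto u
    filter_upwards [h7.eventually (eventually_nhdsWithin_iff.1 h6)] with w hw hw'
    exact hw hw'.1
  refine ⟨A, hAu, ?_⟩
  filter_upwards [hev, Metric.ball_mem_nhds u hε] with w hw hwε
  have key : w ∈ halfSpaceOf c.n ∩ Metric.ball 0 c.r →
      A w ∈ halfSpaceOf c'.n ∩ Metric.ball 0 c'.r ∧ c.q w = c'.q (A w) := by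
    intro h
    have h1 := (hsub' w ⟨h.1, hwε⟩).1
    have h2 : c'.φ (c.q w) = A w := hA' ⟨h.1, hwε⟩
    rw [← h2]
    exact ⟨c'.φ_mem _ h1, (c'.q_φ _ h1).symm⟩
  refine ⟨⟨fun h => (key h).1, fun h => ?_⟩, fun h => (key h).2⟩
  obtain ⟨h1, h2⟩ := hw h
  have h3 := c.φ_mem _ h1
  have h4 : c'.φ (c.q (c.φ (c'.q (A w)))) = A (c.φ (c'.q (A w))) := hA' ⟨h3.1, h2⟩
  rw [c.q_φ _ h1, c'.φ_q _ h] at h4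
  rw [A.injective h4]
  exact h3

end FlatChart

end Transition

/-! ### Distances and lengths of curves. -/

section Length

open Manifold

/-- Let `t` be the supremum of the times up to which the bound holds. The estimate to the left of
`t` shows that the bound holds at `t`, and the one to the right pushes it further unless `t = 1`. -/
lemma edist_le_of_forall_local {α : Type*} [PseudoEMetricSpace α] {f : ℝ → α} {L : ℝ → ℝ → ENNReal}
    (hadd : ∀ a b c, a ≤ b → b ≤ c → L a b + L b c = L a c)
    (hloc : ∀ t ∈ Icc (0 : ℝ) 1, ∀ᶠ z in 𝓝 t, (z ≤ t → edist (f z) (f t) ≤ L z t) ∧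
      (t ≤ z → edist (f t) (f z) ≤ L t z)) : edist (f 0) (f 1) ≤ L 0 1 := by
  set T := {t ∈ Icc (0 : ℝ) 1 | edist (f 0) (f t) ≤ L 0 t} with hT
  have h0 : (0 : ℝ) ∈ T := ⟨by simp, by simp⟩
  have hbdd : BddAbove T := ⟨1, fun t ht => ht.1.2⟩
  set t := sSup T with ht
  have ht0 : 0 ≤ t := le_csSup hbdd h0
  have ht1 : t ≤ 1 := csSup_le ⟨0, h0⟩ fun t ht => ht.1.2
  obtain ⟨ε, hε, hεt⟩ := Metric.eventually_nhds_iff.1 (hloc t ⟨ht0, ht1⟩)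
  obtain ⟨z, hz, hzt⟩ := exists_lt_of_lt_csSup ⟨0, h0⟩ (sub_lt_self t hε)
  have hzt' : z ≤ t := le_csSup hbdd hz
  have htT : edist (f 0) (f t) ≤ L 0 t := by
    rw [← hadd 0 z t hz.1.1 hzt']
    refine (edist_triangle _ (f z) _).trans (add_le_add hz.2 ((hεt ?_).1 hzt'))
    rw [Real.dist_eq, abs_lt]; constructor <;> linarith
  have hup : ∀ y, t ≤ y → y < t + ε → edist (f 0) (f y) ≤ L 0 y := by
    intro y hy hyε
    rw [← hadd 0 t y ht0 hy]
    refine (edist_triangle _ (f t) _).trans (add_le_add htT ((hεt ?_).2 hy))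
    rw [Real.dist_eq, abs_lt]; constructor <;> linarith
  rcases ht1.eq_or_lt with h1 | h1
  · rw [← h1]; exact htT
  · have hm : min 1 (t + ε / 2) ∈ T := by
      refine ⟨⟨le_min zero_le_one (by positivity), min_le_left _ _⟩, hup _ ?_ ?_⟩
      · exact le_min ht1 (by linarith)
      · exact (min_le_right _ _).trans_lt (by linarith)
    have := le_csSup hbdd hm
    rw [← ht] at this
    have h2 : t < min 1 (t + ε / 2) := lt_min h1 (by linarith)
    exact absurd this (not_le.2 h2)

variable {M : Type*} [TopologicalSpace M] [ChartedSpace (EuclideanHalfSpace 4) M]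
  [RiemannianBundle (fun x : M => TangentSpace (𝓡∂ 4) x)]

lemma enorm_mapDeriv_eq {x : M} (c : FlatChart x) {γ : ℝ → M} {t : ℝ}
    (hγ : MDifferentiableAt 𝓘(ℝ, ℝ) (𝓡∂ 4) γ t) (ht : γ t ∈ c.U) :
    ‖deriv (c.φ ∘ γ) t‖ₑ = ‖mfderiv 𝓘(ℝ, ℝ) (𝓡∂ 4) γ t 1‖ₑ := by
  have h1 := (hasFDerivAt_comp_mapDeriv (c.mdifferentiableAt_φ ht) hγ).hasDerivAt.deriv
  have h2 : ‖deriv (c.φ ∘ γ) t‖ = ‖mapDeriv γ t 1‖ := by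
    rw [h1]; exact c.norm_tderiv_φ _ ht _
  have h3 : ‖deriv (c.φ ∘ γ) t‖ₑ = ‖mapDeriv γ t 1‖ₑ := by
    rw [← ofReal_norm, h2, ofReal_norm]
  exact h3

lemma edist_le_pathELength {x : M} (c : FlatChart x) {γ : ℝ → M} {a b : ℝ} (hab : a ≤ b)
    (hγ : ContMDiff 𝓘(ℝ, ℝ) (𝓡∂ 4) 1 γ) (hU : ∀ t ∈ Icc a b, γ t ∈ c.U) :
    edist (c.φ (γ a)) (c.φ (γ b)) ≤ pathELength (𝓡∂ 4) γ a b := by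
  have h1 : ContDiffOn ℝ 1 (c.φ ∘ γ) (Icc a b) := fun t ht =>
    (contMDiffAt_iff_contDiffAt.1 (((c.contMDiffAt_φ _ (hU t ht)).of_le (by norm_num)).comp t
      (hγ t))).contDiffWithinAt
  rw [edist_comm, edist_eq_enorm_sub]
  refine (enorm_sub_le_lintegral_deriv_of_contDiffOn_Icc h1 hab).trans ?_
  rw [pathELength_eq_lintegral_mfderiv_Icc]
  exact (MeasureTheory.setLIntegral_congr_fun measurableSet_Icc fun t ht =>
    enorm_mapDeriv_eq c ((hγ t).mdifferentiableAt (by simp)) (hU t ht)).le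

/-- Along a nearly shortest curve, near each time the increment of `h` is at most the Euclidean
distance in a chart centred there, hence at most the length of the piece of the curve. -/
theorem edist_le_riemannianEDist {h : M → ℝ}
    (hh : ∀ x : M, ∃ c : FlatChart x, ∀ᶠ w in 𝓝[halfSpaceOf c.n] 0, |h (c.q w) - h x| ≤ ‖w‖)
    (x y : M) : edist (h x) (h y) ≤ riemannianEDist (𝓡∂ 4) x y := by
  refine le_of_forall_gt fun r hr => ?_
  obtain ⟨γ, h0, h1, hγ, hr, -, -⟩ := exists_lt_locally_constant_of_riemannianEDist_lt hr zero_lt_one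
  refine lt_of_le_of_lt ?_ hr
  rw [← h0, ← h1]
  refine edist_le_of_forall_local (f := h ∘ γ) (fun a b c hab hbc => pathELength_add hab hbc) ?_
  intro t _
  obtain ⟨c, hc⟩ := hh (γ t)
  have hγt : ContinuousAt γ t := hγ.continuous.continuousAt
  have hU : ∀ᶠ z in 𝓝 t, γ z ∈ c.U := hγt (c.isOpen_U.mem_nhds c.mem_U)
  have hφ : Tendsto (fun z => c.φ (γ z)) (𝓝 t) (𝓝 0) := by
    have := ((c.φ_continuousAt c.mem_U).comp hγt).tendsto
    rwa [Function.comp_apply, c.φ_self] at this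
  have h3 := hφ.eventually (eventually_nhdsWithin_iff.1 hc)
  have h4 : ∀ᶠ z in 𝓝 t, edist (h (γ z)) (h (γ t)) ≤ edist (c.φ (γ z)) (c.φ (γ t)) := by
    filter_upwards [hU, h3] with z hz hz3
    have := hz3 (c.φ_mem _ hz).1
    rw [c.q_φ _ hz] at this
    rw [c.φ_self, edist_dist, edist_dist, Real.dist_eq, dist_zero_right]
    exact ENNReal.ofReal_le_ofReal this
  obtain ⟨ε, hε, hεU⟩ := Metric.eventually_nhds_iff.1 hU
  filter_upwards [h4, Metric.ball_mem_nhds t hε] with z hz hzε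
  rw [Metric.mem_ball, Real.dist_eq, abs_lt] at hzε
  refine ⟨fun hzt => hz.trans (edist_le_pathELength c hzt hγ fun s hs => hεU ?_), fun hzt => ?_⟩
  · rw [Real.dist_eq, abs_lt]; constructor <;> linarith [hs.1, hs.2]
  · change edist (h (γ t)) (h (γ z)) ≤ _
    rw [edist_comm]
    refine hz.trans ?_
    rw [edist_comm]
    refine edist_le_pathELength c hzt hγ fun s hs => hεU ?_
    rw [Real.dist_eq, abs_lt]; constructor <;> linarith [hs.1, hs.2]

/-- The image of the straight segment has the length of the segment. -/
lemma riemannianEDist_le_edist {E : Type*} [NormedAddCommGroup E] [InnerProductSpace ℝ E]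
    {s : E → M} {u v : E} (hs : ∀ w ∈ segment ℝ u v, IsIsometricAt s w) :
    riemannianEDist (𝓡∂ 4) (s u) (s v) ≤ edist u v := by
  let ℓ : ℝ → E := fun t => u + t • (v - u)
  have hℓ : ∀ t, HasDerivAt ℓ (v - u) t := fun t => by
    have h := ((hasDerivAt_id t).smul_const (v - u)).const_add u
    rwa [one_smul] at h
  have hℓs : ∀ t ∈ Icc (0 : ℝ) 1, ℓ t ∈ segment ℝ u v := fun t ht =>
    (convex_segment u v).add_smul_sub_mem (left_mem_segment ℝ u v) (right_mem_segment ℝ u v) ht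
  have hℓc : ContDiff ℝ 1 ℓ := by fun_prop
  have h1 : ContMDiffOn 𝓘(ℝ, ℝ) (𝓡∂ 4) 1 (s ∘ ℓ) (Icc 0 1) := fun t ht =>
    (((hs _ (hℓs t ht)).contMDiffAt.of_le (by norm_num)).comp t
      hℓc.contMDiff.contMDiffAt).contMDiffWithinAt
  refine (riemannianEDist_le_pathELength h1 (x := s u) (y := s v) (by simp [ℓ]) (by simp [ℓ])
    zero_le_one).trans ?_
  rw [pathELength_eq_lintegral_mfderiv_Icc]
  have h2 : ∀ t ∈ Icc (0 : ℝ) 1, ‖mfderiv 𝓘(ℝ, ℝ) (𝓡∂ 4) (s ∘ ℓ) t 1‖ₑ = edist u v := by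
    intro t ht
    have h3 : HasMFDerivAt 𝓘(ℝ, ℝ) 𝓘(ℝ, E) ℓ t (ContinuousLinearMap.toSpanSingleton ℝ (v - u)) :=
      (hℓ t).hasFDerivAt.hasMFDerivAt
    have h4 : HasMFDerivAt 𝓘(ℝ, ℝ) (𝓡∂ 4) (s ∘ ℓ) t
        (mapDeriv s (ℓ t) ∘L ContinuousLinearMap.toSpanSingleton ℝ (v - u)) :=
      (hs _ (hℓs t ht)).mdifferentiableAt.hasMFDerivAt.comp t h3
    have h5 : ‖mapDeriv s (ℓ t) ((1 : ℝ) • (v - u))‖ₑ = edist u v := by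
      rw [← ofReal_norm, (hs _ (hℓs t ht)).norm_mapDeriv, one_smul, edist_comm, edist_dist,
        dist_eq_norm]
    rw [h4.mfderiv]
    exact h5
  rw [MeasureTheory.setLIntegral_congr_fun measurableSet_Icc h2]
  simp

end Length

/-! ### Local models at regular and orbifold points. -/

section Atlas

/-- A map from a neighbourhood of `0` in a Euclidean half-space, or in the Euclidean space, together
with a group acting on that space. -/
structure LocalModel (X : Type*) where
  n : E4
  r : ℝ
  G : Subgroup (E4 ≃ₗᵢ[ℝ] E4)
  q : E4 → X

/-- The domain of a local model. -/
def LocalModel.dom {X : Type*} (m : LocalModel X) : Set E4 := halfSpaceOf m.n ∩ Metric.ball 0 m.r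

/-- The local model is a neighbourhood of `p`, as the quotient of its domain by its group. -/
structure LocalModel.IsAt {X : Type*} [MetricSpace X] (m : LocalModel X) (p : X) : Prop where
  norm_n : m.n = 0 ∨ ‖m.n‖ = 1
  r_pos : 0 < m.r
  finite_G : Finite m.G
  G_eq_bot : m.n ≠ 0 → m.G = ⊥
  q_zero : m.q 0 = p
  image_mem_nhds : ∀ δ > 0, m.q '' (halfSpaceOf m.n ∩ Metric.ball 0 δ) ∈ 𝓝 p
  dist_q_le : ∀ u ∈ m.dom, ∀ v ∈ m.dom, dist (m.q u) (m.q v) ≤ dist u v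
  q_eq_iff : ∀ u ∈ m.dom, ∀ v ∈ m.dom, m.q u = m.q v ↔ ∃ g ∈ m.G, g u = v
  free : ∀ g ∈ m.G, g ≠ 1 → ∀ u, g u = u → u = 0

/-- Near `u`, the local models `m` and `m'` differ by an affine isometry that maps `u` to `0`. -/
def LocalModel.Compat {X : Type*} (m m' : LocalModel X) (u : E4) : Prop :=
  ∃ A : E4 ≃ᵃⁱ[ℝ] E4, A u = 0 ∧ ∀ᶠ w in 𝓝 u,
    (w ∈ m.dom ↔ A w ∈ m'.dom) ∧ (w ∈ m.dom → m.q w = m'.q (A w))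

/-- A flat orbifold with boundary, as a metric space with an atlas of Euclidean local models; the
boundary is the union of a family of injectively immersed Euclidean `3`-spaces. -/
structure FlatAtlas (X : Type*) [MetricSpace X] where
  model : X → LocalModel X
  boundary : Set (Set X)
  isAt : ∀ p, (model p).IsAt p
  compat : ∀ p, ∀ u ∈ (model p).dom, (model p).Compat (model ((model p).q u)) u
  -- This is the form in which the length metric enters: infinitesimally 1-Lipschitz functions are
  -- 1-Lipschitz, which bounds distances from below. The bound from above is `dist_q_le`.
  length : ∀ h : X → ℝ, (∀ p, ∀ᶠ w in 𝓝[halfSpaceOf (model p).n] 0,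
    |h ((model p).q w) - h p| ≤ ‖w‖) → ∀ x y, |h x - h y| ≤ dist x y
  sUnion_boundary : ⋃₀ boundary = {p | (model p).n ≠ 0}
  boundary_flat : ∀ Y ∈ boundary, ∃ f : E3 → X, Function.Injective f ∧ range f = Y ∧
    ∀ u, ∃ J : E3 →ᵃⁱ[ℝ] E4, J u = 0 ∧ (∀ v, inner ℝ (model (f u)).n (J v) = 0) ∧
      ∀ᶠ v in 𝓝 u, f v = (model (f u)).q (J v)

variable {X : Type*} [MetricSpace X] {S : Finset X}

lemma isOpenEmbedding_reg : IsOpenEmbedding (Subtype.val : Reg S → X) :=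
  S.finite_toSet.isClosed.isOpen_compl.isOpenEmbedding_subtypeVal

variable [ChartedSpace (EuclideanHalfSpace 4) (Reg S)]
    [RiemannianBundle (fun x : Reg S => TangentSpace (𝓡∂ 4) x)]

/-- The local model that is given by a chart at a regular point. -/
def FlatChart.toLocalModel {x : Reg S} (c : FlatChart x) : LocalModel X :=
  ⟨c.n, c.r, ⊥, fun w => c.q w⟩

lemma dist_le_of_isIsometricAt (hR : IsRiemannianManifold (𝓡∂ 4) (Reg S)) {s : E4 → Reg S} {u v : E4}
    (hs : ∀ w ∈ segment ℝ u v, IsIsometricAt s w) : dist (s u : X) (s v) ≤ dist u v := by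
  have h1 := riemannianEDist_le_edist hs
  rw [← hR.out] at h1
  have h2 : dist (s u) (s v) ≤ dist u v := by
    rw [dist_edist, dist_edist]
    exact ENNReal.toReal_mono (edist_ne_top u v) h1
  exact h2

lemma FlatChart.toLocalModel_isAt (hR : IsRiemannianManifold (𝓡∂ 4) (Reg S)) {x : Reg S}
    (c : FlatChart x) : c.toLocalModel.IsAt (x : X) where
  norm_n := c.norm_n
  r_pos := c.r_pos
  finite_G := inferInstanceAs (Finite (⊥ : Subgroup (E4 ≃ₗᵢ[ℝ] E4)))
  G_eq_bot := fun _ => rfl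
  q_zero := by
    change ((c.q 0 : Reg S) : X) = x
    rw [← c.φ_self, c.q_φ _ c.mem_U]
  image_mem_nhds := by
    intro δ hδ
    have h0 : Metric.ball (0 : E4) δ ∈ 𝓝 (c.φ x) := by
      rw [c.φ_self]; exact Metric.ball_mem_nhds 0 hδ
    have h1 := Filter.inter_mem (c.isOpen_U.mem_nhds c.mem_U) (c.φ_continuousAt c.mem_U h0)
    rw [← (isOpenEmbedding_reg (S := S)).map_nhds_eq x]
    refine mem_of_superset (image_mem_map h1) ?_
    rintro _ ⟨y, ⟨hy, hy'⟩, rfl⟩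
    exact ⟨c.φ y, ⟨(c.φ_mem y hy).1, hy'⟩, congrArg Subtype.val (c.q_φ y hy)⟩
  dist_q_le := by
    intro u hu v hv
    change dist (c.q u : X) (c.q v) ≤ dist u v
    -- The chart is known to be isometric only off the boundary, so both endpoints are pushed
    -- inwards along the normal, which keeps their distance, and a limit is taken.
    have hlim : ∀ u ∈ halfSpaceOf c.n ∩ Metric.ball 0 c.r,
        Tendsto (fun t : ℝ => u + t • c.n) (𝓝[>] 0) (𝓝[halfSpaceOf c.n] u) ∧
        ∀ᶠ t in 𝓝[>] (0 : ℝ), u + t • c.n ∈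
          {w | c.n = 0 ∨ 0 < inner ℝ c.n w} ∩ Metric.ball 0 c.r := by
      intro u hu
      have h1 : Continuous fun t : ℝ => u + t • c.n := by fun_prop
      have h2 : Tendsto (fun t : ℝ => u + t • c.n) (𝓝[>] 0) (𝓝 u) := by
        simpa using (h1.tendsto 0).mono_left nhdsWithin_le_nhds
      have h3 : ∀ᶠ t in 𝓝[>] (0 : ℝ), u + t • c.n ∈
          {w | c.n = 0 ∨ 0 < inner ℝ c.n w} ∩ Metric.ball 0 c.r := by
        filter_upwards [h2 (Metric.isOpen_ball.mem_nhds hu.2), self_mem_nhdsWithin] with t ht ht0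
        refine ⟨?_, ht⟩
        by_cases hn : c.n = 0
        · exact Or.inl hn
        · refine Or.inr ?_
          rw [inner_add_right, real_inner_smul_right]
          have h1 : 0 < inner ℝ c.n c.n := real_inner_self_pos.2 hn
          have h2 : 0 < t * inner ℝ c.n c.n := mul_pos ht0 h1
          have h3 : 0 ≤ inner ℝ c.n u := hu.1
          linarith
      refine ⟨tendsto_nhdsWithin_iff.2 ⟨h2, h3.mono fun t ht => ?_⟩, h3⟩
      rcases ht.1 with h | h
      · simp [halfSpaceOf, h]
      · exact le_of_lt h
    have h1 := ((c.tendsto_q hu).comp (hlim u hu).1).dist ((c.tendsto_q hv).comp (hlim v hv).1)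
    refine le_of_tendsto h1 ?_
    filter_upwards [(hlim u hu).2, (hlim v hv).2] with t hut hvt
    have h2 : dist u v = dist (u + t • c.n) (v + t • c.n) := by simp
    rw [h2]
    refine dist_le_of_isIsometricAt hR fun w hw => ?_
    have h3 := ((convex_openHalfSpace c.n).inter (convex_ball 0 c.r)).segment_subset hut hvt hw
    exact c.isIsometricAt_q h3.2 h3.1
  q_eq_iff := by
    intro u hu v hv
    refine ⟨fun h => ⟨1, Subgroup.one_mem _, ?_⟩, ?_⟩
    · have h1 : c.q u = c.q v := Subtype.val_injective h
      have h2 := congrArg c.φ h1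
      rwa [c.φ_q u hu, c.φ_q v hv] at h2
    · rintro ⟨g, hg, rfl⟩
      rw [Subgroup.mem_bot.1 hg]; rfl
  free := fun g hg hg1 => absurd (Subgroup.mem_bot.1 hg) hg1

lemma FlatChart.compat {x : Reg S} (c : FlatChart x) {u : E4}
    (hu : u ∈ halfSpaceOf c.n ∩ Metric.ball 0 c.r) (c' : FlatChart (c.q u)) :
    c.toLocalModel.Compat c'.toLocalModel u := by
  obtain ⟨A, hA, h⟩ := c.exists_transition hu c'
  exact ⟨A, hA, h.mono fun w hw => ⟨hw.1, fun h => congrArg Subtype.val (hw.2 h)⟩⟩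

/-- The data of an orbifold point. -/
structure OrbifoldChart (S : Finset X) [ChartedSpace (EuclideanHalfSpace 4) (Reg S)]
    [RiemannianBundle (fun x : Reg S => TangentSpace (𝓡∂ 4) x)] (p : X) where
  r : ℝ
  G : Subgroup (E4 ≃ₗᵢ[ℝ] E4)
  q : E4 → X
  s : E4 → Reg S
  r_pos : 0 < r
  finite_G : Finite G
  G_ne_bot : G ≠ ⊥
  q_zero : q 0 = p
  continuousOn_q : ContinuousOn q (Metric.ball 0 r)
  isOpen_image : ∀ W ⊆ Metric.ball (0 : E4) r, IsOpen W → IsOpen (q '' W)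
  q_eq_iff : ∀ x ∈ Metric.ball (0 : E4) r, ∀ y ∈ Metric.ball (0 : E4) r,
      q x = q y ↔ ∃ g ∈ G, g x = y
  coe_s : ∀ x ∈ Metric.ball (0 : E4) r, x ≠ 0 → (s x : X) = q x
  isIsometricAt_s : ∀ x ∈ Metric.ball (0 : E4) r, x ≠ 0 → IsIsometricAt s x

lemma IsFlatOrbifoldPoint.nonempty_orbifoldChart {p : X} (h : IsFlatOrbifoldPoint S p) :
    Nonempty (OrbifoldChart S p) := by
  obtain ⟨r, G, q, s, hr, hG, hG1, hq0, hqc, hqo, hq, hs⟩ := h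
  exact ⟨⟨r, G, q, s, hr, hG, hG1, hq0, hqc, hqo, hq, fun x hx hx0 => (hs x hx hx0).1,
    fun x hx hx0 => ⟨(hs x hx hx0).2.1.of_le (WithTop.coe_le_coe.2 (le_top : (2 : ℕ∞) ≤ ⊤)),
      (hs x hx hx0).2.2⟩⟩⟩

namespace OrbifoldChart

variable {p : X} (o : OrbifoldChart S p)

/-- The local model that is given by a chart at an orbifold point. -/
def toLocalModel : LocalModel X := ⟨0, o.r, o.G, o.q⟩

lemma dom_toLocalModel : o.toLocalModel.dom = Metric.ball 0 o.r := by
  simp [LocalModel.dom, toLocalModel, halfSpaceOf]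

lemma exists_affine {u : E4} (hu : u ∈ Metric.ball (0 : E4) o.r) (hu0 : u ≠ 0)
    (c : FlatChart (o.s u)) :
    ∃ A : E4 ≃ᵃⁱ[ℝ] E4, A u = 0 ∧ ∀ᶠ w in 𝓝 u, o.s w ∈ c.U ∧ c.φ (o.s w) = A w := by
  have hs := (o.isIsometricAt_s u hu hu0).contMDiffAt.continuousAt
  have h1 : ∀ᶠ w in 𝓝 u, o.s w ∈ c.U ∧ w ∈ Metric.ball 0 o.r ∧ w ≠ 0 :=
    (hs.tendsto.eventually (c.isOpen_U.eventually_mem c.mem_U)).and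
      ((Metric.isOpen_ball.eventually_mem hu).and (isOpen_ne.eventually_mem hu0))
  obtain ⟨ε, hε, hsub⟩ := Metric.eventually_nhds_iff_ball.1 h1
  obtain ⟨A, hA⟩ := c.exists_affine_of_isIsometricAt Metric.isOpen_ball (convex_ball u ε)
    (fun w hw => o.isIsometricAt_s w (hsub w hw).2.1 (hsub w hw).2.2) (fun w hw => (hsub w hw).1)
  refine ⟨A, ?_, ?_⟩
  · rw [← hA u (Metric.mem_ball_self hε), c.φ_self]
  · filter_upwards [Metric.ball_mem_nhds u hε] with w hw
    exact ⟨(hsub w hw).1, hA w hw⟩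

/-- A segment that misses 0 lies in the region where the quotient map is isometric. A segment
through 0 is split there, and each half is a limit of segments from `u` to `t • u` with `t > 0`. -/
lemma dist_le (hR : IsRiemannianManifold (𝓡∂ 4) (Reg S)) {u v : E4}
    (hu : u ∈ Metric.ball (0 : E4) o.r) (hv : v ∈ Metric.ball (0 : E4) o.r) :
    dist (o.q u) (o.q v) ≤ dist u v := by
  have h1 : ∀ u ∈ Metric.ball (0 : E4) o.r, ∀ v ∈ Metric.ball (0 : E4) o.r,
      (0 : E4) ∉ segment ℝ u v → dist (o.q u) (o.q v) ≤ dist u v := by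
    intro u hu v hv h0
    have hne : ∀ w ∈ segment ℝ u v, w ≠ 0 := fun w hw h => h0 (h ▸ hw)
    rw [← o.coe_s u hu (hne u (left_mem_segment ℝ u v)),
      ← o.coe_s v hv (hne v (right_mem_segment ℝ u v))]
    exact dist_le_of_isIsometricAt hR fun w hw =>
      o.isIsometricAt_s w ((convex_ball 0 o.r).segment_subset hu hv hw) (hne w hw)
  have h2 : ∀ u ∈ Metric.ball (0 : E4) o.r, dist (o.q u) (o.q 0) ≤ dist u 0 := by
    intro u hu
    by_cases hu0 : u = 0
    · simp [hu0]
    have hlim : Tendsto (fun t : ℝ => t • u) (𝓝[>] 0) (𝓝 0) := by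
      have : Continuous fun t : ℝ => t • u := by fun_prop
      simpa using (this.tendsto 0).mono_left nhdsWithin_le_nhds
    have h3 : Tendsto (fun t : ℝ => o.q (t • u)) (𝓝[>] 0) (𝓝 (o.q 0)) :=
      ((o.continuousOn_q.continuousAt (Metric.ball_mem_nhds 0 o.r_pos)).tendsto).comp hlim
    refine le_of_tendsto_of_tendsto (tendsto_const_nhds.dist h3) (tendsto_const_nhds.dist hlim) ?_
    filter_upwards [hlim (Metric.ball_mem_nhds 0 o.r_pos), self_mem_nhdsWithin] with t ht ht0
    refine h1 u hu _ ht ?_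
    rintro ⟨a, b, ha, hb, hab, h⟩
    rw [smul_smul, ← add_smul] at h
    have ht0' : (0 : ℝ) < t := ht0
    rcases smul_eq_zero.1 h with h | h
    · nlinarith [mul_nonneg hb ht0'.le, mul_pos ht0' ht0']
    · exact hu0 h
  by_cases h0 : (0 : E4) ∈ segment ℝ u v
  · rw [← dist_add_dist_of_mem_segment h0]
    refine (dist_triangle _ (o.q 0) _).trans (add_le_add (h2 u hu) ?_)
    rw [dist_comm, dist_comm 0 v]
    exact h2 v hv
  · exact h1 u hu v hv h0

/-- Away from 0 the quotient map is locally injective, being affine in a flat chart. So an element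
of `G` with a nonzero fixed point is the identity near a multiple of that point, and by linearity
everywhere. -/
lemma eq_one_of_fixed (hc : ∀ x : Reg S, Nonempty (FlatChart x)) {g : E4 ≃ₗᵢ[ℝ] E4} (hg : g ∈ o.G)
    {u : E4} (hu0 : u ≠ 0) (hgu : g u = u) : g = 1 := by
  obtain ⟨t, ht, hut⟩ : ∃ t : ℝ, t ≠ 0 ∧ t • u ∈ Metric.ball (0 : E4) o.r := by
    have hlim : Tendsto (fun t : ℝ => t • u) (𝓝[≠] 0) (𝓝 0) := by
      have : Continuous fun t : ℝ => t • u := by fun_prop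
      simpa using (this.tendsto 0).mono_left nhdsWithin_le_nhds
    obtain ⟨t, h1, h2⟩ :=
      ((hlim.eventually (Metric.ball_mem_nhds 0 o.r_pos)).and self_mem_nhdsWithin).exists
    exact ⟨t, h2, h1⟩
  have hw0 : t • u ≠ 0 := smul_ne_zero ht hu0
  obtain ⟨c⟩ := hc (o.s (t • u))
  obtain ⟨A, -, hA⟩ := o.exists_affine hut hw0 c
  have hgc : Tendsto g (𝓝 (t • u)) (𝓝 (t • u)) := by
    have := g.continuous.tendsto (t • u)
    rwa [map_smul, hgu] at this
  have hfix : ∀ᶠ w in 𝓝 (t • u), g w = w := by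
    filter_upwards [hA, hgc.eventually hA, isOpen_ne.eventually_mem hw0,
      hgc.eventually (isOpen_ne.eventually_mem hw0), Metric.isOpen_ball.eventually_mem hut,
      hgc.eventually (Metric.isOpen_ball.eventually_mem hut)] with w h1 h2 h3 h4 h5 h6
    have h7 : o.q w = o.q (g w) := (o.q_eq_iff w h5 _ h6).2 ⟨g, hg, rfl⟩
    rw [← o.coe_s w h5 h3, ← o.coe_s _ h6 h4] at h7
    have h8 := congrArg c.φ (Subtype.val_injective h7)
    rw [h1.2, h2.2] at h8
    exact (A.injective h8).symm
  obtain ⟨ε, hε, hb⟩ := Metric.eventually_nhds_iff_ball.1 hfix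
  have hdiff : ∀ᶠ c : ℝ in 𝓝[≠] 0, ∀ v : E4, ‖v‖ ≤ 1 → t • u + c • v ∈ Metric.ball (t • u) ε := by
    filter_upwards [mem_nhdsWithin_of_mem_nhds (Metric.ball_mem_nhds (0 : ℝ) hε)] with c hc v hv
    rw [mem_ball_iff_norm, add_sub_cancel_left, norm_smul]
    rw [mem_ball_zero_iff] at hc
    exact lt_of_le_of_lt (mul_le_of_le_one_right (norm_nonneg _) hv) hc
  obtain ⟨c, hc, hc0⟩ := (hdiff.and self_mem_nhdsWithin).exists
  have hone : ∀ v : E4, ‖v‖ ≤ 1 → g v = v := by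
    intro v hv
    have h1 := hb _ (hc v hv)
    rw [map_add, map_smul, map_smul, hgu, add_right_inj] at h1
    exact smul_right_injective E4 hc0 h1
  ext1 v
  by_cases hv : v = 0
  · simp [hv]
  · have h1 := hone (‖v‖⁻¹ • v) (by rw [norm_smul, norm_inv, norm_norm, inv_mul_cancel₀ (norm_ne_zero_iff.2 hv)])
    rw [map_smul] at h1
    exact smul_right_injective E4 (inv_ne_zero (norm_ne_zero_iff.2 hv)) h1

lemma toLocalModel_isAt (hR : IsRiemannianManifold (𝓡∂ 4) (Reg S))
    (hc : ∀ x : Reg S, Nonempty (FlatChart x)) : o.toLocalModel.IsAt p where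
  norm_n := Or.inl rfl
  r_pos := o.r_pos
  finite_G := o.finite_G
  G_eq_bot := fun h => absurd rfl h
  q_zero := o.q_zero
  image_mem_nhds := by
    intro δ hδ
    have h1 : IsOpen (o.q '' (Metric.ball 0 o.r ∩ Metric.ball 0 δ)) :=
      o.isOpen_image _ inter_subset_left (Metric.isOpen_ball.inter Metric.isOpen_ball)
    refine mem_of_superset (h1.mem_nhds ⟨0, ⟨Metric.mem_ball_self o.r_pos, Metric.mem_ball_self hδ⟩,
      o.q_zero⟩) (image_mono fun w hw => ⟨by simp [toLocalModel, halfSpaceOf], hw.2⟩)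
  dist_q_le := by
    rw [o.dom_toLocalModel]
    exact fun u hu v hv => o.dist_le hR hu hv
  q_eq_iff := by
    rw [o.dom_toLocalModel]
    exact o.q_eq_iff
  free := by
    intro g hg hg1 u hgu
    by_contra hu
    exact hg1 (o.eq_one_of_fixed hc hg hu hgu)

lemma compat {u : E4} (hu : u ∈ Metric.ball (0 : E4) o.r) (hu0 : u ≠ 0) (c : FlatChart (o.s u)) :
    o.toLocalModel.Compat c.toLocalModel u := by
  obtain ⟨A, hA, h⟩ := o.exists_affine hu hu0 c
  refine ⟨A, hA, ?_⟩
  rw [o.dom_toLocalModel]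
  filter_upwards [h, Metric.isOpen_ball.eventually_mem hu, isOpen_ne.eventually_mem hu0]
    with w hw hwr hw0
  have h1 := c.φ_mem _ hw.1
  rw [hw.2] at h1
  refine ⟨⟨fun _ => h1, fun _ => hwr⟩, fun _ => ?_⟩
  change o.q w = (c.q (A w) : X)
  rw [← o.coe_s w hwr hw0, ← hw.2, c.q_φ _ hw.1]

end OrbifoldChart

end Atlas

/-! ### The atlas of a flat orbifold with boundary. -/

section AtlasOfOrbifold

lemma exists_isometry_onto_orthogonal {n : E4} (hn : n ≠ 0) :
    ∃ (ι : E3 →ₗᵢ[ℝ] E4) (P : E4 →L[ℝ] E3), (∀ v, inner ℝ n (ι v) = 0) ∧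
      ∀ w, inner ℝ n w = 0 → ι (P w) = w := by
  let W : Submodule ℝ E4 := (ℝ ∙ n)ᗮ
  have : Fact (Module.finrank ℝ E4 = 3 + 1) := ⟨by simp⟩
  have hW : Module.finrank ℝ W = 3 := Submodule.finrank_orthogonal_span_singleton hn
  let e : W ≃ₗᵢ[ℝ] E3 := (stdOrthonormalBasis ℝ W).repr.trans
      (LinearIsometryEquiv.piLpCongrLeft 2 ℝ ℝ (finCongr hW))
  refine ⟨W.subtypeₗᵢ.comp e.symm.toLinearIsometry,
    (e.toContinuousLinearEquiv : W →L[ℝ] E3) ∘L W.orthogonalProjectionOnto, fun v => ?_, fun w hw => ?_⟩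
  · exact Submodule.mem_orthogonal_singleton_iff_inner_right.1 (e.symm v).2
  · have hwW : w ∈ W := Submodule.mem_orthogonal_singleton_iff_inner_right.2 hw
    have h1 : W.orthogonalProjectionOnto w = ⟨w, hwW⟩ :=
      W.orthogonalProjectionOnto_mem_subspace_eq_self ⟨w, hwW⟩
    simp [h1]

/-- In the chart the boundary map takes values in the hyperplane orthogonal to `n`. Identified with
ℝ³, it becomes a local isometry of ℝ³, hence affine. -/
lemma FlatChart.exists_boundary_affine {M : Type*} [TopologicalSpace M]
    [ChartedSpace (EuclideanHalfSpace 4) M] [RiemannianBundle (fun x : M => TangentSpace (𝓡∂ 4) x)]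
    {f : E3 → M} {u : E3} (c : FlatChart (f u)) (hf : ∀ v, IsIsometricAt f v)
    (hb : ∀ v, f v ∈ (𝓡∂ 4).boundary M) :
    ∃ J : E3 →ᵃⁱ[ℝ] E4, J u = 0 ∧ (∀ v, inner ℝ c.n (J v) = 0) ∧ ∀ᶠ v in 𝓝 u, f v = c.q (J v) := by
  have hn := ((c.mem_boundary_iff _ c.mem_U).1 (hb u)).1
  obtain ⟨ι, P, hι, hP⟩ := exists_isometry_onto_orthogonal hn
  have h1 : ∀ᶠ v in 𝓝 u, f v ∈ c.U :=
    (hf u).contMDiffAt.continuousAt.tendsto.eventually (c.isOpen_U.eventually_mem c.mem_U)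
  obtain ⟨ε, hε, hU⟩ := Metric.eventually_nhds_iff_ball.1 h1
  have horth : ∀ v ∈ Metric.ball u ε, inner ℝ c.n (c.φ (f v)) = 0 := fun v hv =>
    ((c.mem_boundary_iff _ (hU v hv)).1 (hb v)).2
  have hd : ∀ v ∈ Metric.ball u ε, DifferentiableAt ℝ (c.φ ∘ f) v := fun v hv =>
    (c.contDiffAt_φ_comp (hf v) (hU v hv)).differentiableAt (by simp)
  have horth' : ∀ v ∈ Metric.ball u ε, ∀ w, inner ℝ c.n (fderiv ℝ (c.φ ∘ f) v w) = 0 := by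
    intro v hv w
    have h2 := (innerSL ℝ c.n).hasFDerivAt.comp v (hd v hv).hasFDerivAt
    have h3 : HasFDerivAt (innerSL ℝ c.n ∘ (c.φ ∘ f)) (0 : E3 →L[ℝ] ℝ) v := by
      refine (hasFDerivAt_const (0 : ℝ) v).congr_of_eventuallyEq ?_
      filter_upwards [Metric.isOpen_ball.eventually_mem hv] with z hz using horth z hz
    exact congrArg (fun l => l w) (h2.unique h3)
  obtain ⟨A, hA⟩ := exists_affineIsometryEquiv_of_norm_fderiv_eq (T := P ∘ (c.φ ∘ f))
    Metric.isOpen_ball (convex_ball u ε)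
    (fun v hv => (P.contDiff.contDiffAt.comp v
      (c.contDiffAt_φ_comp (hf v) (hU v hv))).contDiffWithinAt)
    (fun v hv w => by
      rw [(P.hasFDerivAt.comp v (hd v hv).hasFDerivAt).fderiv]
      change ‖P (fderiv ℝ (c.φ ∘ f) v w)‖ = _
      rw [← ι.norm_map, hP _ (horth' v hv w), c.norm_fderiv_φ_comp (hf v) (hU v hv)])
  have hJ : ∀ v ∈ Metric.ball u ε, c.φ (f v) = ι (A v) := fun v hv => by
    rw [← hA v hv]; exact (hP _ (horth v hv)).symm
  refine ⟨ι.toAffineIsometry.comp A.toAffineIsometry, ?_, fun v => hι _, ?_⟩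
  · exact (hJ u (Metric.mem_ball_self hε)).symm.trans c.φ_self
  · filter_upwards [Metric.ball_mem_nhds u hε] with v hv
    have h4 : (ι.toAffineIsometry.comp A.toAffineIsometry) v = c.φ (f v) := (hJ v hv).symm
    rw [h4, c.q_φ _ (hU v hv)]

variable {X : Type*} [MetricSpace X] {S : Finset X}
  [ChartedSpace (EuclideanHalfSpace 4) (Reg S)]
  [RiemannianBundle (fun x : Reg S => TangentSpace (𝓡∂ 4) x)]

/-- The local models that are given by charts at all points. -/
def modelOf (c : ∀ x : Reg S, FlatChart x) (o : ∀ p ∈ S, OrbifoldChart S p) (p : X) : LocalModel X :=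
  open Classical in
  if h : p ∈ S then (o p h).toLocalModel else (c ⟨p, h⟩).toLocalModel

variable (c : ∀ x : Reg S, FlatChart x) (o : ∀ p ∈ S, OrbifoldChart S p)

lemma modelOf_of_mem {p : X} (h : p ∈ S) : modelOf c o p = (o p h).toLocalModel := dif_pos h

lemma modelOf_coe (x : Reg S) : modelOf c o x = (c x).toLocalModel := dif_neg x.2

lemma modelOf_isAt (hR : IsRiemannianManifold (𝓡∂ 4) (Reg S)) (p : X) : (modelOf c o p).IsAt p := by
  by_cases h : p ∈ S
  · rw [modelOf_of_mem c o h]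
    exact (o p h).toLocalModel_isAt hR fun x => ⟨c x⟩
  · have := (c ⟨p, h⟩).toLocalModel_isAt hR
    rwa [← modelOf_coe c o] at this

lemma modelOf_compat (p : X) (u : E4) (hu : u ∈ (modelOf c o p).dom) :
    (modelOf c o p).Compat (modelOf c o ((modelOf c o p).q u)) u := by
  by_cases h : p ∈ S
  · rw [modelOf_of_mem c o h] at hu ⊢
    rw [(o p h).dom_toLocalModel] at hu
    by_cases hu0 : u = 0
    · have h1 : (o p h).toLocalModel.q u = p := by rw [hu0]; exact (o p h).q_zero
      rw [h1, modelOf_of_mem c o h]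
      exact ⟨AffineIsometryEquiv.refl ℝ E4, hu0, Eventually.of_forall fun w => ⟨Iff.rfl, fun _ => rfl⟩⟩
    · have h1 : (o p h).toLocalModel.q u = (o p h).s u := ((o p h).coe_s u hu hu0).symm
      rw [h1, modelOf_coe]
      exact (o p h).compat hu hu0 _
  · have h1 := modelOf_coe c o ⟨p, h⟩
    dsimp only at h1
    rw [h1] at hu ⊢
    have h2 : (c ⟨p, h⟩).toLocalModel.q u = (c ⟨p, h⟩).q u := rfl
    rw [h2, modelOf_coe]
    exact (c ⟨p, h⟩).compat hu _

lemma continuous_of_local_lipschitz {h : X → ℝ} {m : X → LocalModel X} (hm : ∀ p, (m p).IsAt p)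
    (hh : ∀ p, ∀ᶠ w in 𝓝[halfSpaceOf (m p).n] 0, |h ((m p).q w) - h p| ≤ ‖w‖) : Continuous h := by
  refine continuous_iff_continuousAt.2 fun p => Metric.continuousAt_iff'.2 fun ε hε => ?_
  obtain ⟨δ, hδ, hδh⟩ := Metric.mem_nhdsWithin_iff.1 (hh p)
  refine mem_of_superset ((hm p).image_mem_nhds (min δ ε) (by positivity)) ?_
  rintro _ ⟨w, ⟨hw, hw'⟩, rfl⟩
  rw [mem_ball_zero_iff] at hw'
  have h1 : |h ((m p).q w) - h p| ≤ ‖w‖ :=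
    hδh ⟨mem_ball_zero_iff.2 (hw'.trans_le (min_le_left _ _)), hw⟩
  change dist (h ((m p).q w)) (h p) < ε
  rw [Real.dist_eq]
  exact h1.trans_lt (hw'.trans_le (min_le_right _ _))

lemma dense_reg (o : ∀ p ∈ S, OrbifoldChart S p) : Dense {p : X | p ∉ S} := by
  intro p
  by_cases h : p ∈ S
  · have hlim : Tendsto (fun t : ℝ => t • (EuclideanSpace.single 0 1 : E4)) (𝓝[≠] 0) (𝓝 0) := by
      have : Continuous fun t : ℝ => t • (EuclideanSpace.single 0 1 : E4) := by fun_prop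
      simpa using (this.tendsto 0).mono_left nhdsWithin_le_nhds
    have h1 := (((o p h).continuousOn_q.continuousAt
      (Metric.ball_mem_nhds 0 (o p h).r_pos)).tendsto).comp hlim
    rw [(o p h).q_zero] at h1
    refine mem_closure_of_tendsto h1 ?_
    filter_upwards [hlim.eventually (Metric.ball_mem_nhds 0 (o p h).r_pos), self_mem_nhdsWithin]
      with t ht ht0
    have h2 := (o p h).coe_s _ ht (smul_ne_zero ht0 (by simp))
    rw [Function.comp_apply, ← h2]
    exact ((o p h).s _).2
  · exact subset_closure h

/-- On regular points the distance is the Riemannian one; the regular points are dense and `h` is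
continuous. -/
lemma abs_sub_le_dist_of_local (hR : IsRiemannianManifold (𝓡∂ 4) (Reg S)) {h : X → ℝ}
    (hh : ∀ p, ∀ᶠ w in 𝓝[halfSpaceOf (modelOf c o p).n] 0, |h ((modelOf c o p).q w) - h p| ≤ ‖w‖)
    (x y : X) : |h x - h y| ≤ dist x y := by
  have hcont := continuous_of_local_lipschitz (modelOf_isAt c o hR) hh
  have hreg : ∀ x y : Reg S, |h x - h y| ≤ dist (x : X) y := by
    intro x y
    have h1 := edist_le_riemannianEDist (h := fun x : Reg S => h x) (fun x => ⟨c x, by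
      have := hh x
      rwa [modelOf_coe] at this⟩) x y
    rw [← hR.out] at h1
    have h2 := ENNReal.toReal_mono (edist_ne_top x y) h1
    rwa [← dist_edist, ← dist_edist, Real.dist_eq] at h2
  have hcl : IsClosed {z : X × X | |h z.1 - h z.2| ≤ dist z.1 z.2} :=
    isClosed_le (by fun_prop) (by fun_prop)
  have hd : Dense ({p : X | p ∉ S} ×ˢ {p : X | p ∉ S}) := (dense_reg o).prod (dense_reg o)
  have hsub : {p : X | p ∉ S} ×ˢ {p : X | p ∉ S} ⊆ {z : X × X | |h z.1 - h z.2| ≤ dist z.1 z.2} :=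
    fun z hz => hreg ⟨z.1, hz.1⟩ ⟨z.2, hz.2⟩
  exact hcl.closure_subset_iff.2 hsub (hd (x, y))

variable [IsManifold (𝓡∂ 4) ∞ (Reg S)]
  [IsContMDiffRiemannianBundle (𝓡∂ 4) ∞ E4 (fun x : Reg S => TangentSpace (𝓡∂ 4) x)]

lemma isInducing_image_connectedComponentIn {α β : Type*} [TopologicalSpace α] [TopologicalSpace β]
    {e : α → β} (he : IsInducing e) {F : Set α} {x : α} (hx : x ∈ F) :
    e '' connectedComponentIn F x = connectedComponentIn (e '' F) (e x) := by
  refine (he.continuous.continuousOn.image_connectedComponentIn_subset hx).antisymm fun y hy => ?_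
  have h1 : e '' (F ∩ e ⁻¹' connectedComponentIn (e '' F) (e x)) = connectedComponentIn (e '' F) (e x) := by
    rw [image_inter_preimage]
    exact inter_eq_right.2 (connectedComponentIn_subset _ _)
  have h2 : IsPreconnected (F ∩ e ⁻¹' connectedComponentIn (e '' F) (e x)) := by
    rw [← he.isPreconnected_image, h1]
    exact isPreconnected_connectedComponentIn
  rw [← h1] at hy
  exact image_mono (h2.subset_connectedComponentIn
    ⟨hx, mem_connectedComponentIn (mem_image_of_mem e hx)⟩ inter_subset_left) hy

/-- The connected components of a subset. -/
def componentsIn {α : Type*} [TopologicalSpace α] (B : Set α) : Set (Set α) := connectedComponentIn B '' B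

/-- The atlas, with connectedness and completeness of `X`, is all that the classification uses.
Boundary components may be computed in `X` because the regular part is embedded in it. -/
theorem exists_flatAtlas (hX : IsFlatHyperkahlerOrbifold S) :
    ∃ 𝒜 : FlatAtlas X, {p | (𝒜.model p).G ≠ ⊥} = S ∧
      𝒜.boundary.encard = (boundaryComponents (Reg S)).encard ∧
      𝒜.boundary = componentsIn {p | (𝒜.model p).n ≠ 0} ∧ ∃ p, (𝒜.model p).n ≠ 0 := by
  obtain ⟨D, hD, hF, -, hT⟩ := hX.flat_hyperkahler
  let c : ∀ x : Reg S, FlatChart x := fun x => (nonempty_flatChart hD hF hT x).some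
  let o : ∀ p ∈ S, OrbifoldChart S p := fun p hp =>
    (hX.orbifold_points p hp).nonempty_orbifoldChart.some
  have hbd : ∀ x : Reg S, x ∈ (𝓡∂ 4).boundary (Reg S) ↔ (c x).n ≠ 0 := fun x => by
    rw [(c x).mem_boundary_iff x (c x).mem_U, (c x).φ_self, inner_zero_right]
    simp
  have hinj : Function.Injective (image (Subtype.val : Reg S → X)) :=
    image_injective.2 Subtype.val_injective
  have hbdX : Subtype.val '' (𝓡∂ 4).boundary (Reg S) = {p : X | (modelOf c o p).n ≠ 0} := by
    ext p
    constructor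
    · rintro ⟨x, hx, rfl⟩
      rw [mem_ofPred_eq, modelOf_coe]
      exact (hbd x).1 hx
    · intro hp
      have hpS : p ∉ S := fun h => hp (by rw [modelOf_of_mem c o h]; rfl)
      have h1 := modelOf_coe c o ⟨p, hpS⟩
      dsimp only at h1
      rw [mem_ofPred_eq, h1] at hp
      exact ⟨⟨p, hpS⟩, (hbd ⟨p, hpS⟩).2 hp, rfl⟩
  have hcomp : image Subtype.val '' boundaryComponents (Reg S) =
      componentsIn {p : X | (modelOf c o p).n ≠ 0} := by
    rw [← hbdX, componentsIn, boundaryComponents, image_image, image_image]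
    exact image_congr fun x hx => isInducing_image_connectedComponentIn isOpenEmbedding_reg.isInducing hx
  refine ⟨⟨modelOf c o, image Subtype.val '' boundaryComponents (Reg S), modelOf_isAt c o hX.riemannian,
    modelOf_compat c o, fun h hh => abs_sub_le_dist_of_local c o hX.riemannian hh, ?_, ?_⟩, ?_, ?_, ?_, ?_⟩
  · rw [← hbdX]
    ext p
    constructor
    · rintro ⟨_, ⟨_, ⟨y, hy, rfl⟩, rfl⟩, ⟨x, hx, rfl⟩⟩
      exact ⟨x, connectedComponentIn_subset _ _ hx, rfl⟩
    · rintro ⟨x, hx, rfl⟩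
      exact ⟨_, ⟨_, ⟨_, hx, rfl⟩, rfl⟩, ⟨_, mem_connectedComponentIn hx, rfl⟩⟩
  · rintro _ ⟨Y, hY, rfl⟩
    obtain ⟨f, hf, hfi, hfY, hfn⟩ := hX.boundary_flat Y hY
    have hb : ∀ v, f v ∈ (𝓡∂ 4).boundary (Reg S) := by
      intro v
      have h1 : f v ∈ Y := hfY ▸ mem_range_self v
      obtain ⟨y, hy, rfl⟩ := hY
      exact connectedComponentIn_subset _ _ h1
    refine ⟨fun v => f v, Subtype.val_injective.comp hfi, ?_, fun u => ?_⟩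
    · rw [← hfY, ← range_comp]; rfl
    · obtain ⟨J, hJ0, hJn, hJ⟩ := (c (f u)).exists_boundary_affine (fun v =>
        ⟨hf.contMDiffAt.of_le (WithTop.coe_le_coe.2 (le_top : (2 : ℕ∞) ≤ ⊤)), hfn v⟩) hb
      rw [modelOf_coe]
      exact ⟨J, hJ0, hJn, hJ.mono fun v hv => congrArg Subtype.val hv⟩
  · ext p
    rw [mem_ofPred_eq, Finset.mem_coe]
    by_cases h : p ∈ S
    · simp only [h, iff_true]
      rw [modelOf_of_mem c o h]
      exact (o p h).G_ne_bot
    · simp only [h, iff_false, not_not]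
      have h1 := modelOf_coe c o ⟨p, h⟩
      dsimp only at h1
      rw [h1]; rfl
  · exact hinj.encard_image _
  · exact hcomp
  · obtain ⟨x, hx⟩ := hX.boundary_nonempty
    refine ⟨x, ?_⟩
    change (modelOf c o x).n ≠ 0
    rw [modelOf_coe]
    exact (hbd x).1 hx

end AtlasOfOrbifold

/-! ### Local models as partial maps. -/

section Germs

open Classical in
/-- The quotient map of a local model as a partial map, defined on the domain of the model. -/
def LocalModel.germ {X : Type*} (m : LocalModel X) (w : E4) : Option X :=
  if w ∈ m.dom then some (m.q w) else none

namespace LocalModel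

variable {X : Type*} {m m' : LocalModel X} {w u : E4}

lemma germ_of_mem (h : w ∈ m.dom) : m.germ w = some (m.q w) := if_pos h

lemma germ_of_notMem (h : w ∉ m.dom) : m.germ w = none := if_neg h

lemma germ_ne_none : m.germ w ≠ none ↔ w ∈ m.dom := by
  by_cases h : w ∈ m.dom <;> simp [germ, h]

lemma germ_eq_some {p : X} : m.germ w = some p ↔ w ∈ m.dom ∧ m.q w = p := by
  by_cases h : w ∈ m.dom <;> simp [germ, h]

/-- With the value `none` off the domain, the matching of domains and the matching of values become
a single equality of germs. -/
lemma Compat.exists_germ_eq (h : m.Compat m' u) :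
    ∃ A : E4 ≃ᵃⁱ[ℝ] E4, A u = 0 ∧ m.germ =ᶠ[𝓝 u] m'.germ ∘ A := by
  obtain ⟨A, hA, h⟩ := h
  refine ⟨A, hA, h.mono fun w hw => ?_⟩
  by_cases hwm : w ∈ m.dom
  · rw [germ_of_mem hwm, Function.comp_apply, germ_of_mem (hw.1.1 hwm), hw.2 hwm]
  · rw [germ_of_notMem hwm, Function.comp_apply, germ_of_notMem (mt hw.1.2 hwm)]

lemma openDom_subset_dom : {w | m.n = 0 ∨ 0 < inner ℝ m.n w} ∩ Metric.ball 0 m.r ⊆ m.dom := by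
  rintro w ⟨h | h, h'⟩
  · exact ⟨by simp [halfSpaceOf, h], h'⟩
  · exact ⟨le_of_lt h, h'⟩

lemma mem_nhds_dom (h : m.n = 0 ∨ 0 < inner ℝ m.n w) (hw : w ∈ Metric.ball 0 m.r) : m.dom ∈ 𝓝 w :=
  mem_of_superset (((isOpen_openHalfSpace m.n).inter Metric.isOpen_ball).mem_nhds ⟨h, hw⟩)
    openDom_subset_dom

lemma inner_pos_of_mem_nhds_dom (h : m.dom ∈ 𝓝 w) : m.n = 0 ∨ 0 < inner ℝ m.n w := by
  refine or_iff_not_imp_left.2 fun hn => ?_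
  have hlim : Tendsto (fun t : ℝ => w - t • m.n) (𝓝[>] 0) (𝓝 w) := by
    have : Continuous fun t : ℝ => w - t • m.n := by fun_prop
    simpa using (this.tendsto 0).mono_left nhdsWithin_le_nhds
  obtain ⟨t, ht, ht0⟩ := ((hlim.eventually h).and self_mem_nhdsWithin).exists
  have h1 : 0 ≤ inner ℝ m.n (w - t • m.n) := ht.1
  rw [inner_sub_right, real_inner_smul_right] at h1
  have h2 : 0 < t * inner ℝ m.n m.n := mul_pos ht0 (real_inner_self_pos.2 hn)
  linarith

lemma frequently_mem_openDom (h : w ∈ m.dom) :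
    ∃ᶠ z in 𝓝 w, z ∈ {w | m.n = 0 ∨ 0 < inner ℝ m.n w} ∩ Metric.ball 0 m.r := by
  by_cases hn : m.n = 0
  · refine Eventually.frequently ?_
    filter_upwards [Metric.isOpen_ball.mem_nhds h.2] with z hz using ⟨Or.inl hn, hz⟩
  have hlim : Tendsto (fun t : ℝ => w + t • m.n) (𝓝[>] 0) (𝓝 w) := by
    have : Continuous fun t : ℝ => w + t • m.n := by fun_prop
    simpa using (this.tendsto 0).mono_left nhdsWithin_le_nhds
  refine hlim.frequently (Eventually.frequently ?_)
  filter_upwards [hlim.eventually (Metric.isOpen_ball.eventually_mem h.2), self_mem_nhdsWithin]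
    with t ht ht0
  refine ⟨Or.inr ?_, ht⟩
  rw [inner_add_right, real_inner_smul_right]
  have h2 : 0 < t * inner ℝ m.n m.n := mul_pos ht0 (real_inner_self_pos.2 hn)
  have h3 : 0 ≤ inner ℝ m.n w := h.1
  linarith

lemma mem_dom_of_frequently (h : ∃ᶠ z in 𝓝 w, z ∈ m.dom) (hw : w ∈ Metric.ball 0 m.r) : w ∈ m.dom :=
  ⟨(isClosed_halfSpaceOf m.n).mem_of_frequently_of_tendsto (h.mono fun _ hz => hz.1) tendsto_id, hw⟩

end LocalModel

/-- Affine isometries that agree near a point are equal. -/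
lemma affineIsometryEquiv_eq_of_eventuallyEq {A B : E4 ≃ᵃⁱ[ℝ] E4} {x : E4} (h : ∀ᶠ y in 𝓝 x, A y = B y) :
    A = B := by
  obtain ⟨ε, hε, hs⟩ := Metric.eventually_nhds_iff_ball.1 h
  have h1 : affineSpan ℝ (Metric.ball x ε) = ⊤ :=
    Metric.isOpen_ball.affineSpan_eq_top ⟨x, Metric.mem_ball_self hε⟩
  have h2 : A.toAffineEquiv = B.toAffineEquiv := AffineEquiv.ext_on h1 _ _ fun y hy => hs y hy
  exact AffineIsometryEquiv.toAffineEquiv_injective h2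

/-- Baire's theorem for a finite closed cover. -/
lemma exists_eventually_mem_of_subset_iUnion {ι : Type*} [Finite ι] [Nonempty ι] {V : Set E4} (hV : IsOpen V)
    (hne : V.Nonempty) {C : ι → Set E4} (hC : ∀ i, IsClosed (C i)) (h : V ⊆ ⋃ i, C i) :
    ∃ i, ∃ x ∈ V, ∀ᶠ y in 𝓝 x, y ∈ C i := by
  have h1 : ⋃ i, (C i ∪ Vᶜ) = univ := by
    refine eq_univ_of_forall fun x => ?_
    by_cases hx : x ∈ V
    · obtain ⟨i, hi⟩ := mem_iUnion.1 (h hx)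
      exact mem_iUnion.2 ⟨i, Or.inl hi⟩
    · exact mem_iUnion.2 ⟨Classical.arbitrary ι, Or.inr hx⟩
  have h2 := dense_iUnion_interior_of_closed (fun i => (hC i).union hV.isClosed_compl) h1
  obtain ⟨x, hxV, hx⟩ := h2.inter_open_nonempty V hV hne
  obtain ⟨i, hi⟩ := mem_iUnion.1 hx
  refine ⟨i, x, hxV, ?_⟩
  filter_upwards [mem_interior_iff_mem_nhds.1 hi, hV.mem_nhds hxV] with y hy hyV
  exact hy.resolve_right fun h => h hyV

namespace LocalModel.IsAt

variable {X : Type*} [MetricSpace X] {m : LocalModel X} {p : X}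

lemma zero_mem_dom (hm : m.IsAt p) : (0 : E4) ∈ m.dom := ⟨by simp [halfSpaceOf], Metric.mem_ball_self hm.r_pos⟩

lemma map_mem_dom (hm : m.IsAt p) {g : E4 ≃ₗᵢ[ℝ] E4} (hg : g ∈ m.G) {w : E4} : g w ∈ m.dom ↔ w ∈ m.dom := by
  by_cases hn : m.n = 0
  · simp [LocalModel.dom, halfSpaceOf, hn]
  · have h1 := hm.G_eq_bot hn
    rw [h1, Subgroup.mem_bot] at hg
    rw [hg]; rfl

lemma germ_map (hm : m.IsAt p) {g : E4 ≃ₗᵢ[ℝ] E4} (hg : g ∈ m.G) (w : E4) : m.germ (g w) = m.germ w := by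
  by_cases h : w ∈ m.dom
  · have h' := (hm.map_mem_dom hg).2 h
    rw [LocalModel.germ_of_mem h, LocalModel.germ_of_mem h', (hm.q_eq_iff _ h _ h').2 ⟨g, hg, rfl⟩]
  · rw [LocalModel.germ_of_notMem h, LocalModel.germ_of_notMem (mt (hm.map_mem_dom hg).1 h)]

lemma eq_zero_of_q_eq (hm : m.IsAt p) {w : E4} (hw : w ∈ m.dom) (h : m.q w = p) : w = 0 := by
  rw [← hm.q_zero, hm.q_eq_iff w hw 0 hm.zero_mem_dom] at h
  obtain ⟨g, -, hg⟩ := h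
  exact g.injective (hg.trans g.map_zero.symm)

/-- Pointwise, `B y` is a translate of `A y` by an element of the group that may depend on `y`. The
group is finite, so one element works on an open set, and affine isometries that agree on an open
set are equal. -/
lemma exists_eq_comp_of_germ_eventuallyEq (hm : m.IsAt p) {A B : E4 ≃ᵃⁱ[ℝ] E4} {x : E4} (hx : A x ∈ m.dom)
    (h : m.germ ∘ A =ᶠ[𝓝 x] m.germ ∘ B) : ∃ g ∈ m.G, ∀ y, B y = g (A y) := by
  obtain ⟨U, hU, hUo, hxU⟩ := eventually_nhds_iff.1 h
  -- The point `A x` may lie on the boundary of the model, so the argument takes place on nearby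
  -- points of the open half-space.
  set V := U ∩ A ⁻¹' ({w | m.n = 0 ∨ 0 < inner ℝ m.n w} ∩ Metric.ball 0 m.r) with hV
  have hVo : IsOpen V :=
    hUo.inter (((isOpen_openHalfSpace m.n).inter Metric.isOpen_ball).preimage A.continuous)
  have hVne : V.Nonempty := by
    have h1 : Tendsto A.symm (𝓝 (A x)) (𝓝 x) := by
      simpa using A.symm.continuous.tendsto (A x)
    obtain ⟨z, hz, hz'⟩ := ((LocalModel.frequently_mem_openDom hx).and_eventually
      (h1.eventually (hUo.eventually_mem hxU))).exists
    exact ⟨A.symm z, hz', by simpa using hz⟩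
  have hfin := hm.finite_G
  obtain ⟨⟨g, hg⟩, y, -, hy⟩ := exists_eventually_mem_of_subset_iUnion (ι := m.G) hVo hVne
    (C := fun g => {y | B y = (g : E4 ≃ₗᵢ[ℝ] E4) (A y)})
    (fun g => isClosed_eq B.continuous ((g : E4 ≃ₗᵢ[ℝ] E4).continuous.comp A.continuous)) (by
      rintro y ⟨hyU, hyA⟩
      have h1 : A y ∈ m.dom := LocalModel.openDom_subset_dom hyA
      have h2 : m.germ (A y) = m.germ (B y) := hU y hyU
      rw [LocalModel.germ_of_mem h1, eq_comm, LocalModel.germ_eq_some] at h2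
      obtain ⟨g, hg, hgy⟩ := (hm.q_eq_iff _ h1 _ h2.1).1 h2.2.symm
      exact mem_iUnion.2 ⟨⟨g, hg⟩, hgy.symm⟩)
  have h3 : B = A.trans g.toAffineIsometryEquiv := affineIsometryEquiv_eq_of_eventuallyEq hy
  exact ⟨g, hg, fun y => by rw [h3]; rfl⟩

end LocalModel.IsAt

end Germs

namespace FlatAtlas

variable {X : Type*} [MetricSpace X] {𝒜 : FlatAtlas X} {Φ Ψ : E4 → Option X} {x y z w : E4} {p a b : X}
  {A B : E4 ≃ᵃⁱ[ℝ] E4}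

/-! ### Good germs and unique continuation. -/

section Germs

/-- Near `x`, the partial map `Φ` is the local model at `p`, composed with the isometry `A` that maps
`x` to `0`. -/
def HasGerm (𝒜 : FlatAtlas X) (Φ : E4 → Option X) (x : E4) (p : X) (A : E4 ≃ᵃⁱ[ℝ] E4) : Prop :=
  A x = 0 ∧ Φ =ᶠ[𝓝 x] (𝒜.model p).germ ∘ A

/-- Near `x`, the partial map `Φ` is a local model up to an isometry that maps `x` to `0`. -/
def Good (𝒜 : FlatAtlas X) (Φ : E4 → Option X) (x : E4) : Prop := ∃ p A, 𝒜.HasGerm Φ x p A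

lemma HasGerm.good (h : 𝒜.HasGerm Φ x p A) : 𝒜.Good Φ x := ⟨p, A, h⟩

lemma HasGerm.apply_eq (h : 𝒜.HasGerm Φ x p A) : Φ x = some p := by
  rw [h.2.self_of_nhds, Function.comp_apply, h.1, LocalModel.germ_of_mem (𝒜.isAt p).zero_mem_dom,
    (𝒜.isAt p).q_zero]

lemma Good.ne_none (h : 𝒜.Good Φ x) : Φ x ≠ none := by
  obtain ⟨p, A, h⟩ := h
  simp [h.apply_eq]

lemma HasGerm.congr (h : 𝒜.HasGerm Φ x p A) (h' : Φ =ᶠ[𝓝 x] Ψ) : 𝒜.HasGerm Ψ x p A :=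
  ⟨h.1, h'.symm.trans h.2⟩

lemma Good.congr (h : 𝒜.Good Φ x) (h' : Φ =ᶠ[𝓝 x] Ψ) : 𝒜.Good Ψ x := by
  obtain ⟨p, A, h⟩ := h
  exact ⟨p, A, h.congr h'⟩

lemma hasGerm_of_eventuallyEq (h : Φ =ᶠ[𝓝 z] (𝒜.model p).germ ∘ B) (hz : B z ∈ (𝒜.model p).dom) :
    ∃ A, 𝒜.HasGerm Φ z ((𝒜.model p).q (B z)) A := by
  obtain ⟨A, hA, hA'⟩ := (𝒜.compat p _ hz).exists_germ_eq
  refine ⟨B.trans A, hA, h.trans ?_⟩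
  exact hA'.comp_tendsto (B.continuous.tendsto z)

lemma HasGerm.exists_lift (h : 𝒜.HasGerm Φ z ((𝒜.model p).q w) A) (hw : w ∈ (𝒜.model p).dom) :
    ∃ B : E4 ≃ᵃⁱ[ℝ] E4, B z = w ∧ Φ =ᶠ[𝓝 z] (𝒜.model p).germ ∘ B := by
  obtain ⟨C, hC, hC'⟩ := (𝒜.compat p _ hw).exists_germ_eq
  have h1 : (A.trans C.symm) z = w := by
    change C.symm (A z) = w
    rw [h.1, ← hC, C.symm_apply_apply]
  refine ⟨A.trans C.symm, h1, h.2.trans ?_⟩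
  have h2 : Tendsto (A.trans C.symm) (𝓝 z) (𝓝 w) := by
    rw [← h1]; exact (A.trans C.symm).continuous.tendsto z
  filter_upwards [h2.eventually hC'] with y hy
  rw [Function.comp_apply, Function.comp_apply, hy, Function.comp_apply]
  change _ = (𝒜.model _).germ (C (C.symm (A y)))
  rw [C.apply_symm_apply]

lemma Good.exists_lift (h : 𝒜.Good Φ z) (hz : Φ z = some ((𝒜.model p).q w)) (hw : w ∈ (𝒜.model p).dom) :
    ∃ B : E4 ≃ᵃⁱ[ℝ] E4, B z = w ∧ Φ =ᶠ[𝓝 z] (𝒜.model p).germ ∘ B := by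
  obtain ⟨p', A, h⟩ := h
  obtain rfl : (𝒜.model p).q w = p' := by
    rw [h.apply_eq] at hz
    exact (Option.some_injective _ hz).symm
  exact h.exists_lift hw

lemma HasGerm.eventually_mem_ball (h : 𝒜.HasGerm Φ x p A) {ε : ℝ} (hε : 0 < ε) :
    ∀ᶠ y in 𝓝 x, A y ∈ Metric.ball 0 ε := by
  have h1 := A.continuous.tendsto x
  rw [h.1] at h1
  exact h1.eventually (Metric.ball_mem_nhds 0 hε)

lemma Good.eventually (h : 𝒜.Good Φ x) : ∀ᶠ y in 𝓝 x, Φ y ≠ none → 𝒜.Good Φ y := by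
  obtain ⟨p, A, h⟩ := h
  filter_upwards [h.2.eventually_nhds] with y hy hne
  rw [hy.self_of_nhds] at hne
  exact (hasGerm_of_eventuallyEq hy (LocalModel.germ_ne_none.1 hne)).elim fun _ h => h.good

lemma ne_none_of_frequently (h : Φ =ᶠ[𝓝 y] (𝒜.model p).germ ∘ A)
    (hy : A y ∈ Metric.ball 0 (𝒜.model p).r) (hf : ∃ᶠ z in 𝓝 y, Φ z ≠ none) : A y ∈ (𝒜.model p).dom := by
  refine LocalModel.mem_dom_of_frequently ?_ hy
  refine (A.continuous.tendsto y).frequently ((hf.and_eventually h).mono fun z hz => ?_)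
  rw [hz.2] at hz
  exact LocalModel.germ_ne_none.1 hz.1

lemma HasGerm.eventually_dist_le (h : 𝒜.HasGerm Φ x p A) : ∀ᶠ y in 𝓝 x, ∀ᶠ z in 𝓝 x,
    ∀ a b, Φ y = some a → Φ z = some b → dist a b ≤ dist y z := by
  filter_upwards [h.2] with y hy
  filter_upwards [h.2] with z hz a b ha hb
  rw [ha, eq_comm] at hy
  rw [hb, eq_comm] at hz
  obtain ⟨hy', rfl⟩ := LocalModel.germ_eq_some.1 hy
  obtain ⟨hz', rfl⟩ := LocalModel.germ_eq_some.1 hz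
  exact ((𝒜.isAt p).dist_q_le _ hy' _ hz').trans_eq (A.dist_map y z)

lemma Good.eventually_dist_le (h : 𝒜.Good Φ x) (hx : Φ x = some a) : ∀ᶠ y in 𝓝 x,
    ∀ b, Φ y = some b → dist a b ≤ dist x y := by
  obtain ⟨p, A, h⟩ := h
  filter_upwards [h.eventually_dist_le.self_of_nhds] with y hy b hb using hy a b hx hb

/-- Partial maps that agree near some points in every neighbourhood of `x` agree near `x`. -/
lemma Good.eventuallyEq_of_frequently (hΦ : 𝒜.Good Φ x) (hΨ : 𝒜.Good Ψ x)
    (h : ∃ᶠ y in 𝓝 x, Φ =ᶠ[𝓝 y] Ψ ∧ Φ y ≠ none) : Φ =ᶠ[𝓝 x] Ψ := by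
  obtain ⟨p, A, hA⟩ := hΦ
  obtain ⟨p', B, hB⟩ := hΨ
  -- The two base points coincide, because both germs are nonexpanding at `x` and share values at
  -- points arbitrarily close to `x`.
  obtain rfl : p = p' := by
    refine eq_of_forall_dist_le fun ε hε => ?_
    obtain ⟨y, ⟨hy, hne⟩, hyA, hyB, hyε⟩ := (h.and_eventually
      ((hA.good.eventually_dist_le hA.apply_eq).and ((hB.good.eventually_dist_le hB.apply_eq).and
        (Metric.ball_mem_nhds x (half_pos hε))))).exists
    obtain ⟨b, hb⟩ := Option.ne_none_iff_exists'.1 hne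
    have h1 := hyA b hb
    have h2 := hyB b (hy.self_of_nhds.symm.trans hb)
    have h3 : dist y x < ε / 2 := hyε
    rw [dist_comm] at h3
    linarith [dist_triangle_right p p' b]
  obtain ⟨y, ⟨hy, hne⟩, hyA, hyB⟩ := (h.and_eventually
    (hA.2.eventually_nhds.and hB.2.eventually_nhds)).exists
  rw [hyA.self_of_nhds] at hne
  have hAB : (𝒜.model p).germ ∘ A =ᶠ[𝓝 y] (𝒜.model p).germ ∘ B := by
    filter_upwards [hyA, hy, hyB] with z h1 h2 h3
    rw [← h1, h2, h3]
  obtain ⟨g, hg, hgAB⟩ := (𝒜.isAt p).exists_eq_comp_of_germ_eventuallyEq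
    (LocalModel.germ_ne_none.1 hne) hAB
  refine hA.2.trans (EventuallyEq.trans (Eventually.of_forall fun z => ?_) hB.2.symm)
  rw [Function.comp_apply, Function.comp_apply, hgAB, (𝒜.isAt p).germ_map hg]

/-- Unique continuation along a connected set. -/
lemma eventuallyEq_of_isPreconnected {C : Set E4} (hC : IsPreconnected C) (hΦ : ∀ x ∈ C, 𝒜.Good Φ x)
    (hΨ : ∀ x ∈ C, (∃ᶠ y in 𝓝 x, Ψ y ≠ none) → 𝒜.Good Ψ x) (hx : x ∈ C) (h : Φ =ᶠ[𝓝 x] Ψ)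
    (hy : y ∈ C) : Φ =ᶠ[𝓝 y] Ψ := by
  have hS : IsOpen {x | Φ =ᶠ[𝓝 x] Ψ} := isOpen_setOfPred_eventually_nhds
  have hV : IsOpen {x | ∀ᶠ y in 𝓝 x, Φ y ≠ none → ¬ Φ =ᶠ[𝓝 y] Ψ} := isOpen_setOfPred_eventually_nhds
  -- Where disagreement does not hold throughout a punctured-by-`none` neighbourhood, points of
  -- agreement accumulate, and then the germs agree there. So agreement and disagreement are both
  -- open conditions that cover `C`.
  have hcov : C ⊆ {x | Φ =ᶠ[𝓝 x] Ψ} ∪ {x | ∀ᶠ y in 𝓝 x, Φ y ≠ none → ¬ Φ =ᶠ[𝓝 y] Ψ} := by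
    intro z hz
    refine or_iff_not_imp_right.2 fun hzV => ?_
    have h1 : ∃ᶠ y in 𝓝 z, Φ =ᶠ[𝓝 y] Ψ ∧ Φ y ≠ none := by
      refine (not_eventually.1 hzV).mono fun y hy => ?_
      push Not at hy
      exact ⟨hy.2, hy.1⟩
    refine (hΦ z hz).eventuallyEq_of_frequently (hΨ z hz (h1.mono fun y hy => ?_)) h1
    rw [← hy.1.self_of_nhds]; exact hy.2
  by_contra hne
  obtain ⟨z, hzC, hzS, hzV⟩ := hC _ _ hS hV hcov ⟨x, hx, h⟩ ⟨y, hy, (hcov hy).resolve_left hne⟩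
  exact hzV.self_of_nhds (hΦ z hzC).ne_none hzS

/-- Good germs are nonexpanding at each point, and the local estimates add up along the segment. -/
lemma dist_le_of_good (h : ∀ z ∈ segment ℝ x y, 𝒜.Good Φ z) (ha : Φ x = some a) (hb : Φ y = some b) :
    dist a b ≤ dist x y := by
  set c : ℝ → E4 := fun t => AffineMap.lineMap (k := ℝ) x y t with hc
  have hcc : Continuous c := AffineMap.lineMap_continuous
  set f : ℝ → X := fun t => (Φ (c t)).getD a with hf
  have hfc : ∀ t ∈ Icc (0 : ℝ) 1, Φ (c t) = some (f t) := by
    intro t ht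
    have h1 : c t ∈ segment ℝ x y := by
      rw [segment_eq_image_lineMap]; exact mem_image_of_mem _ ht
    obtain ⟨b, hb⟩ := Option.ne_none_iff_exists'.1 (h _ h1).ne_none
    simp [hf, hb]
  have hdist : ∀ s t, dist (c s) (c t) = |t - s| * dist x y := by
    intro s t
    rw [hc, dist_lineMap_lineMap, Real.dist_eq, abs_sub_comm]
  -- The parameter is clamped to `[0, 1]`, because the local estimate is also required on both sides
  -- of the endpoints.
  have key := edist_le_of_forall_local (f := fun t => f (max 0 (min t 1)))
    (L := fun s t => ENNReal.ofReal ((t - s) * dist x y)) (fun s t u hst htu => by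
      rw [← ENNReal.ofReal_add (mul_nonneg (by linarith) dist_nonneg)
        (mul_nonneg (by linarith) dist_nonneg)]
      congr 1; ring) (fun t ht => by
      have h1 : c t ∈ segment ℝ x y := by
        rw [segment_eq_image_lineMap]; exact mem_image_of_mem _ ht
      have ht' : max 0 (min t 1) = t := by rw [min_eq_left ht.2, max_eq_right ht.1]
      have h2 := (h _ h1).eventually_dist_le (hfc t ht)
      have h3 : Tendsto (fun z : ℝ => c (max 0 (min z 1))) (𝓝 t) (𝓝 (c t)) := by
        have : Continuous fun z : ℝ => c (max 0 (min z 1)) := by fun_prop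
        simpa [ht'] using this.tendsto t
      filter_upwards [h3.eventually h2] with z hz
      have hz' : max 0 (min z 1) ∈ Icc (0 : ℝ) 1 := by simp
      have h4 := hz _ (hfc _ hz')
      rw [hdist] at h4
      have h5 : |max 0 (min z 1) - t| ≤ |z - t| := by
        rcases le_total z 1 with h | h <;> rcases le_total 0 z with h' | h' <;>
          simp only [h, h', min_eq_left, min_eq_right, max_eq_left, max_eq_right, zero_le_one] <;>
          (try exact le_rfl)
        · rw [abs_sub_comm, abs_of_nonneg (by linarith [ht.1]), abs_sub_comm, abs_of_nonneg (by linarith [ht.1])]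
          linarith
        · rw [abs_of_nonneg (by linarith [ht.2]), abs_of_nonneg (by linarith [ht.2])]
          linarith
        · linarith
      have h6 := h4.trans (mul_le_mul_of_nonneg_right h5 dist_nonneg)
      simp only [ht']
      refine ⟨fun hzt => ?_, fun hzt => ?_⟩
      · rw [edist_comm, edist_dist]
        refine ENNReal.ofReal_le_ofReal (h6.trans_eq ?_)
        rw [abs_sub_comm, abs_of_nonneg (by linarith)]
      · rw [edist_dist]
        refine ENNReal.ofReal_le_ofReal (h6.trans_eq ?_)
        rw [abs_of_nonneg (by linarith)])
  have h0 : f 0 = a := by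
    have := hfc 0 (by simp)
    simp only [hc, AffineMap.lineMap_apply_zero, ha] at this
    exact (Option.some_injective _ this).symm
  have h1 : f 1 = b := by
    have := hfc 1 (by simp)
    simp only [hc, AffineMap.lineMap_apply_one, hb] at this
    exact (Option.some_injective _ this).symm
  simp only [min_self, zero_le_one, min_eq_left, max_self, max_eq_right, h0, h1, sub_zero, one_mul, edist_dist] at key
  exact (ENNReal.ofReal_le_ofReal_iff dist_nonneg).1 key

end Germs

end FlatAtlas

/-! ### Splitting ℝ⁴ into height and horizontal part. -/

section Coordinates

/-- The last three coordinates of a point of `ℝ⁴`. -/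
def tail : E4 →ₗ[ℝ] E3 where
  toFun x := WithLp.toLp 2 fun i => x i.succ
  map_add' _ _ := rfl
  map_smul' _ _ := rfl

/-- The point of `ℝ⁴` with the coordinates `t, v 0, v 1, v 2`. -/
def pt (v : E3) (t : ℝ) : E4 := WithLp.toLp 2 (Fin.cons t v)

variable {x y : E4} {v w : E3} {s t : ℝ}

@[simp] lemma pt_apply_zero (v : E3) (t : ℝ) : pt v t 0 = t := rfl

@[simp] lemma tail_pt (v : E3) (t : ℝ) : tail (pt v t) = v := rfl

@[simp] lemma pt_tail (x : E4) : pt (tail x) (x 0) = x := by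
  ext i
  refine Fin.cases rfl (fun i => rfl) i

lemma pt_sub_pt (v w : E3) (s t : ℝ) : pt v s - pt w t = pt (v - w) (s - t) := by
  ext i
  refine Fin.cases rfl (fun i => rfl) i

lemma pt_add_pt (v w : E3) (s t : ℝ) : pt v s + pt w t = pt (v + w) (s + t) := by
  ext i
  refine Fin.cases rfl (fun i => rfl) i

lemma smul_pt (c : ℝ) (v : E3) (t : ℝ) : c • pt v t = pt (c • v) (c * t) := by
  ext i
  refine Fin.cases rfl (fun i => rfl) i

lemma inner_eq_tail (x y : E4) : inner ℝ x y = x 0 * y 0 + inner ℝ (tail x) (tail y) := by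
  rw [PiLp.inner_apply, Fin.sum_univ_succ, PiLp.inner_apply]
  congr 1
  exact mul_comm _ _

lemma norm_sq_eq_tail (x : E4) : ‖x‖ ^ 2 = x 0 ^ 2 + ‖tail x‖ ^ 2 := by
  rw [← real_inner_self_eq_norm_sq, inner_eq_tail, real_inner_self_eq_norm_sq]; ring

lemma abs_apply_zero_le_norm (x : E4) : |x 0| ≤ ‖x‖ :=
  abs_le_of_sq_le_sq (by nlinarith [norm_sq_eq_tail x, sq_nonneg ‖tail x‖]) (norm_nonneg x)

lemma norm_tail_le_norm (x : E4) : ‖tail x‖ ≤ ‖x‖ :=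
  le_of_sq_le_sq (by nlinarith [norm_sq_eq_tail x, sq_nonneg (x 0)]) (norm_nonneg x)

lemma norm_le_abs_add_norm_tail (x : E4) : ‖x‖ ≤ |x 0| + ‖tail x‖ := by
  refine le_of_sq_le_sq ?_ (by positivity)
  nlinarith [norm_sq_eq_tail x, sq_abs (x 0), mul_nonneg (abs_nonneg (x 0)) (norm_nonneg (tail x))]

@[fun_prop] lemma continuous_tail : Continuous tail := tail.continuous_of_finiteDimensional

lemma continuous_apply_zero : Continuous fun x : E4 => x 0 := by fun_prop

lemma continuous_pt : Continuous fun p : E3 × ℝ => pt p.1 p.2 := by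
  have : Continuous fun p : E3 × ℝ => (Fin.cons p.2 p.1.ofLp : Fin 4 → ℝ) := by
    refine continuous_pi fun i => ?_
    refine Fin.cases ?_ (fun i => ?_) i
    · exact continuous_snd
    · change Continuous fun p : E3 × ℝ => p.1 i
      fun_prop
  exact (PiLp.continuous_toLp 2 _).comp this

@[fun_prop] lemma Continuous.pt' {α : Type*} [TopologicalSpace α] {f : α → E3} {g : α → ℝ} (hf : Continuous f)
    (hg : Continuous g) : Continuous fun a => pt (f a) (g a) :=
  continuous_pt.comp (hf.prodMk hg)

lemma dist_pt_pt_left (v : E3) (s t : ℝ) : dist (pt v s) (pt v t) = |s - t| := by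
  have h := norm_sq_eq_tail (pt v s - pt v t)
  rw [pt_sub_pt, pt_apply_zero, tail_pt, sub_self, norm_zero] at h
  rw [dist_eq_norm, pt_sub_pt, sub_self, ← Real.sqrt_sq (norm_nonneg _), h]
  simp [Real.sqrt_sq_eq_abs]

lemma dist_pt_pt_right (v w : E3) (t : ℝ) : dist (pt v t) (pt w t) = dist v w := by
  have h := norm_sq_eq_tail (pt v t - pt w t)
  rw [pt_sub_pt, pt_apply_zero, tail_pt, sub_self] at h
  rw [dist_eq_norm, pt_sub_pt, sub_self, dist_eq_norm, ← Real.sqrt_sq (norm_nonneg (pt _ _)), h]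
  simp

/-- The affine isometry of `ℝ⁴` that extends an isometry from `ℝ³` onto the hyperplane `n⊥`. -/
lemma exists_affineIsometryEquiv_extending (J : E3 →ᵃⁱ[ℝ] E4) {n : E4} (hn : ‖n‖ = 1)
    (hJ : ∀ v, inner ℝ n (J v) = 0) : ∃ A : E4 ≃ᵃⁱ[ℝ] E4, ∀ y, A y = J (tail y) + y 0 • n := by
  have hJ' : ∀ v, inner ℝ n (J.linearIsometry v) = 0 := by
    intro v
    have h1 := J.map_vadd 0 v
    rw [vadd_eq_add, vadd_eq_add, add_zero] at h1
    have h2 := hJ v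
    rw [h1, inner_add_right, hJ 0, add_zero] at h2
    exact h2
  let l : E4 →ₗ[ℝ] E4 := J.linearIsometry.toLinearMap ∘ₗ tail +
    (EuclideanSpace.proj (0 : Fin 4) : E4 →L[ℝ] ℝ).toLinearMap.smulRight n
  have hl : ∀ y, l y = J.linearIsometry (tail y) + y 0 • n := fun y => rfl
  let L : E4 →ₗᵢ[ℝ] E4 := ⟨l, fun y => by
    rw [hl]
    have h1 : ‖J.linearIsometry (tail y) + y 0 • n‖ ^ 2 = ‖y‖ ^ 2 := by
      rw [norm_add_sq_real, real_inner_smul_right, real_inner_comm, hJ', J.linearIsometry.norm_map,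
        norm_smul, hn, norm_sq_eq_tail, Real.norm_eq_abs, mul_one, sq_abs]
      ring
    exact (sq_eq_sq₀ (norm_nonneg _) (norm_nonneg _)).1 h1⟩
  let L' : E4 ≃ₗᵢ[ℝ] E4 := L.toLinearIsometryEquiv rfl
  refine ⟨L'.toAffineIsometryEquiv.trans (AffineIsometryEquiv.constVAdd ℝ E4 (J 0)), fun y => ?_⟩
  change J 0 + (J.linearIsometry (tail y) + y 0 • n) = _
  have h1 := J.map_vadd 0 (tail y)
  rw [vadd_eq_add, vadd_eq_add, add_zero] at h1
  rw [h1]; abel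

lemma AffineIsometryEquiv.sub_eq (A : E4 ≃ᵃⁱ[ℝ] E4) (x y : E4) :
    A y - A x = A.linearIsometryEquiv (y - x) := (A.map_vsub y x).symm

/-- An affine isometry that, near a point of the hyperplane, maps the upper half-space to the half-space
of normal `n`, maps the vertical coordinate to the coordinate along `n`. -/
lemma inner_eq_apply_zero {A : E4 ≃ᵃⁱ[ℝ] E4} {n : E4} (hn : ‖n‖ = 1) (hx : x 0 = 0) (hA : A x = 0)
    (h : ∀ᶠ y in 𝓝 x, 0 ≤ inner ℝ n (A y) ↔ 0 ≤ y 0) (y : E4) : inner ℝ n (A y) = y 0 := by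
  set m : E4 := A.linearIsometryEquiv.symm n with hm
  have hm1 : ‖m‖ = 1 := by rw [hm, LinearIsometryEquiv.norm_map, hn]
  have hinner : ∀ y, inner ℝ n (A y) = inner ℝ m (y - x) := by
    intro y
    have h1 := AffineIsometryEquiv.sub_eq A x y
    rw [hA, sub_zero] at h1
    rw [h1, hm, ← A.linearIsometryEquiv.inner_map_map _ (y - x), LinearIsometryEquiv.apply_symm_apply]
  -- Both inequalities are invariant under positive scaling of `z`, so their equivalence near `x`
  -- holds everywhere. This forces `m` to be the vertical unit vector.
  have hall : ∀ z : E4, 0 ≤ inner ℝ m z ↔ 0 ≤ z 0 := by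
    intro z
    have hlim : Tendsto (fun t : ℝ => x + t • z) (𝓝[>] 0) (𝓝 x) := by
      have : Continuous fun t : ℝ => x + t • z := by fun_prop
      simpa using (this.tendsto 0).mono_left nhdsWithin_le_nhds
    obtain ⟨t, ht, ht0⟩ := ((hlim.eventually h).and self_mem_nhdsWithin).exists
    have ht0 : 0 < t := ht0
    rw [hinner, add_sub_cancel_left, real_inner_smul_right] at ht
    have h2 : (x + t • z) 0 = t * z 0 := by
      rw [PiLp.add_apply, PiLp.smul_apply, hx, zero_add, smul_eq_mul]
    rw [h2, mul_nonneg_iff_of_pos_left ht0, mul_nonneg_iff_of_pos_left ht0] at ht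
    exact ht
  have htail : tail m = 0 := by
    have h1 := (hall (-pt (tail m) 0)).2 (by simp)
    rw [inner_neg_right, inner_eq_tail] at h1
    simp only [pt_apply_zero, mul_zero, zero_add, tail_pt, real_inner_self_eq_norm_sq] at h1
    have : ‖tail m‖ ^ 2 = 0 := le_antisymm (by linarith) (sq_nonneg _)
    simpa using this
  have hm0 : m 0 = 1 := by
    have h1 := norm_sq_eq_tail m
    rw [hm1, htail, norm_zero] at h1
    have h2 := (hall (pt 0 1)).2 (by simp)
    rw [inner_eq_tail] at h2
    simp only [pt_apply_zero, mul_one, tail_pt, inner_zero_right, add_zero] at h2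
    nlinarith
  rw [hinner, inner_eq_tail, hm0, htail, inner_zero_left, PiLp.sub_apply, hx]
  ring

/-- Such an isometry is determined by its values on the hyperplane and the image of the vertical
unit vector. That image is a unit vector whose inner product with `n` is 1, so it is `n`. -/
lemma affineIsometryEquiv_eq_of_eqOn_hyperplane {A B : E4 ≃ᵃⁱ[ℝ] E4} {n : E4} (hn : ‖n‖ = 1) (hx : x 0 = 0)
    (hAx : A x = 0) (hBx : B x = 0) (hA : ∀ᶠ y in 𝓝 x, 0 ≤ inner ℝ n (A y) ↔ 0 ≤ y 0)
    (hB : ∀ᶠ y in 𝓝 x, 0 ≤ inner ℝ n (B y) ↔ 0 ≤ y 0) (h : ∀ᶠ y in 𝓝 x, y 0 = 0 → A y = B y) : A = B := by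
  have key : ∀ {A : E4 ≃ᵃⁱ[ℝ] E4}, A x = 0 → (∀ᶠ y in 𝓝 x, 0 ≤ inner ℝ n (A y) ↔ 0 ≤ y 0) →
      ∀ y, A y = A (pt (tail y) 0) + y 0 • n := by
    intro A hAx hA y
    have h1 := inner_eq_apply_zero hn hx hAx hA
    set d := A.linearIsometryEquiv (pt 0 1) with hd
    have h2 : ∀ v t, A (pt v t) - A (pt v 0) = t • d := by
      intro v t
      rw [AffineIsometryEquiv.sub_eq, pt_sub_pt, hd, ← map_smul, smul_pt]
      simp
    have hd1 : ‖d‖ = 1 := by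
      rw [hd, LinearIsometryEquiv.norm_map]
      have := dist_pt_pt_left 0 1 0
      rw [dist_eq_norm, pt_sub_pt] at this
      simpa using this
    have hnd : inner ℝ n d = 1 := by
      have h3 := h2 0 1
      rw [one_smul] at h3
      rw [← h3, inner_sub_right, h1, h1]
      simp
    have hdn : n = d := (inner_eq_one_iff_of_norm_eq_one hn hd1).1 hnd
    have h3 := h2 (tail y) (y 0)
    rw [pt_tail] at h3
    rw [hdn, ← h3]; abel
  refine affineIsometryEquiv_eq_of_eventuallyEq (x := x) ?_
  have hlim : Tendsto (fun y : E4 => pt (tail y) 0) (𝓝 x) (𝓝 x) := by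
    have : Continuous fun y : E4 => pt (tail y) 0 := by fun_prop
    have h1 := this.tendsto x
    rw [← hx, pt_tail] at h1
    simpa only [hx] using h1
  filter_upwards [hlim.eventually h] with y hy
  rw [key hAx hA, key hBx hB, hy (by simp)]

end Coordinates

namespace FlatAtlas

variable {X : Type*} [MetricSpace X] {𝒜 : FlatAtlas X} {f : E3 → X} {Φ Ψ : E4 → Option X} {x y z : E4}
  {u u' v : E3} {ε η s t T : ℝ} {U V : Set E4} {p : X} {A B : E4 ≃ᵃⁱ[ℝ] E4}

/-! ### Developing along vertical lines. -/

section Development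

/-- The map `f` is a local isometry of Euclidean `3`-space into the boundary. -/
def IsBoundaryMap (𝒜 : FlatAtlas X) (f : E3 → X) : Prop :=
  ∀ u, (𝒜.model (f u)).n ≠ 0 ∧ ∃ J : E3 →ᵃⁱ[ℝ] E4, J u = 0 ∧
    (∀ v, inner ℝ (𝒜.model (f u)).n (J v) = 0) ∧ ∀ᶠ v in 𝓝 u, f v = (𝒜.model (f u)).q (J v)

/-- On `U`, the partial map `Φ` is an extension of `f` to the upper half-space as a local isometry. -/
def Develops (𝒜 : FlatAtlas X) (f : E3 → X) (Φ : E4 → Option X) (U : Set E4) : Prop :=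
  ∀ x ∈ U, (Φ x ≠ none ↔ 0 ≤ x 0) ∧ (0 ≤ x 0 → 𝒜.Good Φ x) ∧ (x 0 = 0 → Φ x = some (f (tail x)))

lemma Develops.mono (h : 𝒜.Develops f Φ U) (hVU : V ⊆ U) : 𝒜.Develops f Φ V := fun x hx => h x (hVU hx)

lemma Develops.congr (hU : IsOpen U) (h : 𝒜.Develops f Φ U) (h' : ∀ x ∈ U, Ψ x = Φ x) :
    𝒜.Develops f Ψ U := by
  intro x hx
  rw [h' x hx]
  refine ⟨(h x hx).1, fun h0 => ((h x hx).2.1 h0).congr ?_, (h x hx).2.2⟩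
  filter_upwards [hU.mem_nhds hx] with y hy using (h' y hy).symm

/-- The solid cylinder over the ball of radius `ε` about `u`, up to the height `t`. -/
def cyl (u : E3) (ε t : ℝ) : Set E4 := {x | dist (tail x) u < ε ∧ x 0 < t}

lemma isOpen_cyl : IsOpen (cyl u ε t) :=
  IsOpen.inter (s := {x : E4 | dist (tail x) u < ε}) (t := {x : E4 | x 0 < t})
    (isOpen_lt (by fun_prop) continuous_const) (isOpen_lt (by fun_prop) continuous_const)

lemma isPreconnected_image_pt (u : E3) {C : Set ℝ} (hC : IsPreconnected C) :
    IsPreconnected (pt u '' C) :=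
  hC.image _ (Continuous.continuousOn (by fun_prop))

lemma norm_n_eq_one (h : (𝒜.model p).n ≠ 0) : ‖(𝒜.model p).n‖ = 1 := (𝒜.isAt p).norm_n.resolve_left h

/-- An extension of `f` is determined near the floor: its germ is an isometry with prescribed values
on the hyperplane and a prescribed side. -/
lemma Develops.eventuallyEq_of_apply_zero (hf : 𝒜.IsBoundaryMap f) (hU : IsOpen U) (hV : IsOpen V)
    (hΦ : 𝒜.Develops f Φ U) (hΨ : 𝒜.Develops f Ψ V) (hxU : x ∈ U) (hxV : x ∈ V) (hx : x 0 = 0) :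
    Φ =ᶠ[𝓝 x] Ψ := by
  have key : ∀ {Φ : E4 → Option X} {U : Set E4}, IsOpen U → 𝒜.Develops f Φ U → x ∈ U →
      ∃ A, 𝒜.HasGerm Φ x (f (tail x)) A ∧
        (∀ᶠ y in 𝓝 x, 0 ≤ inner ℝ (𝒜.model (f (tail x))).n (A y) ↔ 0 ≤ y 0) ∧
        ∀ᶠ y in 𝓝 x, y 0 = 0 → (𝒜.model (f (tail x))).germ (A y) = some (f (tail y)) := by
    intro Φ U hU h hxU
    obtain ⟨p, A, hA⟩ := (h x hxU).2.1 hx.ge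
    obtain rfl : f (tail x) = p := by
      have h1 := (h x hxU).2.2 hx
      rw [hA.apply_eq] at h1
      exact (Option.some_injective _ h1).symm
    refine ⟨A, hA, ?_, ?_⟩
    · filter_upwards [hU.mem_nhds hxU, hA.2, hA.eventually_mem_ball (𝒜.isAt _).r_pos] with y hyU hy hyr
      rw [← (h y hyU).1, hy, Function.comp_apply, LocalModel.germ_ne_none]
      exact ⟨fun h => ⟨h, hyr⟩, fun h => h.1⟩
    · filter_upwards [hU.mem_nhds hxU, hA.2] with y hyU hy hy0
      rw [← (h y hyU).2.2 hy0, hy, Function.comp_apply]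
  obtain ⟨A, hA, hA1, hA2⟩ := key hU hΦ hxU
  obtain ⟨B, hB, hB1, hB2⟩ := key hV hΨ hxV
  have hn := (hf (tail x)).1
  -- The values on the hyperplane agree in the model and not just in `X`, since the group of a
  -- boundary model is trivial.
  have hAB : A = B := by
    refine affineIsometryEquiv_eq_of_eqOn_hyperplane (norm_n_eq_one hn) hx hA.1 hB.1 hA1 hB1 ?_
    filter_upwards [hA2, hB2] with y h1 h2 hy0
    obtain ⟨h1, h1'⟩ := LocalModel.germ_eq_some.1 (h1 hy0)
    obtain ⟨h2, h2'⟩ := LocalModel.germ_eq_some.1 (h2 hy0)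
    obtain ⟨g, hg, hgy⟩ := ((𝒜.isAt _).q_eq_iff _ h1 _ h2).1 (h1'.trans h2'.symm)
    rw [(𝒜.isAt _).G_eq_bot hn, Subgroup.mem_bot] at hg
    rw [← hgy, hg]; rfl
  rw [hAB] at hA
  exact hA.2.trans hB.2.symm

/-- Uniqueness at the floor is carried up the vertical segment by unique continuation. Hence the
choice made in `develop` does not matter. -/
lemma Develops.eventuallyEq (hf : 𝒜.IsBoundaryMap f) (hΦ : 𝒜.Develops f Φ (cyl u ε s))
    (hΨ : 𝒜.Develops f Ψ (cyl v η t)) (hx : x ∈ cyl u ε s) (hx' : x ∈ cyl v η t) : Φ =ᶠ[𝓝 x] Ψ := by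
  rcases lt_or_ge (x 0) 0 with h0 | h0
  · have h1 : IsOpen {y : E4 | y 0 < 0} := isOpen_lt (by fun_prop) continuous_const
    filter_upwards [isOpen_cyl.mem_nhds hx, isOpen_cyl.mem_nhds hx', h1.mem_nhds h0] with y hy hy' hy0
    have h2 := not_not.1 (mt (hΦ y hy).1.1 (not_le.2 hy0))
    have h3 := not_not.1 (mt (hΨ y hy').1.1 (not_le.2 hy0))
    rw [h2, h3]
  · have hmem : ∀ τ ∈ Icc 0 (x 0), pt (tail x) τ ∈ cyl u ε s ∧ pt (tail x) τ ∈ cyl v η t := fun τ hτ =>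
      ⟨⟨hx.1, hτ.2.trans_lt hx.2⟩, ⟨hx'.1, hτ.2.trans_lt hx'.2⟩⟩
    have hC := isPreconnected_image_pt (tail x) (isPreconnected_Icc (a := 0) (b := x 0))
    have hb : pt (tail x) 0 ∈ pt (tail x) '' Icc 0 (x 0) := mem_image_of_mem _ ⟨le_rfl, h0⟩
    have ht : x ∈ pt (tail x) '' Icc 0 (x 0) := ⟨x 0, ⟨h0, le_rfl⟩, pt_tail x⟩
    refine eventuallyEq_of_isPreconnected (𝒜 := 𝒜) hC ?_ ?_ hb (hΦ.eventuallyEq_of_apply_zero hf isOpen_cyl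
      isOpen_cyl hΨ (hmem 0 ⟨le_rfl, h0⟩).1 (hmem 0 ⟨le_rfl, h0⟩).2 rfl) ht
    · rintro _ ⟨τ, hτ, rfl⟩
      exact (hΦ _ (hmem τ hτ).1).2.1 hτ.1
    · rintro _ ⟨τ, hτ, rfl⟩ -
      exact (hΨ _ (hmem τ hτ).2).2.1 hτ.1

open Classical in
/-- The development along the vertical lines, where it is defined. -/
def develop (𝒜 : FlatAtlas X) (f : E3 → X) (x : E4) : Option X :=
  if h : ∃ Φ : E4 → Option X, ∃ u ε t, 𝒜.Develops f Φ (cyl u ε t) ∧ x ∈ cyl u ε t then h.choose x else none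

lemma Develops.develop_eq (hf : 𝒜.IsBoundaryMap f) (h : 𝒜.Develops f Φ (cyl u ε t))
    (hx : x ∈ cyl u ε t) : 𝒜.develop f x = Φ x := by
  have h' : ∃ Φ : E4 → Option X, ∃ u ε t, 𝒜.Develops f Φ (cyl u ε t) ∧ x ∈ cyl u ε t :=
    ⟨Φ, u, ε, t, h, hx⟩
  rw [develop, dif_pos h']
  obtain ⟨u', ε', t', h1, h2⟩ := h'.choose_spec
  exact (h1.eventuallyEq hf h h2 hx).self_of_nhds

lemma Develops.develop (hf : 𝒜.IsBoundaryMap f) (h : 𝒜.Develops f Φ (cyl u ε t)) :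
    𝒜.Develops f (𝒜.develop f) (cyl u ε t) :=
  h.congr isOpen_cyl fun _ hx => h.develop_eq hf hx

/-- The development is defined on a neighbourhood of the vertical line over `u` up to height `t`. -/
def Dev (𝒜 : FlatAtlas X) (f : E3 → X) (u : E3) (t : ℝ) : Prop :=
  ∃ ε > 0, 𝒜.Develops f (𝒜.develop f) (cyl u ε t)

lemma Dev.mono (h : 𝒜.Dev f u t) (hst : s ≤ t) : 𝒜.Dev f u s := by
  obtain ⟨ε, hε, h⟩ := h
  exact ⟨ε, hε, h.mono fun x hx => ⟨hx.1, hx.2.trans_le hst⟩⟩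

lemma Dev.eventually (h : 𝒜.Dev f u t) : ∀ᶠ v in 𝓝 u, 𝒜.Dev f v t := by
  obtain ⟨ε, hε, h⟩ := h
  filter_upwards [Metric.ball_mem_nhds u hε] with v hv
  refine ⟨ε - dist v u, sub_pos.2 hv, h.mono fun x hx => ⟨?_, hx.2⟩⟩
  have := hx.1
  linarith [dist_triangle (tail x) v u]

/-- The boundary chart `J` extends to an affine isometry that sends height to the coordinate along
the normal; the model at `f u` composed with it is a development for small heights. -/
lemma exists_dev (hf : 𝒜.IsBoundaryMap f) (u : E3) : ∃ t > 0, 𝒜.Dev f u t := by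
  obtain ⟨hn, J, hJu, hJ, hfJ⟩ := hf u
  have hn1 := norm_n_eq_one hn
  obtain ⟨A, hA⟩ := exists_affineIsometryEquiv_extending J hn1 hJ
  have hAn : ∀ y, inner ℝ (𝒜.model (f u)).n (A y) = y 0 := by
    intro y
    rw [hA, inner_add_right, hJ, real_inner_smul_right, real_inner_self_eq_norm_sq, hn1]
    ring
  have hA0 : A (pt u 0) = 0 := by rw [hA]; simp [hJu]
  have h1 : ∀ᶠ y in 𝓝 (pt u 0), A y ∈ Metric.ball 0 (𝒜.model (f u)).r ∧
      f (tail y) = (𝒜.model (f u)).q (J (tail y)) := by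
    refine Filter.Eventually.and ?_ ?_
    · refine (A.continuous.tendsto _).eventually (Metric.isOpen_ball.eventually_mem ?_)
      rw [hA0]; exact Metric.mem_ball_self (𝒜.isAt _).r_pos
    · exact (continuous_tail.tendsto (pt u 0)).eventually hfJ
  obtain ⟨δ, hδ, hb⟩ := Metric.eventually_nhds_iff_ball.1 h1
  have hcyl : ∀ y ∈ cyl u (δ / 2) (δ / 2), 0 ≤ y 0 → y ∈ Metric.ball (pt u 0) δ := by
    rintro y ⟨hy1, hy2⟩ hy0
    rw [mem_ball_iff_norm]
    refine (norm_le_abs_add_norm_tail _).trans_lt ?_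
    rw [map_sub, tail_pt, PiLp.sub_apply, pt_apply_zero, sub_zero, abs_of_nonneg hy0, ← dist_eq_norm]
    linarith
  set Φ : E4 → Option X := fun y => if y 0 < 0 then none else (𝒜.model (f u)).germ (A y) with hΦ
  have hΦA : Φ = (𝒜.model (f u)).germ ∘ A := by
    funext y
    by_cases hy : y 0 < 0
    · rw [hΦ]
      simp only [hy, if_true, Function.comp_apply]
      rw [LocalModel.germ_of_notMem]
      rintro ⟨h, -⟩
      have h : 0 ≤ inner ℝ (𝒜.model (f u)).n (A y) := h
      rw [hAn] at h
      exact absurd h (not_le.2 hy)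
    · simp [hΦ, hy]
  have hdom : ∀ y ∈ cyl u (δ / 2) (δ / 2), 0 ≤ y 0 → A y ∈ (𝒜.model (f u)).dom := by
    intro y hy hy0
    refine ⟨?_, (hb y (hcyl y hy hy0)).1⟩
    change 0 ≤ inner ℝ _ (A y)
    rwa [hAn]
  have hdev : 𝒜.Develops f Φ (cyl u (δ / 2) (δ / 2)) := by
    intro y hy
    refine ⟨⟨fun h => ?_, fun h0 => ?_⟩, fun h0 => ?_, fun h0 => ?_⟩
    · by_contra h0
      exact h (if_pos (not_le.1 h0))
    · rw [hΦA]; exact LocalModel.germ_ne_none.2 (hdom y hy h0)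
    · obtain ⟨C, hC⟩ := hasGerm_of_eventuallyEq (𝒜 := 𝒜) (EventuallyEq.of_eq hΦA) (hdom y hy h0)
      exact hC.good
    · rw [hΦA, Function.comp_apply, LocalModel.germ_of_mem (hdom y hy h0.ge), (hb y (hcyl y hy h0.ge)).2, hA]
      simp [h0]
  exact ⟨δ / 2, half_pos hδ, δ / 2, half_pos hδ, hdev.develop hf⟩

/-- A development known beyond height `s` is continued by a partial map that agrees with it near the
slice of height `s`. -/
lemma Develops.glue (hΦ : 𝒜.Develops f Φ (cyl u ε t)) (hst : s < t) (hs : 0 < s)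
    (hΦΨ : ∀ y, dist (tail y) u < ε → y 0 = s → Φ =ᶠ[𝓝 y] Ψ) (hU : U ⊆ {y | dist (tail y) u < ε})
    (hΨ : ∀ y ∈ U, s ≤ y 0 → 𝒜.Good Ψ y) :
    𝒜.Develops f (fun y => if y 0 < s then Φ y else Ψ y) U := by
  intro y hy
  set Θ : E4 → Option X := fun y => if y 0 < s then Φ y else Ψ y with hΘ
  rcases lt_or_ge (y 0) s with h | h
  · have h1 : IsOpen {y : E4 | y 0 < s} := isOpen_lt (by fun_prop) continuous_const
    have h2 : Φ =ᶠ[𝓝 y] Θ := by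
      filter_upwards [h1.mem_nhds h] with z hz using (if_pos hz).symm
    obtain ⟨h3, h4, h5⟩ := hΦ y ⟨hU hy, h.trans hst⟩
    rw [← h2.self_of_nhds]
    exact ⟨h3, fun h0 => (h4 h0).congr h2, h5⟩
  · have h2 : Ψ =ᶠ[𝓝 y] Θ := by
      rcases h.eq_or_lt with h | h
      · filter_upwards [hΦΨ y (hU hy) h.symm] with z hz
        simp only [hΘ]
        split_ifs
        exacts [hz.symm, rfl]
      · have h1 : IsOpen {y : E4 | s < y 0} := isOpen_lt continuous_const (by fun_prop)
        filter_upwards [h1.mem_nhds h] with z hz using (if_neg (not_lt.2 (le_of_lt hz))).symm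
    have h3 := (hΨ y hy h).congr h2
    refine ⟨⟨fun _ => hs.le.trans h, fun _ => h3.ne_none⟩, fun _ => h3, fun h0 => ?_⟩
    linarith

lemma segment_pt_subset (u : E3) (s t : ℝ) : segment ℝ (pt u s) (pt u t) ⊆ pt u '' segment ℝ s t := by
  rintro _ ⟨a, b, ha, hb, hab, rfl⟩
  refine ⟨a • s + b • t, ⟨a, b, ha, hb, hab, rfl⟩, ?_⟩
  rw [smul_pt, smul_pt, pt_add_pt, ← add_smul, hab, one_smul]
  rfl

/-- The vertical line maps to a 1-Lipschitz curve, which converges to some `p` by completeness. The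
model at `p`, lifted at one height close to `T`, continues the development up to `T` by unique
continuation. An orbifold point `p` is no obstacle, because the lift takes place in the covering
ball. -/
lemma exists_germ_of_forall_dev [CompleteSpace X] (hT : 0 < T) (h : ∀ t < T, 𝒜.Dev f u t) :
    ∃ (p : X) (B : E4 ≃ᵃⁱ[ℝ] E4), B (pt u T) = 0 ∧ ∃ s₀, 0 ≤ s₀ ∧ s₀ < T ∧ ∀ s, s₀ ≤ s → s < T →
      𝒜.develop f =ᶠ[𝓝 (pt u s)] (𝒜.model p).germ ∘ B := by
  have hgood : ∀ s ∈ Ico 0 T, 𝒜.Good (𝒜.develop f) (pt u s) := by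
    intro s hs
    obtain ⟨ε, hε, h1⟩ := h ((s + T) / 2) (by linarith [hs.2])
    exact (h1 (pt u s) ⟨by simpa using hε, by simp only [pt_apply_zero]; linarith [hs.2]⟩).2.1 hs.1
  set F : ℝ → X := fun s => (𝒜.develop f (pt u s)).getD (f 0) with hF
  have hFs : ∀ s ∈ Ico 0 T, 𝒜.develop f (pt u s) = some (F s) := by
    intro s hs
    obtain ⟨b, hb⟩ := Option.ne_none_iff_exists'.1 (hgood s hs).ne_none
    simp [hF, hb]
  have hlip : LipschitzOnWith 1 F (Ico 0 T) := by
    refine LipschitzOnWith.of_dist_le_mul fun s hs t ht => ?_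
    rw [NNReal.coe_one, one_mul, Real.dist_eq, ← dist_pt_pt_left u]
    refine dist_le_of_good (𝒜 := 𝒜) (fun z hz => ?_) (hFs s hs) (hFs t ht)
    obtain ⟨τ, hτ, rfl⟩ := segment_pt_subset u s t hz
    exact hgood τ ((convex_Ico 0 T).segment_subset hs ht hτ)
  have hne : NeBot (𝓝[Ico 0 T] T) := right_nhdsWithin_Ico_neBot hT
  have hc : Cauchy (map F (𝓝[Ico 0 T] T)) :=
    (cauchy_nhds.mono nhdsWithin_le_nhds).map_of_le hlip.uniformContinuousOn
      (le_principal_iff.2 self_mem_nhdsWithin)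
  obtain ⟨p, hp⟩ := CompleteSpace.complete hc
  have hp : Tendsto F (𝓝[Ico 0 T] T) (𝓝 p) := hp
  set r := (𝒜.model p).r with hr
  have hr0 : 0 < r := (𝒜.isAt p).r_pos
  -- With `s₀` within `r / 4` of `T` and `w` within `r / 4` of 0, the rest of the line stays in the
  -- ball of radius `r`.
  have hTr : ∀ᶠ s in 𝓝[Ico 0 T] T, T - r / 4 < s :=
    mem_nhdsWithin_of_mem_nhds (lt_mem_nhds (by linarith))
  obtain ⟨s₀, ⟨⟨w, hw, hws⟩, hs₀r⟩, hs₀⟩ := (((hp.eventually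
    ((𝒜.isAt p).image_mem_nhds (r / 4) (by positivity))).and hTr).and self_mem_nhdsWithin).exists
  have hwr : w ∈ (𝒜.model p).dom := ⟨hw.1, Metric.ball_subset_ball (by linarith) hw.2⟩
  obtain ⟨B, hBw, hB⟩ := (hgood s₀ hs₀).exists_lift (by rw [hFs s₀ hs₀, hws]) hwr
  have hball : ∀ s ∈ Icc s₀ T, B (pt u s) ∈ Metric.ball 0 r := by
    intro s hs
    have h1 : dist (B (pt u s)) w = |s - s₀| := by rw [← hBw, B.dist_map, dist_pt_pt_left]
    rw [abs_of_nonneg (by linarith [hs.1])] at h1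
    have h2 : dist w 0 < r / 4 := hw.2
    have h3 := dist_triangle (B (pt u s)) w 0
    rw [Metric.mem_ball]
    linarith [hs.2]
  have heq : ∀ s, s₀ ≤ s → s < T → 𝒜.develop f =ᶠ[𝓝 (pt u s)] (𝒜.model p).germ ∘ B := by
    intro s hs hsT
    refine eventuallyEq_of_isPreconnected (𝒜 := 𝒜) (isPreconnected_image_pt u (isPreconnected_Ico (a := s₀) (b := T)))
      ?_ ?_ (mem_image_of_mem _ ⟨le_rfl, hs₀.2⟩) hB (mem_image_of_mem _ ⟨hs, hsT⟩)
    · rintro _ ⟨τ, hτ, rfl⟩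
      exact hgood τ ⟨hs₀.1.trans hτ.1, hτ.2⟩
    · rintro _ ⟨τ, hτ, rfl⟩ hfr
      have h1 := ne_none_of_frequently EventuallyEq.rfl (hball τ ⟨hτ.1, hτ.2.le⟩) hfr
      exact (hasGerm_of_eventuallyEq EventuallyEq.rfl h1).elim fun _ h => h.good
  have hdom : ∀ s, s₀ ≤ s → s < T → B (pt u s) ∈ (𝒜.model p).dom ∧ (𝒜.model p).q (B (pt u s)) = F s := by
    intro s hs hsT
    have h1 := (heq s hs hsT).self_of_nhds
    rw [hFs s ⟨hs₀.1.trans hs, hsT⟩, eq_comm] at h1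
    exact LocalModel.germ_eq_some.1 h1
  have hev : ∀ᶠ s in 𝓝[Ico 0 T] T, s₀ ≤ s ∧ s < T :=
    mem_of_superset (inter_mem (mem_nhdsWithin_of_mem_nhds (Ioi_mem_nhds hs₀.2)) self_mem_nhdsWithin)
      fun s hs => ⟨le_of_lt hs.1, hs.2.2⟩
  have hlim : Tendsto (fun s => B (pt u s)) (𝓝[Ico 0 T] T) (𝓝 (B (pt u T))) := by
    have : Continuous fun s : ℝ => B (pt u s) := B.continuous.comp (by fun_prop)
    exact (this.tendsto T).mono_left nhdsWithin_le_nhds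
  have hBT : B (pt u T) ∈ (𝒜.model p).dom :=
    LocalModel.mem_dom_of_frequently (hlim.frequently (hev.mono fun s hs => (hdom s hs.1 hs.2).1).frequently)
      (hball T ⟨hs₀.2.le, le_rfl⟩)
  -- By continuity the endpoint lies over the limit `p`, and 0 is the only point of the model over
  -- `p`.
  refine ⟨p, B, (𝒜.isAt p).eq_zero_of_q_eq hBT ?_, s₀, hs₀.1, hs₀.2, heq⟩
  refine tendsto_nhds_unique ?_ hp
  refine tendsto_iff_dist_tendsto_zero.2 (squeeze_zero' (Eventually.of_forall fun _ => dist_nonneg) ?_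
    (tendsto_iff_dist_tendsto_zero.1 hlim))
  filter_upwards [hev] with s hs
  rw [← (hdom s hs.1 hs.2).2]
  exact (𝒜.isAt p).dist_q_le _ (hdom s hs.1 hs.2).1 _ hBT

end Development

end FlatAtlas

namespace FlatAtlas

variable {X : Type*} [MetricSpace X] {𝒜 : FlatAtlas X} {f : E3 → X} {Φ Ψ : E4 → Option X} {x y z : E4}
  {u u' v a a' : E3} {ε η s t T b b' : ℝ} {U V : Set E4} {p : X} {A B : E4 ≃ᵃⁱ[ℝ] E4}

/-! ### How vertical lines leave through the boundary. -/

section Exit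

/-- The vertical line over `u` leaves the space at the height `b + ⟪a, u⟫`, through a part of the
boundary which is the graph of `v ↦ b + ⟪a, v⟫`. -/
def Exit (𝒜 : FlatAtlas X) (f : E3 → X) (a : E3) (b : ℝ) (u : E3) : Prop :=
  0 < b + inner ℝ a u ∧ (∀ t < b + inner ℝ a u, 𝒜.Dev f u t) ∧
    ∃ Ψ, 𝒜.Good Ψ (pt u (b + inner ℝ a u)) ∧ ∀ᶠ y in 𝓝 (pt u (b + inner ℝ a u)),
      (Ψ y ≠ none ↔ y 0 ≤ b + inner ℝ a (tail y)) ∧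
      (y 0 < b + inner ℝ a (tail y) → 𝒜.develop f =ᶠ[𝓝 y] Ψ)

lemma Exit.frequently {P : E4 → Prop}
    (h : ∀ᶠ y in 𝓝 (pt u T), y 0 < b + inner ℝ a (tail y) → P y) (hT : T = b + inner ℝ a u) :
    ∀ᶠ s in 𝓝[<] T, P (pt u s) := by
  have hlim : Tendsto (fun s : ℝ => pt u s) (𝓝[<] T) (𝓝 (pt u T)) := by
    have : Continuous fun s : ℝ => pt u s := by fun_prop
    exact (this.tendsto T).mono_left nhdsWithin_le_nhds
  filter_upwards [hlim.eventually h, self_mem_nhdsWithin] with s hs hsT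
  exact hs (by simpa [← hT] using hsT)

/-- A development beyond the exit height would agree with `Ψ` there by continuation from below, yet
`Ψ` is `none` just above the graph. -/
lemma Exit.le_of_dev (h : 𝒜.Exit f a b u) (ht : 𝒜.Dev f u t) : t ≤ b + inner ℝ a u := by
  obtain ⟨h0, -, Ψ, hΨ, hev⟩ := h
  by_contra! hlt
  obtain ⟨ε, hε, hdev⟩ := ht
  set T := b + inner ℝ a u with hT
  have hmem : pt u T ∈ cyl u ε t := ⟨by simpa using hε, hlt⟩
  have hgood := (hdev _ hmem).2.1 h0.le
  have hlim : Tendsto (fun s : ℝ => pt u s) (𝓝[<] T) (𝓝 (pt u T)) := by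
    have : Continuous fun s : ℝ => pt u s := by fun_prop
    exact (this.tendsto T).mono_left nhdsWithin_le_nhds
  have h1 : 𝒜.develop f =ᶠ[𝓝 (pt u T)] Ψ := by
    refine hgood.eventuallyEq_of_frequently hΨ (hlim.frequently (Eventually.frequently ?_))
    filter_upwards [Exit.frequently (hev.mono fun y hy => hy.2) hT,
      hlim.eventually hgood.eventually, mem_nhdsWithin_of_mem_nhds (lt_mem_nhds h0),
      hlim.eventually (isOpen_cyl.eventually_mem hmem)] with s hs1 _ hs3 hs4
    exact ⟨hs1, (hdev _ hs4).1.2 hs3.le⟩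
  have hlim' : Tendsto (fun s : ℝ => pt u s) (𝓝[>] T) (𝓝 (pt u T)) := by
    have : Continuous fun s : ℝ => pt u s := by fun_prop
    exact (this.tendsto T).mono_left nhdsWithin_le_nhds
  obtain ⟨s, hs1, hs2, hs3, hs4⟩ := ((hlim'.eventually h1).and ((hlim'.eventually hev).and
    ((hlim'.eventually (isOpen_cyl.eventually_mem hmem)).and self_mem_nhdsWithin))).exists
  have hs4 : T < s := hs4
  have h2 := (hdev _ hs3).1.2 (by simp only [pt_apply_zero]; linarith)
  rw [hs1] at h2
  have h3 := hs2.1.1 h2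
  simp only [pt_apply_zero, tail_pt, ← hT] at h3
  linarith

/-- The same `Ψ` witnesses the exit over nearby points. -/
lemma Exit.eventually (h : 𝒜.Exit f a b u) : ∀ᶠ v in 𝓝 u, 𝒜.Exit f a b v := by
  obtain ⟨h0, hdev, Ψ, hΨ, hev⟩ := h
  have hT : Continuous fun v : E3 => b + inner ℝ a v := by fun_prop
  have hlim : Tendsto (fun v : E3 => pt v (b + inner ℝ a v)) (𝓝 u) (𝓝 (pt u (b + inner ℝ a u))) := by
    have : Continuous fun v : E3 => pt v (b + inner ℝ a v) := by fun_prop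
    exact this.tendsto u
  obtain ⟨δ, hδ, hball⟩ := Metric.eventually_nhds_iff_ball.1 (hev.and hΨ.eventually)
  set T := b + inner ℝ a u with hTdef
  obtain ⟨s, hs0, hsT, hsδ⟩ : ∃ s, 0 < s ∧ s < T ∧ T < s + δ / 2 :=
    ⟨max (T / 2) (T - δ / 4), lt_max_of_lt_left (by linarith), max_lt (by linarith) (by linarith),
      by linarith [le_max_right (T / 2) (T - δ / 4)]⟩
  obtain ⟨ε, hε, hcyl⟩ := hdev s hsT
  have hT1 : ∀ᶠ v in 𝓝 u, b + inner ℝ a v < T + δ / 4 := by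
    have := hT.tendsto u
    exact this.eventually (gt_mem_nhds (by linarith))
  obtain ⟨κ, hκ, hκT⟩ := Metric.eventually_nhds_iff_ball.1 hT1
  filter_upwards [hT.tendsto u (lt_mem_nhds h0), hlim.eventually (hev.eventually_nhds.and hΨ.eventually),
    Metric.ball_mem_nhds u (lt_min (lt_min hε hκ) (half_pos hδ))] with v hv0 hv hvu
  refine ⟨hv0, fun t ht => ?_, Ψ, hv.2 (hv.1.self_of_nhds.1.2 le_rfl), hv.1⟩
  have hvu' : dist v u < min (min ε κ) (δ / 2) := hvu
  have ht' : ∀ᶠ v' in 𝓝 v, t < b + inner ℝ a v' := hT.tendsto v (lt_mem_nhds ht)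
  obtain ⟨ρ, hρ, hρt⟩ := Metric.eventually_nhds_iff_ball.1 ht'
  refine ⟨min ρ (min (min ε κ) (δ / 2) - dist v u), lt_min hρ (sub_pos.2 hvu'), fun y hy => ?_⟩
  have hy1 : dist (tail y) v < ρ := hy.1.trans_le (min_le_left _ _)
  have hy2 : dist (tail y) u < min (min ε κ) (δ / 2) := by
    have := hy.1.trans_le (min_le_right _ _)
    linarith [dist_triangle (tail y) v u]
  rw [lt_min_iff, lt_min_iff] at hy2
  -- Below height `s` the cylinder over `u` applies; from `s` on and below the graph, `y` lies in
  -- the ball on which `Ψ` describes the development.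
  rcases lt_or_ge (y 0) s with hys | hys
  · exact hcyl y ⟨hy2.1.1, hys⟩
  · have hyL : y 0 < b + inner ℝ a (tail y) := hy.2.trans (hρt _ hy1)
    have hyT := hκT _ hy2.1.2
    have hyb : y ∈ Metric.ball (pt u T) δ := by
      rw [mem_ball_iff_norm]
      refine (norm_le_abs_add_norm_tail _).trans_lt ?_
      rw [map_sub, tail_pt, PiLp.sub_apply, pt_apply_zero, ← dist_eq_norm]
      have : |y 0 - T| < δ / 2 := abs_lt.2 ⟨by linarith, by linarith⟩
      linarith [hy2.2]
    obtain ⟨⟨h1, h2⟩, h3⟩ := hball y hyb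
    have h4 := h3 (h1.2 hyL.le)
    have h5 := h4.congr (h2 hyL).symm
    exact ⟨⟨fun _ => hs0.le.trans hys, fun _ => h5.ne_none⟩, fun _ => h5, fun h0 => by linarith⟩

/-- The limit point of the line is interior or a boundary point. In the first case its model
continues the development past `T`. In the second its half-space, pulled back to ℝ⁴, is the region
below the graph of an affine function. -/
lemma exists_dev_or_exit [CompleteSpace X] (hf : 𝒜.IsBoundaryMap f) (hT : 0 < T)
    (h : ∀ t < T, 𝒜.Dev f u t) :
    (∃ t > T, 𝒜.Dev f u t) ∨ ∃ a b, b + inner ℝ a u = T ∧ 𝒜.Exit f a b u := by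
  obtain ⟨p, B, hB0, s₀, hs₀, hs₀T, hB⟩ := exists_germ_of_forall_dev hT h
  set m := 𝒜.model p with hm
  have hr0 : 0 < m.r := (𝒜.isAt p).r_pos
  obtain ⟨s, hs0, hss₀, hsT, hsr⟩ : ∃ s, 0 < s ∧ s₀ ≤ s ∧ s < T ∧ T < s + m.r / 4 := by
    refine ⟨max ((s₀ + T) / 2) (T - m.r / 8), lt_max_of_lt_left (by linarith),
      le_max_of_le_left (by linarith), max_lt (by linarith) (by linarith),
      by linarith [le_max_right ((s₀ + T) / 2) (T - m.r / 8)]⟩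
  obtain ⟨ε, hε, hcyl⟩ := h ((s + T) / 2) (by linarith)
  obtain ⟨δ, hδ, hball⟩ := Metric.eventually_nhds_iff_ball.1 (hB s hss₀ hsT).eventually_nhds
  set ρ := min (min ε δ) (m.r / 4) with hρ
  have hρ0 : 0 < ρ := lt_min (lt_min hε hδ) (by positivity)
  have hρε : ρ ≤ ε := (min_le_left _ _).trans (min_le_left _ _)
  have hρδ : ρ ≤ δ := (min_le_left _ _).trans (min_le_right _ _)
  have hρr : ρ ≤ m.r / 4 := min_le_right _ _
  have hBball : ∀ z, dist (tail z) u < ρ → s ≤ z 0 → z 0 < T + m.r / 2 → B z ∈ Metric.ball 0 m.r := by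
    intro z hz hzs hzT
    rw [Metric.mem_ball, ← hB0, B.dist_map, dist_eq_norm]
    refine (norm_le_abs_add_norm_tail _).trans_lt ?_
    rw [map_sub, tail_pt, PiLp.sub_apply, pt_apply_zero, ← dist_eq_norm]
    have : |z 0 - T| < m.r / 2 := abs_lt.2 ⟨by linarith, by linarith⟩
    linarith
  have hglue : ∀ v η t, (∀ z ∈ cyl v η t, dist (tail z) u < ρ) → t ≤ T + m.r / 2 →
      (∀ z ∈ cyl v η t, s ≤ z 0 → m.n = 0 ∨ 0 < inner ℝ m.n (B z)) →
      𝒜.Develops f (𝒜.develop f) (cyl v η t) ∧ ∀ z ∈ cyl v η t, s ≤ z 0 →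
        𝒜.develop f z = m.germ (B z) := by
    intro v η t h1 h2 h3
    have key := Develops.glue (u := u) (ε := ρ) (U := cyl v η t) (Ψ := m.germ ∘ B)
      (hcyl.mono fun z hz => ⟨hz.1.trans_le hρε, hz.2⟩) (show s < (s + T) / 2 by linarith) hs0
      (fun y hy hys => hball y (by
        rw [Metric.mem_ball, ← pt_tail y, hys, dist_pt_pt_right]
        exact hy.trans_le hρδ)) h1 (fun z hz hzs => by
        have h4 : B z ∈ m.dom := LocalModel.openDom_subset_dom
          ⟨h3 z hz hzs, hBball z (h1 z hz) hzs (hz.2.trans_le h2)⟩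
        exact (hasGerm_of_eventuallyEq (𝒜 := 𝒜) EventuallyEq.rfl h4).elim fun _ h => h.good)
    refine ⟨key.develop hf, fun z hz hzs => ?_⟩
    rw [key.develop_eq hf hz]
    exact if_neg (not_lt.2 hzs)
  by_cases hn : m.n = 0
  · left
    exact ⟨T + m.r / 2, by linarith, ρ, hρ0, (hglue u ρ (T + m.r / 2) (fun z hz => hz.1) le_rfl
      fun _ _ _ => Or.inl hn).1⟩
  · right
    set k : E4 := B.linearIsometryEquiv.symm m.n with hk
    have hinner : ∀ y, inner ℝ m.n (B y) = k 0 * (y 0 - T) + inner ℝ (tail k) (tail y - u) := by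
      intro y
      have h1 := AffineIsometryEquiv.sub_eq B (pt u T) y
      rw [hB0, sub_zero] at h1
      have h2 := B.linearIsometryEquiv.inner_map_map k (y - pt u T)
      rw [hk, LinearIsometryEquiv.apply_symm_apply, ← h1, ← hk, inner_eq_tail k, map_sub, tail_pt,
        PiLp.sub_apply, pt_apply_zero] at h2
      exact h2
    -- The line arrives from the interior of the model, so the inner normal points downwards. In
    -- particular the hyperplane is not vertical and is a graph.
    have hk0 : k 0 < 0 := by
      have h1 : m.dom ∈ 𝓝 (B (pt u s)) := by
        have h2 : ∀ᶠ y in 𝓝 (pt u s), 𝒜.develop f y ≠ none := by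
          have hmem : pt u s ∈ cyl u ε ((s + T) / 2) :=
            ⟨by simpa using hε, by simp only [pt_apply_zero]; linarith⟩
          have ho : IsOpen {y : E4 | 0 < y 0} := isOpen_lt continuous_const (by fun_prop)
          filter_upwards [isOpen_cyl.mem_nhds hmem, ho.mem_nhds hs0] with y hy hy0
          exact (hcyl y hy).1.2 (le_of_lt hy0)
        have h3 : ∀ᶠ y in 𝓝 (pt u s), B y ∈ m.dom := by
          filter_upwards [h2, hB s hss₀ hsT] with y hy hy'
          rw [hy'] at hy
          exact LocalModel.germ_ne_none.1 hy
        have h4 : Tendsto B.symm (𝓝 (B (pt u s))) (𝓝 (pt u s)) := by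
          simpa using B.symm.continuous.tendsto (B (pt u s))
        filter_upwards [h4.eventually h3] with w hw
        simpa using hw
      have h2 := (LocalModel.inner_pos_of_mem_nhds_dom h1).resolve_left hn
      rw [hinner] at h2
      simp only [pt_apply_zero, tail_pt, sub_self, inner_zero_right, add_zero] at h2
      nlinarith
    -- The slope found by solving `k 0 * (y 0 - T) + ⟪tail k, tail y - u⟫ = 0` for `y 0`.
    set a : E3 := (-(k 0)⁻¹) • tail k with ha
    have hka : ∀ v, inner ℝ (tail k) v = - k 0 * inner ℝ a v := by
      intro v
      have := hk0.ne
      rw [ha, real_inner_smul_left]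
      field_simp
    have hinner' : ∀ y, inner ℝ m.n (B y) = k 0 * (y 0 - (T - inner ℝ a u + inner ℝ a (tail y))) := by
      intro y
      rw [hinner, hka, inner_sub_right]; ring
    have hTu : T - inner ℝ a u + inner ℝ a u = T := by ring
    refine ⟨a, T - inner ℝ a u, hTu, ?_⟩
    rw [Exit, hTu]
    refine ⟨hT, h, m.germ ∘ B, ⟨p, B, hB0, EventuallyEq.rfl⟩, ?_⟩
    have hκ : 0 < min (ρ / 2) (T - s) := lt_min (half_pos hρ0) (by linarith)
    filter_upwards [Metric.ball_mem_nhds (pt u T) hκ] with y hy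
    have hyκ : dist y (pt u T) < min (ρ / 2) (T - s) := hy
    rw [lt_min_iff, dist_eq_norm] at hyκ
    have hy1 : dist (tail y) u < ρ / 2 := by
      have h1 := norm_tail_le_norm (y - pt u T)
      rw [map_sub, tail_pt, ← dist_eq_norm] at h1
      linarith
    have hy2 := abs_apply_zero_le_norm (y - pt u T)
    rw [PiLp.sub_apply, pt_apply_zero, abs_le] at hy2
    have hyr : B y ∈ Metric.ball 0 m.r := hBball y (by linarith) (by linarith) (by linarith)
    refine ⟨?_, fun hyL => ?_⟩
    · rw [Function.comp_apply, LocalModel.germ_ne_none]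
      have h1 : B y ∈ m.dom ↔ 0 ≤ inner ℝ m.n (B y) := ⟨fun h => h.1, fun h => ⟨h, hyr⟩⟩
      rw [h1, hinner']
      constructor
      · intro h; nlinarith
      · intro h; nlinarith
    · set gap := T - inner ℝ a u + inner ℝ a (tail y) - y 0 with hgap
      have hgap0 : 0 < gap := sub_pos.2 hyL
      -- Over a ball of radius `η` the graph drops by at most `‖a‖ * η`; adding the extra height `η`
      -- still uses up only half of the gap.
      set η := min (ρ / 2) (gap / (2 * (1 + ‖a‖))) with hη
      have hη0 : 0 < η := lt_min (half_pos hρ0) (by positivity)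
      have hηa : η * (1 + ‖a‖) ≤ gap / 2 := by
        have h1 : η ≤ gap / (2 * (1 + ‖a‖)) := min_le_right _ _
        rw [le_div_iff₀ (by positivity)] at h1
        linarith
      have hηρ : η ≤ ρ / 2 := min_le_left _ _
      have hmem : y ∈ cyl (tail y) η (y 0 + η) := ⟨by simpa using hη0, by linarith⟩
      obtain ⟨-, h1⟩ := hglue (tail y) η (y 0 + η)
        (fun z hz => by linarith [dist_triangle (tail z) (tail y) u, hz.1]) (by linarith)
        (fun z hz hzs => by
          right
          rw [hinner']
          refine mul_pos_of_neg_of_neg hk0 ?_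
          have h2 : inner ℝ a (tail y) - inner ℝ a (tail z) ≤ ‖a‖ * η := by
            rw [← inner_sub_right]
            refine (real_inner_le_norm _ _).trans (mul_le_mul_of_nonneg_left ?_ (norm_nonneg _))
            rw [← dist_eq_norm, dist_comm]; exact hz.1.le
          have h3 := hz.2
          linarith)
      have ho : IsOpen {z : E4 | s < z 0} := isOpen_lt continuous_const (by fun_prop)
      have hys : s < y 0 := by linarith
      filter_upwards [isOpen_cyl.mem_nhds hmem, ho.mem_nhds hys] with z hz hzs
      exact h1 z hz (le_of_lt hzs)

lemma eq_of_eventually_inner_eq (h : ∃ᶠ u' in 𝓝 u, ∀ᶠ v in 𝓝 u', b + inner ℝ a v = b' + inner ℝ a' v) :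
    a = a' ∧ b = b' := by
  obtain ⟨u', hu'⟩ := h.exists
  have h1 : ∀ w : E3, inner ℝ (a - a') w = 0 := by
    intro w
    have hlim : Tendsto (fun t : ℝ => u' + t • w) (𝓝[>] 0) (𝓝 u') := by
      have : Continuous fun t : ℝ => u' + t • w := by fun_prop
      simpa using (this.tendsto 0).mono_left nhdsWithin_le_nhds
    obtain ⟨t, ht, ht0⟩ := ((hlim.eventually hu').and self_mem_nhdsWithin).exists
    have h2 := hu'.self_of_nhds
    have ht0 : 0 < t := ht0
    rw [inner_add_right, inner_add_right, real_inner_smul_right, real_inner_smul_right] at ht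
    have h3 : t * (inner ℝ a w - inner ℝ a' w) = 0 := by linarith
    rw [inner_sub_left]
    exact (mul_eq_zero.1 h3).resolve_left ht0.ne'
  have h2 : a = a' := sub_eq_zero.1 (inner_self_eq_zero.1 (h1 (a - a')))
  refine ⟨h2, ?_⟩
  have h3 := hu'.self_of_nhds
  rw [h2] at h3
  linarith

lemma Exit.height_eq (h : 𝒜.Exit f a b u) (h' : 𝒜.Exit f a' b' u) :
    b + inner ℝ a u = b' + inner ℝ a' u := by
  refine le_antisymm ?_ ?_
  · exact le_of_forall_lt fun t ht => by
      obtain ⟨t', ht1, ht2⟩ := exists_between ht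
      exact ht1.trans_le (h'.le_of_dev (h.2.1 t' ht2))
  · exact le_of_forall_lt fun t ht => by
      obtain ⟨t', ht1, ht2⟩ := exists_between ht
      exact ht1.trans_le (h.le_of_dev (h'.2.1 t' ht2))

lemma exists_exit [CompleteSpace X] (hf : 𝒜.IsBoundaryMap f) (h : ¬ 𝒜.Dev f u t) :
    ∃ a b, b + inner ℝ a u ≤ t ∧ 𝒜.Exit f a b u := by
  set D := {s | 𝒜.Dev f u s} with hD
  have hbdd : ∀ s ∈ D, s ≤ t := fun s hs => le_of_not_gt fun hlt => h (Dev.mono hs hlt.le)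
  have hB : BddAbove D := ⟨t, hbdd⟩
  obtain ⟨s, hs0, hs⟩ := exists_dev hf u
  have hT : 0 < sSup D := hs0.trans_le (le_csSup hB hs)
  rcases exists_dev_or_exit hf hT (fun τ hτ => by
    obtain ⟨τ', hτ', hlt⟩ := exists_lt_of_lt_csSup ⟨s, hs⟩ hτ
    exact Dev.mono hτ' hlt.le) with ⟨τ, hτ, hdev⟩ | ⟨a, b, hab, hex⟩
  · exact absurd (le_csSup hB hdev) (not_le.2 hτ)
  · exact ⟨a, b, hab.trans_le (csSup_le ⟨s, hs⟩ hbdd), hex⟩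

/-- The exit condition for given `a`, `b` is open. At a limit `v` of such points the development is
bounded in height, so `v` exits through some graph `a'`, `b'`. Exit heights are unique, so both
affine functions agree on a nonempty open set and coincide. -/
lemma Exit.all [CompleteSpace X] (hf : 𝒜.IsBoundaryMap f) (h : 𝒜.Exit f a b u) (v : E3) :
    𝒜.Exit f a b v := by
  have hopen : IsOpen {v | 𝒜.Exit f a b v} := isOpen_iff_mem_nhds.2 fun v hv => Exit.eventually hv
  have hclosed : IsClosed {v | 𝒜.Exit f a b v} := by
    refine isClosed_iff_frequently.2 fun v hv => ?_
    have hv : ∃ᶠ w in 𝓝 v, 𝒜.Exit f a b w := hv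
    have hle : ∀ t, 𝒜.Dev f v t → t ≤ b + inner ℝ a v := by
      intro t ht
      have hT : Continuous fun w : E3 => b + inner ℝ a w := by fun_prop
      refine le_of_forall_pos_le_add fun ε hε => ?_
      obtain ⟨w, hw, hwt, hwε⟩ := (hv.and_eventually (ht.eventually.and
        (hT.tendsto v (gt_mem_nhds (lt_add_of_pos_right _ hε))))).exists
      exact (hw.le_of_dev hwt).trans (le_of_lt hwε)
    obtain ⟨a', b', hle', hex⟩ := exists_exit hf (u := v) (t := b + inner ℝ a v + 1)
      fun hd => by linarith [hle _ hd]
    obtain ⟨rfl, rfl⟩ := eq_of_eventually_inner_eq ((hv.and_eventually hex.eventually).mono fun w hw =>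
      (hw.1.eventually.and hw.2.eventually).mono fun w h => h.1.height_eq h.2)
    exact hex
  have huniv := IsClopen.eq_univ ⟨hclosed, hopen⟩ ⟨u, h⟩
  exact huniv.ge (mem_univ v)

/-- A non-constant affine function vanishes somewhere, here at `-(b / ‖a‖ ^ 2) • a`, but exit
heights are positive. -/
lemma Exit.slope_eq_zero [CompleteSpace X] (hf : 𝒜.IsBoundaryMap f) (h : 𝒜.Exit f a b u) : a = 0 := by
  by_contra ha
  have h1 := (h.all hf (-(b / ‖a‖ ^ 2) • a)).1
  rw [real_inner_smul_right, real_inner_self_eq_norm_sq, neg_mul, div_mul_cancel₀] at h1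
  · linarith
  · exact pow_ne_zero 2 (norm_ne_zero_iff.2 ha)

/-- The partial map `Φ` is an extension of `f` to a local isometry on `Ω`. -/
structure IsDevelopment (𝒜 : FlatAtlas X) (f : E3 → X) (Φ : E4 → Option X) (Ω : Set E4) : Prop where
  ne_none_iff : ∀ x, Φ x ≠ none ↔ x ∈ Ω
  good : ∀ x ∈ Ω, 𝒜.Good Φ x
  apply_pt : ∀ v, Φ (pt v 0) = some (f v)

lemma Dev.develops (h : 𝒜.Dev f (tail x) t) (hx : x 0 < t) : 
    (𝒜.develop f x ≠ none ↔ 0 ≤ x 0) ∧ (0 ≤ x 0 → 𝒜.Good (𝒜.develop f) x) ∧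
      (x 0 = 0 → 𝒜.develop f x = some (f (tail x))) := by
  obtain ⟨ε, hε, h⟩ := h
  exact h x ⟨by simpa using hε, hx⟩

theorem exists_isDevelopment [CompleteSpace X] (hf : 𝒜.IsBoundaryMap f) :
    ∃ Φ, 𝒜.IsDevelopment f Φ {x | 0 ≤ x 0} ∨ ∃ c > 0, 𝒜.IsDevelopment f Φ {x | 0 ≤ x 0 ∧ x 0 ≤ c} := by
  by_cases hall : ∀ u t, 𝒜.Dev f u t
  · have key := fun x : E4 => (hall (tail x) (x 0 + 1)).develops (lt_add_one _)
    exact ⟨𝒜.develop f, Or.inl ⟨fun x => (key x).1, fun x hx => (key x).2.1 hx,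
      fun v => (key (pt v 0)).2.2 rfl⟩⟩
  push Not at hall
  obtain ⟨u₀, t₀, h₀⟩ := hall
  obtain ⟨a, c, -, hex⟩ := exists_exit hf h₀
  obtain rfl := hex.slope_eq_zero hf
  have hex' : ∀ u, 0 < c ∧ (∀ t < c, 𝒜.Dev f u t) ∧ ∃ Ψ, 𝒜.Good Ψ (pt u c) ∧ ∀ᶠ y in 𝓝 (pt u c),
      (Ψ y ≠ none ↔ y 0 ≤ c) ∧ (y 0 < c → 𝒜.develop f =ᶠ[𝓝 y] Ψ) := by
    intro u
    have := hex.all hf u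
    simpa only [Exit, inner_zero_left, add_zero] using this
  have hc := (hex' 0).1
  have hdev : ∀ x : E4, x 0 < c → (𝒜.develop f x ≠ none ↔ 0 ≤ x 0) ∧
      (0 ≤ x 0 → 𝒜.Good (𝒜.develop f) x) ∧ (x 0 = 0 → 𝒜.develop f x = some (f (tail x))) := by
    intro x hx
    obtain ⟨t, ht, htc⟩ := exists_between hx
    exact ((hex' (tail x)).2.1 t htc).develops ht
  choose Ψ hΨ hΨev using fun u => (hex' u).2.2
  -- The canonical development reaches only below the height `c`; on the top face it is completed by
  -- the exit germs.
  set Φ : E4 → Option X := fun x =>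
    if x 0 < c then 𝒜.develop f x else if x 0 = c then Ψ (tail x) x else none with hΦ
  have hlow : ∀ x : E4, x 0 < c → 𝒜.develop f =ᶠ[𝓝 x] Φ := by
    intro x hx
    have ho : IsOpen {z : E4 | z 0 < c} := isOpen_lt (by fun_prop) continuous_const
    filter_upwards [ho.mem_nhds hx] with y hy using (if_pos hy).symm
  have htop : ∀ u, Ψ u =ᶠ[𝓝 (pt u c)] Φ := by
    intro u
    filter_upwards [(hΨev u).eventually_nhds, (hΨ u).eventually] with y hy hgood
    rcases lt_trichotomy (y 0) c with h | h | h
    · rw [← (hlow y h).self_of_nhds, (hy.self_of_nhds.2 h).self_of_nhds]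
    · have h1 : Φ y = Ψ (tail y) y := by simp [hΦ, h]
      rw [h1]
      have hy' : y = pt (tail y) c := by rw [← h, pt_tail]
      have h2 := hΨev (tail y)
      have h3 := hΨ (tail y)
      rw [← hy'] at h2 h3
      have hlim : Tendsto (fun s : ℝ => pt (tail y) s) (𝓝[<] c) (𝓝 y) := by
        have : Continuous fun s : ℝ => pt (tail y) s := by fun_prop
        have h4 := (this.tendsto c).mono_left (nhdsWithin_le_nhds (s := Iio c))
        rwa [← hy'] at h4
      -- Exit germs over neighbouring points agree on the top face, because both continue the same
      -- development from below.
      refine ((hgood (hy.self_of_nhds.1.2 h.le)).eventuallyEq_of_frequently h3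
        (hlim.frequently (Eventually.frequently ?_))).self_of_nhds
      filter_upwards [hlim.eventually hy, hlim.eventually h2, self_mem_nhdsWithin] with s hs hs' hsc
      have hsc : s < c := hsc
      exact ⟨(hs.2 hsc).symm.trans (hs'.2 hsc), hs.1.2 hsc.le⟩
    · have h1 : Φ y = none := by simp [hΦ, h.ne', not_lt.2 h.le]
      rw [h1]
      exact not_not.1 (mt hy.self_of_nhds.1.1 (not_le.2 h))
  refine ⟨Φ, Or.inr ⟨c, hc, ?_, ?_, ?_⟩⟩
  · intro x
    rcases lt_trichotomy (x 0) c with h | h | h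
    · rw [← (hlow x h).self_of_nhds, (hdev x h).1]
      exact ⟨fun h0 => ⟨h0, h.le⟩, fun h0 => h0.1⟩
    · have h1 := (htop (tail x)).self_of_nhds
      rw [← h, pt_tail] at h1
      have h2 := hΨ (tail x)
      rw [← h, pt_tail] at h2
      rw [← h1]
      exact ⟨fun _ => ⟨by rw [h]; exact hc.le, h.le⟩, fun _ => h2.ne_none⟩
    · have h1 : Φ x = none := by simp [hΦ, h.ne', not_lt.2 h.le]
      rw [h1]
      exact ⟨fun h => absurd rfl h, fun h' => absurd h'.2 (not_le.2 h)⟩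
  · rintro x ⟨h0, hxc⟩
    rcases hxc.lt_or_eq with h | h
    · exact ((hdev x h).2.1 h0).congr (hlow x h)
    · have h1 := (hΨ (tail x)).congr (htop (tail x))
      rwa [← h, pt_tail] at h1
  · intro v
    rw [← (hlow (pt v 0) hc).self_of_nhds]
    exact (hdev (pt v 0) hc).2.2 rfl

end Exit

end FlatAtlas

namespace FlatAtlas

variable {X : Type*} [MetricSpace X] {𝒜 : FlatAtlas X} {f : E3 → X} {Φ Ψ : E4 → Option X} {x y z w : E4}
  {Ω : Set E4} {p a b : X} {γ γ' : E4 ≃ᵃⁱ[ℝ] E4}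

/-! ### Deck transformations of the development. -/

section Deck

/-- The isometry `γ` is a deck transformation of `Φ`. -/
def IsDeck (Φ : E4 → Option X) (γ : E4 ≃ᵃⁱ[ℝ] E4) : Prop := ∀ z, Φ (γ z) = Φ z

lemma IsDeck.symm (h : IsDeck Φ γ) : IsDeck Φ γ.symm := fun z => by
  rw [← h (γ.symm z), γ.apply_symm_apply]

lemma IsDeck.trans (h : IsDeck Φ γ) (h' : IsDeck Φ γ') : IsDeck Φ (γ.trans γ') := fun z =>
  (h' (γ z)).trans (h z)

lemma Good.comp (h : 𝒜.Good Φ (γ x)) : 𝒜.Good (Φ ∘ γ) x := by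
  obtain ⟨p, A, hA, h⟩ := h
  exact ⟨p, γ.trans A, hA, h.comp_tendsto (γ.continuous.tendsto x)⟩

namespace IsDevelopment

lemma mem_iff_of_isDeck (h : 𝒜.IsDevelopment f Φ Ω) (hγ : IsDeck Φ γ) : γ x ∈ Ω ↔ x ∈ Ω := by
  rw [← h.ne_none_iff, ← h.ne_none_iff, hγ]

lemma exists_eq_some (h : 𝒜.IsDevelopment f Φ Ω) (hx : x ∈ Ω) : ∃ p, Φ x = some p :=
  Option.ne_none_iff_exists'.1 ((h.ne_none_iff x).2 hx)

lemma mem_of_eq_some (h : 𝒜.IsDevelopment f Φ Ω) (hx : Φ x = some p) : x ∈ Ω :=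
  (h.ne_none_iff x).1 (by simp [hx])

lemma exists_hasGerm (h : 𝒜.IsDevelopment f Φ Ω) (hx : Φ x = some p) : ∃ A, 𝒜.HasGerm Φ x p A := by
  obtain ⟨q, A, hA⟩ := h.good x (h.mem_of_eq_some hx)
  obtain rfl : q = p := Option.some_injective _ (hA.apply_eq.symm.trans hx)
  exact ⟨A, hA⟩

/-- The preimage of the model domain is convex, so a lift at one point extends over the whole model.
Every patch of `X` thus lifts at full size, as for a covering. -/
lemma exists_lift (h : 𝒜.IsDevelopment f Φ Ω) (hΩ : IsClosed Ω) (hz : Φ z = some ((𝒜.model p).q w))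
    (hw : w ∈ (𝒜.model p).dom) : ∃ B : E4 ≃ᵃⁱ[ℝ] E4, B z = w ∧
      ∀ y, B y ∈ (𝒜.model p).dom → Φ y = some ((𝒜.model p).q (B y)) := by
  obtain ⟨B, hBz, hB⟩ := (h.good z (h.mem_of_eq_some hz)).exists_lift hz hw
  refine ⟨B, hBz, fun y hy => ?_⟩
  have hC : IsPreconnected (B ⁻¹' (𝒜.model p).dom) := by
    have h1 : Convex ℝ (𝒜.model p).dom := (convex_halfSpaceOf _).inter (convex_ball _ _)
    exact (h1.affine_preimage B.toAffineEquiv.toAffineMap).isPreconnected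
  have h1 := eventuallyEq_of_isPreconnected (𝒜 := 𝒜) (Φ := (𝒜.model p).germ ∘ B) (Ψ := Φ) hC
    (fun x hx => (hasGerm_of_eventuallyEq EventuallyEq.rfl hx).elim fun _ h => h.good)
    (fun x _ hx => h.good x (hΩ.mem_of_frequently_of_tendsto
      (hx.mono fun y hy => (h.ne_none_iff y).1 hy) tendsto_id))
    (by rwa [mem_preimage, hBz]) hB.symm hy
  rw [← h1.self_of_nhds, Function.comp_apply, LocalModel.germ_of_mem hy]

/-- The development is surjective. -/
lemma surjective [ConnectedSpace X] (h : 𝒜.IsDevelopment f Φ Ω) (hΩ : IsClosed Ω) (p : X) :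
    ∃ x, Φ x = some p := by
  have hnhds : ∀ p, (𝒜.model p).q '' (𝒜.model p).dom ∈ 𝓝 p := fun p =>
    (𝒜.isAt p).image_mem_nhds _ (𝒜.isAt p).r_pos
  -- If a patch meets the image of `Φ`, it lies in the image. Hence the image is open and closed.
  have key : ∀ p, ∀ w ∈ (𝒜.model p).dom, (∃ x, Φ x = some ((𝒜.model p).q w)) →
      ∀ w' ∈ (𝒜.model p).dom, ∃ x, Φ x = some ((𝒜.model p).q w') := by
    rintro p w hw ⟨x, hx⟩ w' hw'
    obtain ⟨B, -, hB⟩ := h.exists_lift hΩ hx hw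
    exact ⟨B.symm w', by rw [hB _ (by rwa [B.apply_symm_apply]), B.apply_symm_apply]⟩
  have hopen : IsOpen {p | ∃ x, Φ x = some p} := by
    refine isOpen_iff_mem_nhds.2 fun p hp => mem_of_superset (hnhds p) ?_
    rintro _ ⟨w, hw, rfl⟩
    exact key p 0 (𝒜.isAt p).zero_mem_dom (by rwa [(𝒜.isAt p).q_zero]) w hw
  have hclosed : IsClosed {p | ∃ x, Φ x = some p} := by
    refine isClosed_iff_frequently.2 fun p hp => ?_
    obtain ⟨_, hx, w, hw, rfl⟩ := (hp.and_eventually (hnhds p)).exists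
    have h1 := key p w hw hx 0 (𝒜.isAt p).zero_mem_dom
    rwa [(𝒜.isAt p).q_zero] at h1
  have huniv := IsClopen.eq_univ ⟨hclosed, hopen⟩ ⟨f 0, pt 0 0, h.apply_pt 0⟩
  exact huniv.ge (mem_univ p)

lemma dist_le (h : 𝒜.IsDevelopment f Φ Ω) (hΩ : Convex ℝ Ω) (hx : Φ x = some a) (hy : Φ y = some b) :
    dist a b ≤ dist x y :=
  dist_le_of_good (fun _ hz => h.good _
    (hΩ.segment_subset (h.mem_of_eq_some hx) (h.mem_of_eq_some hy) hz)) hx hy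

/-- Unique continuation spreads the identity over `Ω`. -/
lemma isDeck_of_eventuallyEq (h : 𝒜.IsDevelopment f Φ Ω) (hΩ : Convex ℝ Ω) (hΩc : IsClosed Ω) (hx : x ∈ Ω)
    (hγ : Φ ∘ γ =ᶠ[𝓝 x] Φ) : IsDeck Φ γ := by
  have key : ∀ {γ : E4 ≃ᵃⁱ[ℝ] E4} {x}, x ∈ Ω → Φ ∘ γ =ᶠ[𝓝 x] Φ → ∀ z ∈ Ω, Φ (γ z) = Φ z := by
    intro γ x hx hγ z hz
    refine (eventuallyEq_of_isPreconnected (𝒜 := 𝒜) hΩ.isPreconnected h.good (fun y _ hy => ?_) hx hγ.symm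
      hz).self_of_nhds.symm
    refine Good.comp (h.good _ (hΩc.mem_of_frequently_of_tendsto
      (hy.mono fun z hz => (h.ne_none_iff _).1 hz) (γ.continuous.tendsto y)))
  intro z
  by_cases hz : z ∈ Ω
  · exact key hx hγ z hz
  -- A point outside `Ω` cannot be moved into `Ω`: the argument on `Ω` applies to the inverse of
  -- `γ`, starting at `γ x`.
  by_cases hz' : γ z ∈ Ω
  · have h1 : γ x ∈ Ω := (h.ne_none_iff _).1 ((key hx hγ x hx).trans_ne ((h.ne_none_iff x).2 hx))
    have h2 : Φ ∘ γ.symm =ᶠ[𝓝 (γ x)] Φ := by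
      have h3 : Tendsto γ.symm (𝓝 (γ x)) (𝓝 x) := by
        simpa using γ.symm.continuous.tendsto (γ x)
      filter_upwards [h3.eventually hγ] with y hy
      rw [Function.comp_apply, ← hy, Function.comp_apply, γ.apply_symm_apply]
    have h3 := key h1 h2 _ hz'
    rw [γ.symm_apply_apply] at h3
    exact h3.symm
  · rw [not_not.1 (mt (h.ne_none_iff _).1 hz), not_not.1 (mt (h.ne_none_iff _).1 hz')]

/-- Points with the same image differ by a deck transformation. -/
lemma exists_isDeck (h : 𝒜.IsDevelopment f Φ Ω) (hΩ : Convex ℝ Ω) (hΩc : IsClosed Ω) (hx : x ∈ Ω)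
    (hxy : Φ x = Φ y) : ∃ γ, IsDeck Φ γ ∧ γ x = y := by
  obtain ⟨p, hp⟩ := h.exists_eq_some hx
  obtain ⟨A, hA0, hA⟩ := h.exists_hasGerm hp
  obtain ⟨B, hB0, hB⟩ := h.exists_hasGerm (hxy.symm.trans hp)
  have h1 : (A.trans B.symm) x = y := by
    change B.symm (A x) = y
    rw [hA0, ← hB0, B.symm_apply_apply]
  refine ⟨A.trans B.symm, h.isDeck_of_eventuallyEq hΩ hΩc hx ?_, h1⟩
  have h2 : Tendsto (A.trans B.symm) (𝓝 x) (𝓝 y) := by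
    rw [← h1]; exact (A.trans B.symm).continuous.tendsto x
  filter_upwards [h2.eventually hB, hA] with z hz hz'
  rw [Function.comp_apply, hz, hz', Function.comp_apply, Function.comp_apply]
  congr 1
  exact B.apply_symm_apply _

/-- A deck transformation that fixes a point comes from the group of the local model there. -/
lemma exists_mem_of_isDeck (hγ : IsDeck Φ γ) (hx : γ x = x)
    {A : E4 ≃ᵃⁱ[ℝ] E4} (hA : 𝒜.HasGerm Φ x p A) : ∃ g ∈ (𝒜.model p).G, ∀ y, A (γ y) = g (A y) := by
  have h1 : Tendsto γ (𝓝 x) (𝓝 x) := by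
    have := γ.continuous.tendsto x
    rwa [hx] at this
  have h2 : (𝒜.model p).germ ∘ A =ᶠ[𝓝 x] (𝒜.model p).germ ∘ (γ.trans A) := by
    filter_upwards [hA.2, h1.eventually hA.2] with y hy hy'
    rw [← hy, ← hγ y, hy']; rfl
  exact (𝒜.isAt p).exists_eq_comp_of_germ_eventuallyEq (by rw [hA.1]; exact (𝒜.isAt p).zero_mem_dom) h2

/-- The group of a local model acts by deck transformations. -/
lemma isDeck_of_mem (h : 𝒜.IsDevelopment f Φ Ω) (hΩ : Convex ℝ Ω) (hΩc : IsClosed Ω)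
    {A : E4 ≃ᵃⁱ[ℝ] E4} (hA : 𝒜.HasGerm Φ x p A) {g : E4 ≃ₗᵢ[ℝ] E4} (hg : g ∈ (𝒜.model p).G) :
    IsDeck Φ ((A.trans g.toAffineIsometryEquiv).trans A.symm) := by
  set γ := (A.trans g.toAffineIsometryEquiv).trans A.symm with hγ
  have hAγ : ∀ y, A (γ y) = g (A y) := fun y => A.apply_symm_apply _
  have hγx : γ x = x := A.injective (by rw [hAγ, hA.1, map_zero])
  have h1 : Tendsto γ (𝓝 x) (𝓝 x) := by
    have := γ.continuous.tendsto x
    rwa [hγx] at this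
  refine h.isDeck_of_eventuallyEq hΩ hΩc (h.mem_of_eq_some hA.apply_eq) ?_
  filter_upwards [hA.2, h1.eventually hA.2] with y hy hy'
  rw [Function.comp_apply, hy, hy', Function.comp_apply, Function.comp_apply, hAγ, (𝒜.isAt p).germ_map hg]

/-- Nontrivial deck transformations have at most one fixed point. -/
lemma eq_of_isDeck_fixed (h : 𝒜.IsDevelopment f Φ Ω) (hγ : IsDeck Φ γ) (hx : x ∈ Ω) (hγx : γ x = x)
    (hγy : γ y = y) (hxy : x ≠ y) : ∀ z, γ z = z := by
  obtain ⟨p, A, hA⟩ := h.good x hx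
  obtain ⟨g, hg, hgA⟩ := exists_mem_of_isDeck hγ hγx hA
  by_cases h1 : g = 1
  · intro z
    refine A.injective ?_
    rw [hgA, h1]; rfl
  · have h2 := (𝒜.isAt p).free g hg h1 (A y) (by rw [← hgA, hγy])
    exact absurd (A.injective (hA.1.trans h2.symm)) hxy

/-- Locally `X` looks like the model, so a function whose pullback to ℝ⁴ is 1-Lipschitz passes the
infinitesimal test of `FlatAtlas.length`. Applied to the distance from an orbit it bounds the metric
of `X` from below. -/
lemma dist_ge (h : 𝒜.IsDevelopment f Φ Ω) (hsurj : ∀ p, ∃ x, Φ x = some p) {k : X → ℝ} {K : E4 → ℝ}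
    (hK : ∀ y z, |K y - K z| ≤ dist y z) (hk : ∀ y p, Φ y = some p → k p = K y) (a b : X) :
    |k a - k b| ≤ dist a b := by
  refine 𝒜.length k (fun p => ?_) a b
  obtain ⟨z, hz⟩ := hsurj p
  obtain ⟨A, hA⟩ := h.exists_hasGerm hz
  have h1 : Tendsto A.symm (𝓝 0) (𝓝 z) := by
    rw [← hA.1]
    simpa using A.symm.continuous.tendsto (A z)
  filter_upwards [nhdsWithin_le_nhds (h1.eventually hA.2), self_mem_nhdsWithin,
    nhdsWithin_le_nhds (Metric.ball_mem_nhds 0 (𝒜.isAt p).r_pos)] with w hw hwn hwr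
  rw [Function.comp_apply, A.apply_symm_apply, LocalModel.germ_of_mem ⟨hwn, hwr⟩] at hw
  rw [hk _ _ hw, hk _ _ hz]
  refine (hK _ _).trans_eq ?_
  rw [← A.dist_map, A.apply_symm_apply, hA.1, dist_zero_right]

/-- A germ identifies `Ω` near `x` with the model domain near 0, so boundary points of `X` are
exactly the images of frontier points of `Ω`. -/
lemma n_ne_zero_iff (h : 𝒜.IsDevelopment f Φ Ω) (hx : Φ x = some p) : (𝒜.model p).n ≠ 0 ↔ Ω ∉ 𝓝 x := by
  obtain ⟨A, hA⟩ := h.exists_hasGerm hx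
  rw [not_iff_not]
  have h1 : Ω ∈ 𝓝 x ↔ (𝒜.model p).dom ∈ 𝓝 (0 : E4) := by
    have h2 : Tendsto A (𝓝 x) (𝓝 0) := by rw [← hA.1]; exact A.continuous.tendsto x
    have h3 : Tendsto A.symm (𝓝 0) (𝓝 x) := by
      rw [← hA.1]
      simpa using A.symm.continuous.tendsto (A x)
    constructor
    · intro hΩ
      filter_upwards [h3.eventually hA.2, h3 hΩ] with w hw hw'
      rw [Function.comp_apply, A.apply_symm_apply] at hw
      rw [← LocalModel.germ_ne_none, ← hw]
      exact (h.ne_none_iff _).2 hw'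
    · intro hd
      filter_upwards [hA.2, h2 hd] with y hy hy'
      rw [← h.ne_none_iff, hy]
      exact LocalModel.germ_ne_none.2 hy'
  rw [h1]
  constructor
  · exact fun hn => LocalModel.mem_nhds_dom (Or.inl hn) (Metric.mem_ball_self (𝒜.isAt p).r_pos)
  · intro hd
    exact (LocalModel.inner_pos_of_mem_nhds_dom hd).resolve_right (by simp)

end IsDevelopment

end Deck

end FlatAtlas

/-! ### Counting boundary components. -/

section Components

lemma encard_componentsIn_of_isPreconnected {α : Type*} [TopologicalSpace α] {B : Set α} (hB : IsPreconnected B)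
    (hne : B.Nonempty) : (componentsIn B).encard = 1 := by
  rw [encard_eq_one]
  refine ⟨B, ?_⟩
  obtain ⟨x, hx⟩ := hne
  ext Y
  constructor
  · rintro ⟨y, hy, rfl⟩
    exact hB.connectedComponentIn hy
  · rintro rfl
    exact ⟨x, hx, hB.connectedComponentIn hx⟩

lemma encard_componentsIn_union {α : Type*} [TopologicalSpace α] {A C : Set α} (hA : IsPreconnected A)
    (hC : IsPreconnected C) (hAne : A.Nonempty) (hCne : C.Nonempty) (hAc : IsClosed A) (hCc : IsClosed C)
    (h : Disjoint A C) : (componentsIn (A ∪ C)).encard = 2 := by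
  have key : ∀ {A C : Set α}, IsPreconnected A → IsClosed A → IsClosed C → Disjoint A C → ∀ x ∈ A,
      connectedComponentIn (A ∪ C) x = A := by
    intro A C hA hAc hCc h x hx
    refine Subset.antisymm ?_ (hA.subset_connectedComponentIn hx subset_union_left)
    have h1 := isPreconnected_connectedComponentIn (x := x) (F := A ∪ C)
    have h2 := connectedComponentIn_subset (A ∪ C) x
    have hx' : x ∈ connectedComponentIn (A ∪ C) x := mem_connectedComponentIn (Or.inl hx)
    rcases isPreconnected_iff_subset_of_disjoint_closed.1 h1 A C hAc hCc h2
      (by rw [h.inter_eq, inter_empty]) with h3 | h3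
    · exact h3
    · exact absurd (h3 hx') (disjoint_left.1 h hx)
  rw [encard_eq_two]
  obtain ⟨x, hx⟩ := hAne
  obtain ⟨y, hy⟩ := hCne
  refine ⟨A, C, fun hAC => disjoint_left.1 h hx (hAC ▸ hx), ?_⟩
  have hAeq := key hA hAc hCc h
  have hCeq := key hC hCc hAc h.symm
  rw [union_comm] at hCeq
  ext Y
  constructor
  · rintro ⟨z, hz | hz, rfl⟩
    · exact Or.inl (hAeq z hz)
    · exact Or.inr (hCeq z hz)
  · rintro (rfl | rfl)
    · exact ⟨x, Or.inl hx, hAeq x hx⟩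
    · exact ⟨y, Or.inr hy, hCeq y hy⟩

end Components

namespace FlatAtlas

variable {X : Type*} [MetricSpace X] {𝒜 : FlatAtlas X} {f : E3 → X} {Φ Ψ : E4 → Option X} {x y z w : E4}
  {Ω : Set E4} {p a b : X} {γ γ' : E4 ≃ᵃⁱ[ℝ] E4} {c s : ℝ}

namespace IsDevelopment

/-! ### Trivial deck group and the half-space. -/

section Trivial

lemma pt_mem (h : 𝒜.IsDevelopment f Φ Ω) (v : E3) : pt v 0 ∈ Ω := h.mem_of_eq_some (h.apply_pt v)

lemma exists_mem_ne (h : 𝒜.IsDevelopment f Φ Ω) (z : E4) : ∃ y ∈ Ω, y ≠ z := by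
  by_contra! hall
  have h1 := (hall _ (h.pt_mem 0)).trans (hall _ (h.pt_mem (EuclideanSpace.single 0 1))).symm
  have h2 := congrArg tail h1
  rw [tail_pt, tail_pt] at h2
  simpa using congrArg (fun v => v 0) h2

variable [ConnectedSpace X]

lemma eq_of_eq_some (h : 𝒜.IsDevelopment f Φ Ω) (hΩ : Convex ℝ Ω) (hΩc : IsClosed Ω)
    (hdeck : ∀ γ, IsDeck Φ γ → ∀ z, γ z = z) (hx : Φ x = some p) (hy : Φ y = some p) : x = y := by
  obtain ⟨γ, hγ, hxy⟩ := h.exists_isDeck hΩ hΩc (h.mem_of_eq_some hx) (hx.trans hy.symm)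
  rw [← hxy, hdeck γ hγ]

/-- The lower bound comes from the distance to `x`, which descends to `X` because `Φ` is injective
on `Ω`. -/
lemma dist_eq (h : 𝒜.IsDevelopment f Φ Ω) (hΩ : Convex ℝ Ω) (hΩc : IsClosed Ω)
    (hdeck : ∀ γ, IsDeck Φ γ → ∀ z, γ z = z) (hx : Φ x = some a) (hy : Φ y = some b) :
    dist a b = dist x y := by
  refine le_antisymm (h.dist_le hΩ hx hy) ?_
  choose s hs using h.surjective hΩc
  have hk : ∀ z p, Φ z = some p → dist x (s p) = dist x z := fun z p hz => by
    rw [h.eq_of_eq_some hΩ hΩc hdeck (hs p) hz]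
  have h1 := h.dist_ge (h.surjective hΩc) (k := fun p => dist x (s p)) (K := fun z => dist x z)
    (fun y z => by rw [dist_comm x y, dist_comm x z]; exact abs_dist_sub_le y z x) hk b a
  rw [hk y b hy, hk x a hx, dist_self, sub_zero, dist_comm b a] at h1
  exact (le_abs_self _).trans h1

lemma nonempty_isometryEquiv (h : 𝒜.IsDevelopment f Φ Ω) (hΩ : Convex ℝ Ω) (hΩc : IsClosed Ω)
    (hdeck : ∀ γ, IsDeck Φ γ → ∀ z, γ z = z) : Nonempty (X ≃ᵢ Ω) := by
  choose s hs using h.surjective hΩc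
  have hiso : Isometry s := Isometry.of_dist_eq fun a b => (h.dist_eq hΩ hΩc hdeck (hs a) (hs b)).symm
  have hrange : range s = Ω := by
    ext x
    constructor
    · rintro ⟨p, rfl⟩
      exact h.mem_of_eq_some (hs p)
    · intro hx
      obtain ⟨p, hp⟩ := h.exists_eq_some hx
      exact ⟨p, h.eq_of_eq_some hΩ hΩc hdeck (hs p) hp⟩
  rw [← hrange]
  exact ⟨hiso.isometryEquivOnRange⟩

/-- A nontrivial element of a local group would give a nontrivial deck transformation. -/
lemma G_eq_bot (h : 𝒜.IsDevelopment f Φ Ω) (hΩ : Convex ℝ Ω) (hΩc : IsClosed Ω)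
    (hdeck : ∀ γ, IsDeck Φ γ → ∀ z, γ z = z) (p : X) : (𝒜.model p).G = ⊥ := by
  refine (Subgroup.eq_bot_iff_forall _).2 fun g hg => ?_
  by_contra hg1
  obtain ⟨z, hz⟩ := h.surjective hΩc p
  obtain ⟨A, hA⟩ := h.exists_hasGerm hz
  obtain ⟨y, -, hy⟩ := h.exists_mem_ne z
  have h1 := hdeck _ (h.isDeck_of_mem hΩ hΩc hA hg) y
  have h2 : g (A y) = A y := by
    have h3 := congrArg A h1
    rwa [show A ((A.trans g.toAffineIsometryEquiv).trans A.symm y) = g (A y) from A.apply_symm_apply _] at h3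
  exact hy (A.injective (((𝒜.isAt p).free g hg hg1 _ h2).trans hA.1.symm))

end Trivial

lemma mem_nhds_halfSpace_iff (hx : 0 ≤ x 0) : {x : E4 | 0 ≤ x 0} ∉ 𝓝 x ↔ x 0 = 0 := by
  constructor
  · intro h
    by_contra h0
    have ho : IsOpen {x : E4 | 0 < x 0} := isOpen_lt continuous_const (by fun_prop)
    exact h (mem_of_superset (ho.mem_nhds (lt_of_le_of_ne hx (Ne.symm h0))) fun y (hy : 0 < y 0) => show 0 ≤ y 0 from hy.le)
  · intro h0 hmem
    have hlim : Tendsto (fun t : ℝ => pt (tail x) t) (𝓝[<] 0) (𝓝 x) := by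
      have : Continuous fun t : ℝ => pt (tail x) t := by fun_prop
      have h1 := (this.tendsto (x 0)).mono_left (nhdsWithin_le_nhds (s := Iio (x 0)))
      rwa [pt_tail, h0] at h1
    obtain ⟨t, ht, ht0⟩ := ((hlim.eventually hmem).and self_mem_nhdsWithin).exists
    exact absurd (show 0 ≤ t from ht) (not_le.2 ht0)

lemma mem_nhds_slab_iff (hx : 0 ≤ x 0 ∧ x 0 ≤ c) :
    {x : E4 | 0 ≤ x 0 ∧ x 0 ≤ c} ∉ 𝓝 x ↔ x 0 = 0 ∨ x 0 = c := by
  constructor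
  · intro h
    by_contra! h0
    have ho : IsOpen {x : E4 | 0 < x 0 ∧ x 0 < c} :=
      IsOpen.inter (s := {x : E4 | 0 < x 0}) (t := {x : E4 | x 0 < c})
        (isOpen_lt continuous_const (by fun_prop)) (isOpen_lt (by fun_prop) continuous_const)
    exact h (mem_of_superset (ho.mem_nhds ⟨lt_of_le_of_ne hx.1 (Ne.symm h0.1), lt_of_le_of_ne hx.2 h0.2⟩)
      fun y hy => ⟨hy.1.le, hy.2.le⟩)
  · rintro (h0 | h0) hmem
    · exact (mem_nhds_halfSpace_iff hx.1).2 h0 (mem_of_superset hmem fun y hy => hy.1)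
    · have hlim : Tendsto (fun t : ℝ => pt (tail x) t) (𝓝[>] c) (𝓝 x) := by
        have : Continuous fun t : ℝ => pt (tail x) t := by fun_prop
        have h1 := (this.tendsto (x 0)).mono_left (nhdsWithin_le_nhds (s := Ioi (x 0)))
        rwa [pt_tail, h0] at h1
      obtain ⟨t, ht, ht0⟩ := ((hlim.eventually hmem).and self_mem_nhdsWithin).exists
      exact absurd (show t ≤ c from ht.2) (not_le.2 ht0)

lemma convex_slab (c : ℝ) : Convex ℝ {x : E4 | 0 ≤ x 0 ∧ x 0 ≤ c} :=
  (convex_halfSpace_ge (f := fun x : E4 => x 0) ⟨fun _ _ => rfl, fun _ _ => rfl⟩ 0).inter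
    (convex_halfSpace_le (f := fun x : E4 => x 0) ⟨fun _ _ => rfl, fun _ _ => rfl⟩ c)

lemma isClosed_slab (c : ℝ) : IsClosed {x : E4 | 0 ≤ x 0 ∧ x 0 ≤ c} :=
  IsClosed.inter (s₁ := {x : E4 | 0 ≤ x 0}) (s₂ := {x : E4 | x 0 ≤ c})
    (isClosed_le continuous_const (by fun_prop)) (isClosed_le (by fun_prop) continuous_const)

lemma convex_upper : Convex ℝ {x : E4 | 0 ≤ x 0} :=
  convex_halfSpace_ge (f := fun x : E4 => x 0) ⟨fun _ _ => rfl, fun _ _ => rfl⟩ 0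

lemma isClosed_upper : IsClosed {x : E4 | 0 ≤ x 0} := isClosed_le continuous_const (by fun_prop)

/-- This is where the embedding of the boundary component matters: two points of the bottom face
with the same image coincide. -/
lemma isDeck_fixed (h : 𝒜.IsDevelopment f Φ Ω) (hf : Function.Injective f) (hγ : IsDeck Φ γ)
    (hx : x 0 = 0) (hγx : (γ x) 0 = 0) : γ x = x := by
  have h1 := h.apply_pt (tail x)
  have h2 := h.apply_pt (tail (γ x))
  rw [← hx, pt_tail] at h1
  rw [← hγx, pt_tail, hγ, h1] at h2
  have h3 := hf (Option.some_injective _ h2)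
  rw [← pt_tail (γ x), ← h3, hγx, ← hx, pt_tail]

lemma eq_self_of_fixes_face (h : 𝒜.IsDevelopment f Φ Ω) (hf : Function.Injective f) (hγ : IsDeck Φ γ)
    (hγ0 : ∀ v, (γ (pt v 0)) 0 = 0) (z : E4) : γ z = z := by
  refine h.eq_of_isDeck_fixed hγ (h.pt_mem 0) (h.isDeck_fixed hf hγ rfl (hγ0 0))
    (h.isDeck_fixed (x := pt (EuclideanSpace.single 0 1) 0) hf hγ rfl (hγ0 _)) (fun heq => ?_) z
  have h2 := congrArg tail heq
  rw [tail_pt, tail_pt] at h2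
  simpa using congrArg (fun v => v 0) h2

lemma isPreconnected_face (h : 𝒜.IsDevelopment f Φ Ω) (hΩ : Convex ℝ Ω) {g : E3 → X}
    (hg : ∀ v, Φ (pt v s) = some (g v)) : IsPreconnected (range g) := by
  refine isPreconnected_range (LipschitzWith.continuous (K := 1) (LipschitzWith.of_dist_le_mul fun u v => ?_))
  rw [NNReal.coe_one, one_mul, ← dist_pt_pt_right u v s]
  exact h.dist_le hΩ (hg u) (hg v)

/-- Deck transformations preserve the frontier of `Ω`, which is the bottom face alone, so all of
them are trivial. -/
theorem halfSpace_of_upper [ConnectedSpace X] (h : 𝒜.IsDevelopment f Φ {x | 0 ≤ x 0})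
    (hf : Function.Injective f) : (∀ p, (𝒜.model p).G = ⊥) ∧
      (componentsIn {p | (𝒜.model p).n ≠ 0}).encard = 1 ∧ Nonempty (X ≃ᵢ halfSpace) := by
  have hface : ∀ {x : E4} {p}, Φ x = some p → ((𝒜.model p).n ≠ 0 ↔ x 0 = 0) := fun hx =>
    (h.n_ne_zero_iff hx).trans (mem_nhds_halfSpace_iff (h.mem_of_eq_some hx))
  have hdeck : ∀ γ, IsDeck Φ γ → ∀ z, γ z = z := fun γ hγ =>
    h.eq_self_of_fixes_face hf hγ fun v => by
      have h1 := h.apply_pt v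
      exact (hface ((hγ _).trans h1)).1 ((hface h1).2 rfl)
  refine ⟨h.G_eq_bot convex_upper isClosed_upper hdeck, ?_,
    h.nonempty_isometryEquiv convex_upper isClosed_upper hdeck⟩
  have hB : {p | (𝒜.model p).n ≠ 0} = range f := by
    ext p
    constructor
    · intro hp
      obtain ⟨x, hx⟩ := h.surjective isClosed_upper p
      have hx0 := (hface hx).1 hp
      refine ⟨tail x, Option.some_injective _ ?_⟩
      rw [← h.apply_pt, ← hx, ← hx0, pt_tail]
    · rintro ⟨v, rfl⟩
      exact (hface (h.apply_pt v)).2 rfl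
  rw [hB]
  exact encard_componentsIn_of_isPreconnected (h.isPreconnected_face convex_upper h.apply_pt)
    (range_nonempty f)

/-! ### Deck transformations of the slab. -/

section Slab

lemma slab_face_iff (h : 𝒜.IsDevelopment f Φ {x | 0 ≤ x 0 ∧ x 0 ≤ c}) (hx : Φ x = some p) :
    (𝒜.model p).n ≠ 0 ↔ x 0 = 0 ∨ x 0 = c :=
  (h.n_ne_zero_iff hx).trans (mem_nhds_slab_iff (h.mem_of_eq_some hx))

lemma isDeck_face (hc : 0 < c) (h : 𝒜.IsDevelopment f Φ {x | 0 ≤ x 0 ∧ x 0 ≤ c}) (hγ : IsDeck Φ γ)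
    (hs : s = 0 ∨ s = c) (v : E3) : (γ (pt v s)) 0 = 0 ∨ (γ (pt v s)) 0 = c := by
  have hmem : pt v s ∈ {x : E4 | 0 ≤ x 0 ∧ x 0 ≤ c} := by
    rcases hs with rfl | rfl
    · exact ⟨le_rfl, hc.le⟩
    · exact ⟨hc.le, le_rfl⟩
  obtain ⟨p, hp⟩ := h.exists_eq_some hmem
  exact (h.slab_face_iff ((hγ _).trans hp)).1 ((h.slab_face_iff hp).2 hs)

/-- By the intermediate value theorem a connected face cannot be spread over both faces. -/
lemma isDeck_face_eq (hc : 0 < c) (h : 𝒜.IsDevelopment f Φ {x | 0 ≤ x 0 ∧ x 0 ≤ c}) (hγ : IsDeck Φ γ)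
    (hs : s = 0 ∨ s = c) (u v : E3) : (γ (pt u s)) 0 = (γ (pt v s)) 0 := by
  have key : ∀ u v, (γ (pt u s)) 0 = 0 → (γ (pt v s)) 0 = c → False := by
    intro u v hu hv
    have hcont : Continuous fun v : E3 => (γ (pt v s)) 0 :=
      continuous_apply_zero.comp (γ.continuous.comp (by fun_prop))
    obtain ⟨w, hw⟩ := mem_range_of_exists_le_of_exists_ge hcont (c := c / 2)
      ⟨u, by simp only [hu]; linarith⟩ ⟨v, by simp only [hv]; linarith⟩
    have hw : (γ (pt w s)) 0 = c / 2 := hw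
    rcases h.isDeck_face hc hγ hs w with h1 | h1 <;> rw [hw] at h1 <;> linarith
  rcases h.isDeck_face hc hγ hs u with h1 | h1 <;> rcases h.isDeck_face hc hγ hs v with h2 | h2
  · rw [h1, h2]
  · exact (key u v h1 h2).elim
  · exact (key v u h2 h1).elim
  · rw [h1, h2]

lemma isDeck_swaps (hc : 0 < c) (h : 𝒜.IsDevelopment f Φ {x | 0 ≤ x 0 ∧ x 0 ≤ c})
    (hf : Function.Injective f) (hγ : IsDeck Φ γ) (hne : ¬ ∀ z, γ z = z) (v : E3) : (γ (pt v 0)) 0 = c := by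
  by_contra hv
  have h1 := (h.isDeck_face hc hγ (Or.inl rfl) v).resolve_right hv
  exact hne (h.eq_self_of_fixes_face hf hγ fun u => by
    rw [h.isDeck_face_eq hc hγ (Or.inl rfl) u v, h1])

/-- Two nontrivial deck transformations both send bottom to top, so their quotient sends bottom to
bottom and is trivial. -/
lemma isDeck_unique (hc : 0 < c) (h : 𝒜.IsDevelopment f Φ {x | 0 ≤ x 0 ∧ x 0 ≤ c})
    (hf : Function.Injective f) (hγ : IsDeck Φ γ) (hne : ¬ ∀ z, γ z = z) (hγ' : IsDeck Φ γ')
    (hne' : ¬ ∀ z, γ' z = z) (z : E4) : γ z = γ' z := by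
  have h1 := h.isDeck_swaps hc hf hγ hne 0
  have h2 := h.isDeck_swaps hc hf hγ' hne' 0
  by_contra hz
  have hδ := hγ.trans hγ'.symm
  have hne'' : ¬ ∀ z, (γ.trans γ'.symm) z = z := fun hall => hz (by
    have h3 : γ'.symm (γ z) = z := hall z
    have h4 := congrArg γ' h3
    rwa [γ'.apply_symm_apply] at h4)
  have h3 := h.isDeck_swaps hc hf hδ hne'' 0
  have h4 := h.isDeck_face_eq hc hγ'.symm (Or.inr rfl) (tail (γ (pt 0 0))) (tail (γ' (pt 0 0)))
  have h5 : pt (tail (γ (pt 0 0))) c = γ (pt 0 0) := by rw [← h1, pt_tail]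
  have h6 : pt (tail (γ' (pt 0 0))) c = γ' (pt 0 0) := by rw [← h2, pt_tail]
  rw [h5, h6, γ'.symm_apply_apply, pt_apply_zero] at h4
  have h3 : (γ'.symm (γ (pt 0 0))) 0 = c := h3
  linarith

lemma isDeck_involutive (hc : 0 < c) (h : 𝒜.IsDevelopment f Φ {x | 0 ≤ x 0 ∧ x 0 ≤ c})
    (hf : Function.Injective f) (hγ : IsDeck Φ γ) (hne : ¬ ∀ z, γ z = z) (z : E4) : γ (γ z) = z := by
  rw [h.isDeck_unique hc hf hγ hne hγ.symm (fun hall => hne fun z => by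
    have h1 := hall (γ z)
    rw [γ.symm_apply_apply] at h1
    exact h1.symm) (γ z), γ.symm_apply_apply]

/-- An involution fixes the midpoint of `z` and `γ z`. As only one fixed point is possible, all
these midpoints coincide. -/
lemma exists_center (hc : 0 < c) (h : 𝒜.IsDevelopment f Φ {x | 0 ≤ x 0 ∧ x 0 ≤ c})
    (hf : Function.Injective f) (hγ : IsDeck Φ γ) (hne : ¬ ∀ z, γ z = z) :
    ∃ m : E4, m 0 = c / 2 ∧ ∀ z, 0 ≤ z 0 ∧ z 0 ≤ c → γ z = m + m - z := by
  have hmid : ∀ z, γ (midpoint ℝ z (γ z)) = midpoint ℝ z (γ z) := by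
    intro z
    have h1 := γ.toAffineEquiv.toAffineMap.map_midpoint z (γ z)
    have h2 : γ (midpoint ℝ z (γ z)) = midpoint ℝ (γ z) (γ (γ z)) := h1
    rw [h2, h.isDeck_involutive hc hf hγ hne, midpoint_comm]
  have hmem : ∀ z, 0 ≤ z 0 ∧ z 0 ≤ c → midpoint ℝ z (γ z) ∈ {x : E4 | 0 ≤ x 0 ∧ x 0 ≤ c} := fun z hz =>
    (convex_slab c).segment_subset hz ((h.mem_iff_of_isDeck hγ).2 hz) (midpoint_mem_segment z (γ z))
  set m := midpoint ℝ (pt 0 0) (γ (pt 0 0)) with hm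
  have heq : ∀ z, 0 ≤ z 0 ∧ z 0 ≤ c → midpoint ℝ z (γ z) = m := by
    intro z hz
    by_contra hzm
    exact hne (h.eq_of_isDeck_fixed hγ (hmem z hz) (hmid z) (hmid _) hzm)
  have hadd : ∀ z, 0 ≤ z 0 ∧ z 0 ≤ c → γ z = m + m - z := by
    intro z hz
    have h1 := midpoint_add_self ℝ z (γ z)
    rw [heq z hz] at h1
    rw [h1]; abel
  refine ⟨m, ?_, hadd⟩
  have h1 := h.isDeck_swaps hc hf hγ hne 0
  rw [hadd _ ⟨le_rfl, hc.le⟩, PiLp.sub_apply, PiLp.add_apply, pt_apply_zero] at h1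
  linarith

end Slab

end IsDevelopment

end FlatAtlas

/-! ### The quotient of ℝ⁴ by the sign. -/

section SignQuotient

lemma dist_mk (x y : E4) : dist (R4modZ2.mk x) (R4modZ2.mk y) = min ‖x - y‖ ‖x + y‖ := rfl

lemma surjective_mk : Function.Surjective R4modZ2.mk := fun q => Quotient.exists_rep q

lemma mk_neg (x : E4) : R4modZ2.mk (-x) = R4modZ2.mk x := Quotient.sound (Or.inr rfl)

lemma continuous_mk : Continuous R4modZ2.mk :=
  LipschitzWith.continuous (K := 1) (LipschitzWith.of_dist_le_mul fun x y => by
    rw [NNReal.coe_one, one_mul, dist_mk, dist_eq_norm]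
    exact min_le_left _ _)

/-- The distance to the image of the hyperplane on which the first coordinate vanishes. -/
def height (q : R4modZ2) : ℝ := Quotient.lift (fun x : E4 => |x 0|) (by
  rintro x y (rfl | rfl)
  · rfl
  · change |(-y) 0| = |y 0|
    rw [PiLp.neg_apply, abs_neg]) q

lemma height_mk (x : E4) : height (R4modZ2.mk x) = |x 0| := rfl

lemma continuous_height : Continuous height :=
  LipschitzWith.continuous (K := 1) (LipschitzWith.of_dist_le_mul fun p q => by
    obtain ⟨x, rfl⟩ := surjective_mk p
    obtain ⟨y, rfl⟩ := surjective_mk q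
    rw [NNReal.coe_one, one_mul, dist_mk, height_mk, height_mk, Real.dist_eq]
    refine le_min ((abs_abs_sub_abs_le _ _).trans ?_) ?_
    · exact abs_apply_zero_le_norm (x - y)
    · have h1 := abs_abs_sub_abs_le (x 0) (-(y 0))
      rw [abs_neg, sub_neg_eq_add] at h1
      exact h1.trans (abs_apply_zero_le_norm (x + y)))

/-- The complement of the hyperplane is `height ≠ c`. A connected set through the origin cannot skip
the value `c`, while `height < c` is the image of a convex set. -/
lemma connectedComponentIn_compl_hyperplane {c : ℝ} (hc : 0 < c) :
    connectedComponentIn (R4modZ2.mk '' {x | inner ℝ (pt 0 1) x = c})ᶜ (R4modZ2.mk 0) =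
      {q | height q < c} := by
  have hinner : ∀ x : E4, inner ℝ (pt 0 1) x = x 0 := fun x => by
    rw [inner_eq_tail, pt_apply_zero, tail_pt, inner_zero_left, one_mul, add_zero]
  have hcompl : (R4modZ2.mk '' {x | inner ℝ (pt 0 1) x = c})ᶜ = {q | height q ≠ c} := by
    ext q
    obtain ⟨x, rfl⟩ := surjective_mk q
    rw [mem_compl_iff, not_iff_comm, mem_ofPred_eq, not_not, height_mk]
    constructor
    · intro h
      rcases (abs_eq hc.le).1 h with h | h
      · exact ⟨x, (hinner x).trans h, rfl⟩
      · refine ⟨-x, (hinner _).trans ?_, mk_neg x⟩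
        rw [PiLp.neg_apply, h, neg_neg]
    · rintro ⟨y, hy, hyx⟩
      have hy : inner ℝ (pt 0 1) y = c := hy
      rw [← height_mk, ← hyx, height_mk, ← hinner, hy, abs_of_pos hc]
  rw [hcompl]
  have h0 : R4modZ2.mk 0 ∈ {q | height q < c} := by
    change |(0 : E4) 0| < c
    simpa using hc
  refine Subset.antisymm (fun q hq => ?_) ?_
  · have hK := isPreconnected_connectedComponentIn (x := R4modZ2.mk 0) (F := {q | height q ≠ c})
    have hsub := connectedComponentIn_subset {q | height q ≠ c} (R4modZ2.mk 0)
    by_contra hq'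
    have h1 := hK.intermediate_value
      (mem_connectedComponentIn (show R4modZ2.mk 0 ∈ {q | height q ≠ c} from ne_of_lt h0)) hq
      continuous_height.continuousOn ⟨le_of_lt h0, not_lt.1 hq'⟩
    obtain ⟨q', hq', hqc⟩ := h1
    exact hsub hq' hqc
  · have h1 : {q | height q < c} = R4modZ2.mk '' {x | |x 0| < c} := by
      ext q
      obtain ⟨x, rfl⟩ := surjective_mk q
      constructor
      · exact fun h => ⟨x, h, rfl⟩
      · rintro ⟨y, hy, hyx⟩
        rw [← hyx]; exact hy
    refine IsPreconnected.subset_connectedComponentIn ?_ h0 fun q hq => ne_of_lt hq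
    rw [h1]
    have h2 : {x : E4 | |x 0| < c} = {x : E4 | -c < x 0} ∩ {x : E4 | x 0 < c} := by
      ext x
      exact abs_lt (a := x 0) (b := c)
    have h3 : Convex ℝ {x : E4 | |x 0| < c} := by
      rw [h2]
      exact (convex_halfSpace_gt (f := fun x : E4 => x 0) ⟨fun _ _ => rfl, fun _ _ => rfl⟩ _).inter
        (convex_halfSpace_lt (f := fun x : E4 => x 0) ⟨fun _ _ => rfl, fun _ _ => rfl⟩ _)
    exact h3.isPreconnected.image _ continuous_mk.continuousOn

/-- Shrinking towards the origin shows that points of height `c` belong to the closure. -/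
lemma halfSlabQuotient_eq {c : ℝ} (hc : 0 < c) :
    halfSlabQuotient (pt 0 1) c = {q | height q ≤ c} := by
  rw [halfSlabQuotient, connectedComponentIn_compl_hyperplane hc]
  refine Subset.antisymm (closure_minimal (fun q (hq : height q < c) => show height q ≤ c from hq.le)
    (isClosed_le continuous_height continuous_const)) fun q hq => ?_
  obtain ⟨x, rfl⟩ := surjective_mk q
  have hx : |x 0| ≤ c := hq
  have hlim : Tendsto (fun t : ℝ => R4modZ2.mk (t • x)) (𝓝[<] 1) (𝓝 (R4modZ2.mk x)) := by
    have : Continuous fun t : ℝ => R4modZ2.mk (t • x) := continuous_mk.comp (by fun_prop)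
    simpa using (this.tendsto 1).mono_left (nhdsWithin_le_nhds (s := Iio 1))
  refine mem_closure_of_tendsto hlim ?_
  filter_upwards [mem_nhdsWithin_of_mem_nhds (lt_mem_nhds zero_lt_one), self_mem_nhdsWithin] with t ht0 ht1
  have ht1 : t < 1 := ht1
  change |(t • x) 0| < c
  rw [PiLp.smul_apply, smul_eq_mul, abs_mul, abs_of_pos ht0]
  nlinarith [abs_nonneg (x 0)]

end SignQuotient

/-! ### The slab and its quotient by a point reflection. -/

namespace FlatAtlas

variable {X : Type*} [MetricSpace X] {𝒜 : FlatAtlas X} {f : E3 → X} {Φ : E4 → Option X} {x y z w m : E4}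
  {p a b : X} {γ : E4 ≃ᵃⁱ[ℝ] E4} {c : ℝ}

namespace IsDevelopment

variable [ConnectedSpace X]

/-- The boundary consists of two isometrically embedded copies of ℝ³, which are closed by
completeness of ℝ³ and disjoint by injectivity of `Φ`. -/
theorem slab_of_trivial_deck [CompleteSpace X] (hc : 0 < c)
    (h : 𝒜.IsDevelopment f Φ {x | 0 ≤ x 0 ∧ x 0 ≤ c}) (hdeck : ∀ γ, IsDeck Φ γ → ∀ z, γ z = z) :
    (∀ p, (𝒜.model p).G = ⊥) ∧ (componentsIn {p | (𝒜.model p).n ≠ 0}).encard = 2 ∧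
      Nonempty (X ≃ᵢ slab (pt 0 1) 0 c) := by
  refine ⟨h.G_eq_bot (convex_slab c) (isClosed_slab c) hdeck, ?_, ?_⟩
  · have hg : ∀ v, ∃ p, Φ (pt v c) = some p := fun v => h.exists_eq_some ⟨hc.le, le_rfl⟩
    choose g hg using hg
    have hclosed : ∀ {k : E3 → X} {s : ℝ}, (∀ v, Φ (pt v s) = some (k v)) → IsClosed (range k) := by
      intro k s hk
      refine (Isometry.of_dist_eq fun u v => ?_).isClosedEmbedding.isClosed_range
      rw [h.dist_eq (convex_slab c) (isClosed_slab c) hdeck (hk u) (hk v), dist_pt_pt_right]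
    have hB : {p | (𝒜.model p).n ≠ 0} = range f ∪ range g := by
      ext p
      constructor
      · intro hp
        obtain ⟨x, hx⟩ := h.surjective (isClosed_slab c) p
        rcases (h.slab_face_iff hx).1 hp with h0 | h0
        · exact Or.inl ⟨tail x, Option.some_injective _ (by rw [← h.apply_pt, ← hx, ← h0, pt_tail])⟩
        · exact Or.inr ⟨tail x, Option.some_injective _ (by rw [← hg, ← hx, ← h0, pt_tail])⟩
      · rintro (⟨v, rfl⟩ | ⟨v, rfl⟩)
        · exact (h.slab_face_iff (h.apply_pt v)).2 (Or.inl rfl)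
        · exact (h.slab_face_iff (hg v)).2 (Or.inr rfl)
    rw [hB]
    refine encard_componentsIn_union (h.isPreconnected_face (convex_slab c) h.apply_pt)
      (h.isPreconnected_face (convex_slab c) hg) (range_nonempty f) (range_nonempty g)
      (hclosed h.apply_pt) (hclosed hg) ?_
    rw [disjoint_left]
    rintro _ ⟨u, rfl⟩ ⟨v, hv⟩
    have h1 := h.eq_of_eq_some (convex_slab c) (isClosed_slab c) hdeck (h.apply_pt u) (hv ▸ hg v)
    have h2 : (0 : ℝ) = c := congrArg (fun x : E4 => x 0) h1
    exact hc.ne h2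
  · have h1 : slab (pt 0 1) 0 c = {x | 0 ≤ x 0 ∧ x 0 ≤ c} := by
      ext x
      have h2 : inner ℝ (pt 0 1) x = x 0 := by
        rw [inner_eq_tail, pt_apply_zero, tail_pt, inner_zero_left, one_mul, add_zero]
      rw [slab, mem_ofPred_eq, h2]
      rfl
    rw [h1]
    exact h.nonempty_isometryEquiv (convex_slab c) (isClosed_slab c) hdeck

/-- All fibres of `Φ` are pairs exchanged by the reflection in `m`. Its fixed point gives the single
orbifold point, and the exchange of the faces leaves one boundary component. -/
theorem halfSlabQuotient_of_deck (hc : 0 < c) (h : 𝒜.IsDevelopment f Φ {x | 0 ≤ x 0 ∧ x 0 ≤ c})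
    (hf : Function.Injective f) (hγ : IsDeck Φ γ) (hne : ¬ ∀ z, γ z = z) :
    (∃ p₀, {p | (𝒜.model p).G ≠ ⊥} = {p₀}) ∧ (componentsIn {p | (𝒜.model p).n ≠ 0}).encard = 1 ∧
      Nonempty (X ≃ᵢ halfSlabQuotient (pt 0 1) (c / 2)) := by
  obtain ⟨m, hm, hγm⟩ := h.exists_center hc hf hγ hne
  have hsurj := h.surjective (isClosed_slab c)
  have hmem : ∀ {x : E4} {p}, Φ x = some p → 0 ≤ x 0 ∧ x 0 ≤ c := fun hx => h.mem_of_eq_some hx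
  have hswap : ∀ {x : E4} {p}, Φ x = some p → Φ (m + m - x) = some p := fun hx => by
    rw [← hγm _ (hmem hx), hγ, hx]
  have hfib : ∀ {x y : E4} {p}, Φ x = some p → Φ y = some p → y = x ∨ y = m + m - x := by
    intro x y p hx hy
    obtain ⟨δ, hδ, rfl⟩ := h.exists_isDeck (convex_slab c) (isClosed_slab c) (h.mem_of_eq_some hx)
      (hx.trans hy.symm)
    by_cases hδ1 : ∀ z, δ z = z
    · exact Or.inl (hδ1 x)
    · right
      rw [h.isDeck_unique hc hf hδ hδ1 hγ hne, hγm _ (hmem hx)]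
  have hdist : ∀ {x y : E4} {a b}, Φ x = some a → Φ y = some b →
      dist a b = min (dist x y) (dist x (m + m - y)) := by
    intro x y a b hx hy
    refine le_antisymm (le_min (h.dist_le (convex_slab c) hx hy) (h.dist_le (convex_slab c) hx (hswap hy))) ?_
    choose s hs using hsurj
    -- The distance from `x` to the orbit of `z`; it is invariant under the reflection and so
    -- descends to `X`.
    set K : E4 → ℝ := fun z => min (dist x z) (dist x (m + m - z)) with hK
    have hK1 : ∀ y z, |K y - K z| ≤ dist y z := by
      intro y z
      refine (abs_min_sub_min_le_max _ _ _ _).trans (max_le ?_ ?_)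
      · rw [dist_comm x y, dist_comm x z]; exact abs_dist_sub_le y z x
      · rw [dist_comm x, dist_comm x]
        refine (abs_dist_sub_le _ _ x).trans_eq ?_
        rw [dist_sub_left]
    have hk : ∀ z p, Φ z = some p → K (s p) = K z := by
      intro z p hz
      rcases hfib hz (hs p) with h1 | h1
      · rw [h1]
      · simp only [hK]
        rw [h1, sub_sub_cancel, min_comm]
    have h1 := h.dist_ge (h.surjective (isClosed_slab c)) (k := fun p => K (s p)) hK1 hk b a
    have h2 : K x = 0 := by
      simp only [hK, dist_self]
      exact min_eq_left dist_nonneg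
    rw [hk y b hy, hk x a hx, h2, sub_zero, dist_comm b a] at h1
    exact (le_abs_self _).trans h1
  have hmΩ : m ∈ {x : E4 | 0 ≤ x 0 ∧ x 0 ≤ c} := ⟨by rw [hm]; linarith, by rw [hm]; linarith⟩
  obtain ⟨p₀, hp₀⟩ := h.exists_eq_some hmΩ
  refine ⟨⟨p₀, ?_⟩, ?_, ?_⟩
  · ext p
    constructor
    · intro hp
      obtain ⟨⟨g, hg⟩, hg1⟩ := Subgroup.ne_bot_iff_exists_ne_one.1 hp
      have hg1 : g ≠ 1 := fun h => hg1 (Subtype.ext h)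
      obtain ⟨z, hz⟩ := hsurj p
      obtain ⟨A, hA⟩ := h.exists_hasGerm hz
      set δ := (A.trans g.toAffineIsometryEquiv).trans A.symm with hδ
      have hAδ : ∀ y, A (δ y) = g (A y) := fun y => A.apply_symm_apply _
      have hδ1 : ¬ ∀ z, δ z = z := by
        intro hall
        refine hg1 (LinearIsometryEquiv.ext fun w => ?_)
        have h1 := hAδ (A.symm w)
        rw [hall, A.apply_symm_apply] at h1
        exact h1.symm
      have hδz : δ z = z := A.injective (by rw [hAδ, hA.1, map_zero])
      rw [h.isDeck_unique hc hf (h.isDeck_of_mem (convex_slab c) (isClosed_slab c) hA hg) hδ1 hγ hne,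
        hγm z (hmem hz)] at hδz
      have h1 : z = m := by
        have h2 : (2 : ℝ) • z = (2 : ℝ) • m := by
          rw [two_smul, two_smul]
          exact (sub_eq_iff_eq_add.1 hδz).symm
        exact smul_right_injective E4 (two_ne_zero (α := ℝ)) h2
      rw [h1, hp₀] at hz
      exact (Option.some_injective _ hz).symm
    · rintro rfl hbot
      obtain ⟨A, hA⟩ := h.exists_hasGerm hp₀
      obtain ⟨g, hg, hgA⟩ := exists_mem_of_isDeck hγ
        (by rw [hγm m hmΩ, add_sub_cancel_right]) hA
      rw [hbot, Subgroup.mem_bot] at hg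
      refine hne fun z => A.injective ?_
      rw [hgA, hg]; rfl
  · have hB : {p | (𝒜.model p).n ≠ 0} = range f := by
      ext p
      constructor
      · intro hp
        obtain ⟨x, hx⟩ := hsurj p
        have key : ∀ {x : E4}, Φ x = some p → x 0 = 0 → p ∈ range f := fun {x} hx h0 =>
          ⟨tail x, Option.some_injective _ (by rw [← h.apply_pt, ← hx, ← h0, pt_tail])⟩
        rcases (h.slab_face_iff hx).1 hp with h0 | h0
        · exact key hx h0
        · refine key (hswap hx) ?_
          rw [PiLp.sub_apply, PiLp.add_apply, hm, h0]; ring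
      · rintro ⟨v, rfl⟩
        exact (h.slab_face_iff (h.apply_pt v)).2 (Or.inl rfl)
    rw [hB]
    exact encard_componentsIn_of_isPreconnected (h.isPreconnected_face (convex_slab c) h.apply_pt)
      (range_nonempty f)
  · choose s hs using hsurj
    -- After translating `m` to the origin the reflection becomes `x ↦ -x`.
    have hiso : Isometry fun p => R4modZ2.mk (s p - m) := by
      refine Isometry.of_dist_eq fun a b => ?_
      rw [dist_mk, hdist (hs a) (hs b), dist_eq_norm, dist_eq_norm]
      congr 2 <;> abel
    have hrange : range (fun p => R4modZ2.mk (s p - m)) = halfSlabQuotient (pt 0 1) (c / 2) := by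
      rw [halfSlabQuotient_eq (half_pos hc)]
      ext q
      constructor
      · rintro ⟨p, rfl⟩
        have h1 := hmem (hs p)
        change |(s p - m) 0| ≤ c / 2
        rw [PiLp.sub_apply, hm, abs_le]
        constructor <;> linarith
      · obtain ⟨x, rfl⟩ := surjective_mk q
        intro hx
        have hx : |x 0| ≤ c / 2 := hx
        rw [abs_le] at hx
        obtain ⟨p, hp⟩ := h.exists_eq_some (x := m + x) (by
          constructor <;> rw [PiLp.add_apply, hm] <;> linarith)
        refine ⟨p, ?_⟩
        rcases hfib hp (hs p) with h1 | h1
        · simp only [h1]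
          congr 1; abel
        · simp only [h1]
          rw [← mk_neg]
          congr 1; abel
    rw [← hrange]
    exact ⟨hiso.isometryEquivOnRange⟩

end IsDevelopment

end FlatAtlas

end FlatOrbifold

end

open FlatOrbifold in
theorem mainTheorem10 {X : Type*} [MetricSpace X] (S : Finset X)
    [ChartedSpace (EuclideanHalfSpace 4) (Reg S)] [IsManifold (𝓡∂ 4) ∞ (Reg S)]
    [RiemannianBundle (fun x : Reg S => TangentSpace (𝓡∂ 4) x)]
    [IsContMDiffRiemannianBundle (𝓡∂ 4) ∞ E4 (fun x : Reg S => TangentSpace (𝓡∂ 4) x)]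
    (hX : IsFlatHyperkahlerOrbifold S) :
    (S.card = 0 ∧ (boundaryComponents (Reg S)).encard = 1 ∧ Nonempty (X ≃ᵢ halfSpace)) ∨
    (S.card = 0 ∧ (boundaryComponents (Reg S)).encard = 2 ∧
      ∃ (b : E4) (c₁ c₂ : ℝ), b ≠ 0 ∧ c₁ < c₂ ∧ Nonempty (X ≃ᵢ slab b c₁ c₂)) ∨
    (S.card = 1 ∧ (boundaryComponents (Reg S)).encard = 1 ∧
      ∃ (b : E4) (c : ℝ), b ≠ 0 ∧ c ≠ 0 ∧ Nonempty (X ≃ᵢ halfSlabQuotient b c)) := by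
  have := hX.connected
  have := hX.complete
  obtain ⟨𝒜, hS, hcard, hbd, p, hp⟩ := exists_flatAtlas hX
  rw [hbd] at hcard
  obtain ⟨Y, hY, hpY⟩ : p ∈ ⋃₀ 𝒜.boundary := 𝒜.sUnion_boundary ▸ hp
  obtain ⟨f, hf, hfY, hfJ⟩ := 𝒜.boundary_flat Y hY
  have hfb : 𝒜.IsBoundaryMap f := fun u => by
    have h1 : f u ∈ ⋃₀ 𝒜.boundary := ⟨Y, hY, hfY ▸ mem_range_self u⟩
    rw [𝒜.sUnion_boundary] at h1
    exact ⟨h1, hfJ u⟩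
  have hS0 : (∀ p, (𝒜.model p).G = ⊥) → S.card = 0 := fun h => by
    rw [Finset.card_eq_zero, ← Finset.coe_eq_empty, ← hS]
    exact eq_empty_of_forall_notMem fun p hp => hp (h p)
  obtain ⟨Φ, h | ⟨c, hc, h⟩⟩ := FlatAtlas.exists_isDevelopment hfb
  · obtain ⟨h1, h2, h3⟩ := h.halfSpace_of_upper hf
    exact Or.inl ⟨hS0 h1, hcard ▸ h2, h3⟩
  have hb : pt 0 1 ≠ 0 := fun h0 => one_ne_zero (congrArg (fun x : E4 => x 0) h0)
  by_cases hdeck : ∀ γ, FlatAtlas.IsDeck Φ γ → ∀ z, γ z = z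
  · obtain ⟨h1, h2, h3⟩ := h.slab_of_trivial_deck hc hdeck
    exact Or.inr (Or.inl ⟨hS0 h1, hcard ▸ h2, pt 0 1, 0, c, hb, hc, h3⟩)
  · simp only [not_forall] at hdeck
    obtain ⟨γ, hγ, hne⟩ := hdeck
    obtain ⟨⟨p₀, h1⟩, h2, h3⟩ := h.halfSlabQuotient_of_deck hc hf hγ (not_forall.2 hne)
    -- The slab has width `c` and is centred at the fixed point, so its faces are at distance `c /
    -- 2` from the origin of the quotient.
    refine Or.inr (Or.inr ⟨?_, hcard ▸ h2, pt 0 1, c / 2, hb, (half_pos hc).ne', h3⟩)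
    rw [hS, Finset.coe_eq_singleton] at h1
    rw [h1, Finset.card_singleton]
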